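/- Let $m\ge 2$, $\mathcal A=\{0,\dots,m-1\}$, and equip $\mathcal A^{\mathbb N}=\{\omega_1\omega_2\cdots:\omega_i\in\mathcal A\}$ with the metric $d(u,\omega)=m^{-\min\{i\ge 1:u_i\ne\omega_i\}}$ for $u\neq\omega$, $d(u,u)=0$, and the shift $(\sigma u)_i=u_{i+1}$; $\dim_{\rm H}$ is the Hausdorff dimension for $d$. Let $\Sigma\subset\mathcal A^{\mathbb N}$ be a subshift, that is, a closed set with $\sigma(\Sigma)\subset\Sigma$. Let $\Sigma^n$ be the set of prefixes of length $n$ of elements of $\Sigma$, and let $\Sigma^*=\bigcup_{n\ge1}\Sigma^n$. Assume that $0^\infty\in\Sigma$, that the topological entropy $h(\Sigma)=\lim_{n\to\infty}\frac{\log\sharp\Sigma^n}{n}$ is positive, and that $\Sigma$ has specification: there is $M\in\mathbb N$ such that for all $u,v\in\Sigma^*$ there is $w\in\Sigma^M$ with $uwv\in\Sigma^*$. For $\omega\in\Sigma$ and $n,N\ge1$ let $l_n(\omega)=\sup\{k\ge0:\omega_{n+i}=0\ \forall\,1\le i\le k\}\in\{0,1,\dots\}\cup\{\infty\}$ and $L_N(\omega)=\max_{1\le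 n\le N}l_n(\omega)$. Let $\psi:(0,\infty)\to(0,\infty)$ satisfy $\lim_{x\to\infty}\psi(x)=0$. For $0\le a\le b\le+\infty$ let $$\mathcal U_\psi(a,b)=\Big\{\omega\in\Sigma:\liminf_{N\to\infty}\tfrac{L_N(\omega)}{-\log_m\psi(N)}\ge a,\ \limsup_{N\to\infty}\tfrac{L_N(\omega)}{-\log_m\psi(N)}=b\Big\},$$ $$\mathcal U^*_\psi(a,b)=\Big\{\omega\in\Sigma:\liminf_{N\to\infty}\tfrac{L_N(\omega)}{-\log_m\psi(N)}=a,\ \limsup_{N\to\infty}\tfrac{L_N(\omega)}{-\log_m\psi(N)}=b\Big\}.$$ Suppose that $\tau=\lim_{N\to\infty}\frac{-\log_m\psi(N)}{N}\in[0,+\infty]$ exists. Then, for all $0\le a\le b\le+\infty$, the following hold. **Case I: $0<\tau<+\infty$.** (1) Suppose $a\ge\tau^{-1}$. If $b<+\infty$, then $\mathcal U^*_\psi(a,b)=\mathcal U_\psi(a,b)=\emptyset$. If $b=+\infty$, then $\dim_{\rm H}\mathcal U^*_\psi(a,b)=\dim_{\rm H}\mathcal U_\psi(a,b)=0$. (2)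 Suppose $0\le a<\tau^{-1}$. If $b<\frac{a}{1-\tau a}$, then $\mathcal U^*_\psi(a,b)=\mathcal U_\psi(a,b)=\emptyset$. If $b\ge\frac{a}{1-\tau a}$, then $$\dim_{\rm H}\mathcal U^*_\psi(a,b)=\dim_{\rm H}\mathcal U_\psi(a,b)=\frac{b(1-\tau a)-a}{(1+\tau b)(b-a)}\dim_{\rm H}\Sigma,$$ where the fraction is read as $1$ if $a=b=0$, and as $0$ (its limit as $b\to\infty$) if $b=+\infty$. **Case II: $\tau=+\infty$.** If $b>0$, then $\dim_{\rm H}\mathcal U^*_\psi(a,b)=\dim_{\rm H}\mathcal U_\psi(a,b)=0$. If $b=0$, then $\dim_{\rm H}\mathcal U^*_\psi(a,b)=\dim_{\rm H}\mathcal U_\psi(a,b)=\dim_{\rm H}\Sigma$. **Case III: $\tau=0$.** If in addition $\psi$ is strictly decreasing and $\lim_{N\to\infty}\frac{\log_m\psi(N-\log_m\psi(N))}{\log_m\psi(N)}=1$, then $\dim_{\rm H}\mathcal U^*_\psi(a,b)=\dim_{\rm H}\mathcal U_\psi(a,b)=\dim_{\rm H}\Sigma$. (The Hausdorff dimension of the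 empty set is $0$.) -/

import Mathlib

open Filter Topology Set
open scoped ENNReal

/-- Infinite words over the alphabet `{0, …, m-1}`. The letter `ω_i` (`i ≥ 1`) of the word
`ω = ω_1 ω_2 ⋯` is `ω (i - 1)`. -/
def SymbolicSpace (m : ℕ) : Type := ℕ → Fin m

namespace SymbolicSpace

variable {m : ℕ}

/-- The metric `d(u, v) = m ^ (-min {i ≥ 1 : u_i ≠ v_i})` for `u ≠ v`, and `d(u, u) = 0`. Here
`PiNat.firstDiff u v` is the first 0-based index where `u` and `v` differ. -/
noncomputable def wordDist (u v : SymbolicSpace m) : ℝ :=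
  open Classical in
  if u = v then 0 else ((m : ℝ)⁻¹) ^ (PiNat.firstDiff (E := fun _ => Fin m) u v + 1)

theorem wordDist_self (u : SymbolicSpace m) : wordDist u u = 0 := by simp [wordDist]

theorem wordDist_comm (u v : SymbolicSpace m) : wordDist u v = wordDist v u := by
  by_cases h : u = v
  · rw [h]
  · rw [wordDist, wordDist, if_neg h, if_neg (Ne.symm h),
      PiNat.firstDiff_comm (E := fun _ => Fin m) u v]

theorem wordDist_nonneg (u v : SymbolicSpace m) : 0 ≤ wordDist u v := by
  unfold wordDist
  split_ifs
  · exact le_rfl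
  · positivity

theorem pos_alphabet (u : SymbolicSpace m) : 0 < m := Fin.pos (u 0)

theorem eq_of_wordDist_eq_zero {u v : SymbolicSpace m} (h : wordDist u v = 0) : u = v := by
  by_contra hne
  have hm : (0 : ℝ) < m := Nat.cast_pos.2 (pos_alphabet u)
  rw [wordDist, if_neg hne] at h
  exact absurd h (by positivity)

theorem wordDist_triangle (u v w : SymbolicSpace m) :
    wordDist u w ≤ wordDist u v + wordDist v w := by
  by_cases huw : u = w
  · subst huw
    rw [wordDist_self]
    exact add_nonneg (wordDist_nonneg _ _) (wordDist_nonneg _ _)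
  by_cases huv : u = v
  · subst huv
    simp [wordDist_self]
  by_cases hvw : v = w
  · subst hvw
    simp [wordDist_self]
  have hm : (1 : ℝ) ≤ m := by exact_mod_cast pos_alphabet u
  have hle : (m : ℝ)⁻¹ ≤ 1 := inv_le_one_of_one_le₀ hm
  have hnn : (0 : ℝ) ≤ (m : ℝ)⁻¹ := by positivity
  have key := PiNat.min_firstDiff_le (E := fun _ => Fin m) u v w huw
  rcases min_le_iff.1 key with h | h
  · have : wordDist u w ≤ wordDist u v := by
      rw [wordDist, wordDist, if_neg huw, if_neg huv]
      exact pow_le_pow_of_le_one hnn hle (by omega)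
    linarith [wordDist_nonneg v w]
  · have : wordDist u w ≤ wordDist v w := by
      rw [wordDist, wordDist, if_neg huw, if_neg hvw]
      exact pow_le_pow_of_le_one hnn hle (by omega)
    linarith [wordDist_nonneg u v]

noncomputable instance : MetricSpace (SymbolicSpace m) where
  dist := wordDist
  dist_self := wordDist_self
  dist_comm := wordDist_comm
  dist_triangle := wordDist_triangle
  eq_of_dist_eq_zero := eq_of_wordDist_eq_zero

/-- The shift map `(σ u)_i = u_{i+1}`. -/
def shift (u : SymbolicSpace m) : SymbolicSpace m := fun i => u (i + 1)

/-- The infinite word `0^∞`. -/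
def zeroWord (m : ℕ) [NeZero m] : SymbolicSpace m := fun _ => 0

/-- A subshift: a closed set `S` with `σ(S) ⊆ S`. -/
structure IsSubshift (S : Set (SymbolicSpace m)) : Prop where
  isClosed : IsClosed S
  shift_mem : ∀ u ∈ S, shift u ∈ S

/-- The prefix `u_1 ⋯ u_n`. -/
def pref (u : SymbolicSpace m) (n : ℕ) : List (Fin m) := List.ofFn fun i : Fin n => u i

/-- `S^n`: the words of length `n` which are prefixes of elements of `S`. -/
def words (S : Set (SymbolicSpace m)) (n : ℕ) : Set (List (Fin m)) := (fun u => pref u n) '' S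

/-- `S^* = ⋃_{n ≥ 1} S^n`. -/
def language (S : Set (SymbolicSpace m)) : Set (List (Fin m)) := ⋃ n ≥ 1, words S n

/-- The specification property: there is `M` such that any two words `u`, `v` of `S^*` can be
joined by a word `w` of `S^M`, that is `u w v ∈ S^*`. -/
def HasSpecification (S : Set (SymbolicSpace m)) : Prop :=
  ∃ M : ℕ, ∀ u ∈ language S, ∀ v ∈ language S, ∃ w ∈ words S M, u ++ w ++ v ∈ language S

/-- The topological entropy `h(S) = lim_n (log #S^n) / n`; see `tendsto_entropy` for the existence
of the limit. -/
noncomputable def entropy (S : Set (SymbolicSpace m)) : ℝ :=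
  limUnder atTop fun n : ℕ => Real.log (words S n).ncard / n

theorem words_finite (S : Set (SymbolicSpace m)) (n : ℕ) : (words S n).Finite := by
  refine (Set.finite_range fun w : Fin n → Fin m => List.ofFn w).subset ?_
  rintro _ ⟨u, -, rfl⟩
  exact ⟨fun i => u i, rfl⟩

theorem shift_iterate_mem {S : Set (SymbolicSpace m)} (hS : IsSubshift S) {u : SymbolicSpace m}
    (hu : u ∈ S) (k : ℕ) : shift^[k] u ∈ S := by
  induction k with
  | zero => exact hu
  | succ k ih =>
    rw [Function.iterate_succ_apply']
    exact hS.shift_mem _ ih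

theorem shift_iterate_apply (u : SymbolicSpace m) (k i : ℕ) : (shift^[k] u) i = u (k + i) := by
  induction k generalizing i with
  | zero => simp
  | succ k ih =>
    rw [Function.iterate_succ_apply', shift, ih]
    congr 1
    omega

theorem ncard_words_add_le {S : Set (SymbolicSpace m)} (hS : IsSubshift S) (k l : ℕ) :
    (words S (k + l)).ncard ≤ (words S k).ncard * (words S l).ncard := by
  rw [← Set.ncard_prod]
  have hfin := (words_finite S k).prod (words_finite S l)
  refine (Set.ncard_le_ncard (t := (fun p : List (Fin m) × List (Fin m) => p.1 ++ p.2) ''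
    (words S k ×ˢ words S l)) ?_ (hfin.image _)).trans (Set.ncard_image_le hfin)
  rintro _ ⟨u, hu, rfl⟩
  refine ⟨(pref u k, pref (shift^[k] u) l),
    ⟨⟨u, hu, rfl⟩, ⟨_, shift_iterate_mem hS hu k, rfl⟩⟩, ?_⟩
  simp [pref, List.ofFn_add, shift_iterate_apply]

/-- For a nonempty subshift the limit defining the entropy exists. -/
theorem tendsto_entropy {S : Set (SymbolicSpace m)} (hS : IsSubshift S) (hne : S.Nonempty) :
    Tendsto (fun n : ℕ => Real.log (words S n).ncard / n) atTop (𝓝 (entropy S)) := by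
  have hpos : ∀ n, 0 < (words S n).ncard := fun n =>
    (Set.ncard_pos (words_finite S n)).2 (hne.image _)
  have hsub : Subadditive fun n : ℕ => Real.log (words S n).ncard := by
    intro k l
    have hk : ((words S k).ncard : ℝ) ≠ 0 := by exact_mod_cast (hpos k).ne'
    have hl : ((words S l).ncard : ℝ) ≠ 0 := by exact_mod_cast (hpos l).ne'
    rw [← Real.log_mul hk hl]
    exact Real.log_le_log (by exact_mod_cast hpos _) (by exact_mod_cast ncard_words_add_le hS k l)
  refine tendsto_nhds_limUnder ⟨_, hsub.tendsto_lim ⟨0, ?_⟩⟩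
  rintro _ ⟨n, rfl⟩
  have h1 : (1 : ℝ) ≤ (words S n).ncard := by exact_mod_cast hpos n
  exact div_nonneg (Real.log_nonneg h1) (Nat.cast_nonneg _)

/-- `l_n(ω) = sup {k ≥ 0 : ω_{n+i} = 0 for 1 ≤ i ≤ k}`, possibly `∞`. With 0-based indices the
letter `ω_{n+i}`, `1 ≤ i ≤ k`, is `ω (n + j)` with `j = i - 1 < k`. -/
noncomputable def zeroRun [NeZero m] (ω : SymbolicSpace m) (n : ℕ) : ℕ∞ :=
  ⨆ (k : ℕ) (_ : ∀ j < k, ω (n + j) = 0), (k : ℕ∞)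

/-- `L_N(ω) = max_{1 ≤ n ≤ N} l_n(ω)`. -/
noncomputable def maxZeroRun [NeZero m] (ω : SymbolicSpace m) (N : ℕ) : ℕ∞ :=
  (Finset.Icc 1 N).sup (zeroRun ω)

/-- The ratio `L_N(ω) / (-log_m ψ(N))` in `[0, ∞]`. The functions `ψ` of interest tend to `0`, so
`-log_m ψ(N) > 0` for all large `N`; the other values of `N` do not affect limits. -/
noncomputable def runRatio [NeZero m] (ψ : ℝ → ℝ) (ω : SymbolicSpace m) (N : ℕ) : ℝ≥0∞ :=
  (maxZeroRun ω N : ℝ≥0∞) / ENNReal.ofReal (-Real.logb m (ψ N))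

/-- `U_ψ(a, b)`: the points of `S` with `liminf ≥ a` and `limsup = b`. -/
def levelSet [NeZero m] (S : Set (SymbolicSpace m)) (ψ : ℝ → ℝ) (a b : ℝ≥0∞) :
    Set (SymbolicSpace m) :=
  {ω ∈ S | a ≤ liminf (runRatio ψ ω) atTop ∧ limsup (runRatio ψ ω) atTop = b}

/-- `U*_ψ(a, b)`: the points of `S` with `liminf = a` and `limsup = b`. -/
def levelSetStar [NeZero m] (S : Set (SymbolicSpace m)) (ψ : ℝ → ℝ) (a b : ℝ≥0∞) :
    Set (SymbolicSpace m) :=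
  {ω ∈ S | liminf (runRatio ψ ω) atTop = a ∧ limsup (runRatio ψ ω) atTop = b}

/-- The factor `(b (1 - τ a) - a) / ((1 + τ b) (b - a))` for `0 < τ < ∞`, `0 ≤ a < 1 / τ` and
`a / (1 - τ a) ≤ b ≤ ∞`. It is stipulated to be `1` when `a = b = 0`, and for `b = ∞` it is read as
its limit `0` as `b → ∞`. -/
noncomputable def dimFactor (τ a b : ℝ≥0∞) : ℝ≥0∞ :=
  open Classical in
  if a = 0 ∧ b = 0 then 1
  else if b = ∞ then 0
  else ENNReal.ofReal
    ((b.toReal * (1 - τ.toReal * a.toReal) - a.toReal) /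
      ((1 + τ.toReal * b.toReal) * (b.toReal - a.toReal)))

end SymbolicSpace

/-! Put F(N) = -log_m ψ(N). What matters about ω is when its record runs of zeros occur and how long
they are. If 0 < τ < ∞, then F(N)/N → τ, so the level sets are those of L_N/N with A = τa, B = τb
(`ratioSet_eq_natCast`).

Upper bound for finite B. If A N ≤ L_N ≤ B N for large N, every far nonzero letter at time n is
preceded by a run of length l starting at some s with A n ≤ l ≤ B s, up to bounded errors. If B(1 -
A) < A such a run does not fit (`runSet_eq_empty`). Otherwise it fills a proportion at least κ =
AB/(B - A) of the stretch from s to n; iterating backwards, only about (1 - κ)n of the first n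
letters are free (`exists_ncard_cutWords_le`). Infinitely often a run of length about B n follows
and lengthens the covering cylinders for free. The dimension is therefore at most (1 - κ)/(1 + B) =
(B(1 - A) - A)/((1 + B)(B - A)) times that of Σ (`dimH_ratioSet_le`). Free letters are counted by
`exists_ncard_words_le`: a finite cover of Σ by cylinders of total weight at most one gives a
recursion bounding the number of words by m^(sn) for every s > dim Σ.

Lower bound. By specification, a point x of Σ can be cut into blocks of length p, with fillers,
nonzero letters and runs of zeros inserted between them. A plan (`IsPlan`) says how long a record
run is and how long to wait for the next one: the ratio peaks at a record, giving the limsup b, and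
is smallest just before the next record, giving the liminf a (`PlanLimits.liminf_limsup_eq`). The
insertion map has a Hölder inverse whose exponent tends to (1 - κ)/(1 + B) as p → ∞
(`IsPlan.mul_dimH_le`). So dim Σ is transported directly and no measure has to be built.

Remaining cases. If bτ = ∞, then L_N ≥ K N infinitely often for every K; the first N letters then
determine K N letters, and the dimension is 0. If τ = ∞ and a = b = 0, all points outside such small
sets belong to the level set. If τ = 0, F is so slowly varying that records can be spaced to make
their zeros negligible (`IsSlow.mul_dimH_le`). -/

namespace SymbolicSpace

open MeasureTheory
open scoped NNReal

/-! ### Agreement of words and the metric -/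

section Basic

variable {m : ℕ}

/-- The words `u` and `v` have the same first `n` letters. -/
def Agree (u v : SymbolicSpace m) (n : ℕ) : Prop := ∀ i < n, u i = v i

theorem Agree.mono {u v : SymbolicSpace m} {n k : ℕ} (h : Agree u v n) (hk : k ≤ n) :
    Agree u v k := fun i hi => h i (hi.trans_le hk)

theorem Agree.symm {u v : SymbolicSpace m} {n : ℕ} (h : Agree u v n) : Agree v u n :=
  fun i hi => (h i hi).symm

theorem Agree.trans {u v w : SymbolicSpace m} {n : ℕ} (h : Agree u v n) (h' : Agree v w n) :
    Agree u w n := fun i hi => (h i hi).trans (h' i hi)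

theorem dist_def (u v : SymbolicSpace m) : dist u v = wordDist u v := rfl

theorem dist_le_of_agree {u v : SymbolicSpace m} {n : ℕ} (h : Agree u v n) :
    dist u v ≤ ((m : ℝ)⁻¹) ^ (n + 1) := by
  have hm : (1 : ℝ) ≤ m := by exact_mod_cast pos_alphabet u
  rw [dist_def, wordDist]
  split_ifs with huv
  · positivity
  · refine pow_le_pow_of_le_one (by positivity) (inv_le_one_of_one_le₀ hm) ?_
    by_contra! hlt
    exact PiNat.apply_firstDiff_ne (E := fun _ => Fin m) huv (h _ (by omega))

theorem exists_agree_dist_eq {u v : SymbolicSpace m} (huv : u ≠ v) :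
    ∃ n, Agree u v n ∧ u n ≠ v n ∧ dist u v = ((m : ℝ)⁻¹) ^ (n + 1) := by
  refine ⟨PiNat.firstDiff (E := fun _ => Fin m) u v,
    fun i hi => PiNat.apply_eq_of_lt_firstDiff (E := fun _ => Fin m) hi,
    PiNat.apply_firstDiff_ne (E := fun _ => Fin m) huv, ?_⟩
  rw [dist_def, wordDist, if_neg huv]

theorem agree_of_dist_le (hm : 2 ≤ m) {u v : SymbolicSpace m} {n : ℕ}
    (h : dist u v ≤ ((m : ℝ)⁻¹) ^ (n + 1)) : Agree u v n := by
  by_cases huv : u = v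
  · subst huv
    exact fun _ _ => rfl
  obtain ⟨k, hk, -, hd⟩ := exists_agree_dist_eq huv
  rw [hd] at h
  have hm' : (1 : ℝ) < m := by exact_mod_cast hm
  have := (pow_le_pow_iff_right_of_lt_one₀ (by positivity) (inv_lt_one_of_one_lt₀ hm')).1 h
  exact hk.mono (by omega)

theorem pref_eq_iff {u v : SymbolicSpace m} {n : ℕ} : pref u n = pref v n ↔ Agree u v n := by
  rw [pref, pref, List.ofFn_inj, funext_iff]
  exact ⟨fun h i hi => h ⟨i, hi⟩, fun h i => h i i.2⟩

theorem mem_of_agree (hm : 2 ≤ m) {S : Set (SymbolicSpace m)} (hS : IsClosed S)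
    {y : SymbolicSpace m} (h : ∀ n, ∃ u ∈ S, Agree y u n) : y ∈ S := by
  rw [← hS.closure_eq, Metric.mem_closure_iff]
  intro ε hε
  have hm' : (1 : ℝ) < m := by exact_mod_cast hm
  obtain ⟨n, hn⟩ := exists_pow_lt_of_lt_one hε (inv_lt_one_of_one_lt₀ hm')
  obtain ⟨u, hu, hyu⟩ := h n
  refine ⟨u, hu, lt_of_le_of_lt (dist_le_of_agree hyu) (lt_of_le_of_lt ?_ hn)⟩
  exact pow_le_pow_of_le_one (by positivity) (inv_lt_one_of_one_lt₀ hm').le (by omega)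

theorem isOpen_setOf_agree (hm : 2 ≤ m) (u : SymbolicSpace m) (n : ℕ) :
    IsOpen {v | Agree u v n} := by
  rw [Metric.isOpen_iff]
  intro v hv
  have hm' : (0 : ℝ) < m := by exact_mod_cast (by omega : 0 < m)
  refine ⟨((m : ℝ)⁻¹) ^ (n + 1), by positivity, fun w hw => ?_⟩
  rw [Metric.mem_ball'] at hw
  exact Agree.trans hv (agree_of_dist_le hm hw.le)

/-- The identity from the product topology to the metric is continuous, so Tychonoff applies. -/
theorem compactSpace (hm : 2 ≤ m) : CompactSpace (SymbolicSpace m) := by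
  have hm' : (1 : ℝ) < m := by exact_mod_cast hm
  let φ : (ℕ → Fin m) → SymbolicSpace m := fun u => u
  have hφ : Continuous φ := by
    rw [continuous_iff_continuousAt]
    intro u
    rw [ContinuousAt, Metric.tendsto_nhds]
    intro ε hε
    obtain ⟨n, hn⟩ := exists_pow_lt_of_lt_one hε (inv_lt_one_of_one_lt₀ hm')
    have ho := (PiNat.isOpen_cylinder (fun _ => Fin m) u n).mem_nhds (PiNat.self_mem_cylinder u n)
    filter_upwards [ho] with v hv
    refine lt_of_le_of_lt (dist_le_of_agree (n := n) fun i hi => hv i hi)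
      (lt_of_le_of_lt ?_ hn)
    exact pow_le_pow_of_le_one (by positivity) (inv_lt_one_of_one_lt₀ hm').le (by omega)
  have : IsCompact (Set.range φ) := isCompact_range hφ
  refine ⟨?_⟩
  convert this
  exact (Set.range_eq_univ.2 fun u => ⟨u, rfl⟩).symm

theorem ncard_words_le_pow (S : Set (SymbolicSpace m)) (n : ℕ) : (words S n).ncard ≤ m ^ n := by
  have h : words S n ⊆ Set.range (fun w : Fin n → Fin m => List.ofFn w) := by
    rintro _ ⟨u, -, rfl⟩
    exact ⟨fun i => u i, rfl⟩
  refine (Set.ncard_le_ncard h (Set.finite_range _)).trans ?_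
  rw [← Set.image_univ]
  refine (Set.ncard_image_le Set.finite_univ).trans ?_
  simp [Set.ncard_univ]

theorem words_mono {S S' : Set (SymbolicSpace m)} (h : S ⊆ S') (n : ℕ) :
    words S n ⊆ words S' n := Set.image_mono h

/-- Prefixes of length `k` determine prefixes of length `n`. -/
theorem ncard_words_le_of_agree {S S' : Set (SymbolicSpace m)} {k n : ℕ} (hSS : S ⊆ S')
    (h : ∀ u ∈ S, ∀ v ∈ S, Agree u v k → Agree u v n) :
    (words S n).ncard ≤ (words S' k).ncard := by
  classical
  refine le_trans ?_ (Set.ncard_le_ncard (words_mono hSS k) (words_finite _ _))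
  rcases S.eq_empty_or_nonempty with rfl | ⟨u₀, -⟩
  · simp [words]
  have : Nonempty (SymbolicSpace m) := ⟨u₀⟩
  have hsel : ∀ w ∈ words S k, ∃ u ∈ S, pref u k = w := fun w hw => hw
  choose! g hg1 hg2 using hsel
  refine (Set.ncard_le_ncard (t := (fun w => pref (g w) n) '' words S k) ?_
    ((words_finite _ _).image _)).trans (Set.ncard_image_le (words_finite _ _))
  rintro _ ⟨u, hu, rfl⟩
  have hw : pref u k ∈ words S k := ⟨u, hu, rfl⟩
  exact ⟨_, hw, pref_eq_iff.2 (h _ (hg1 _ hw) _ hu (pref_eq_iff.1 (hg2 _ hw)))⟩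

end Basic

/-! ### Runs of zeros -/

section Runs

variable {m : ℕ} [NeZero m]

/-- `l` consecutive zeros starting at the 0-based position `n`. -/
def IsRun (ω : SymbolicSpace m) (n l : ℕ) : Prop := ∀ j < l, ω (n + j) = 0

theorem IsRun.mono {ω : SymbolicSpace m} {n l k : ℕ} (h : IsRun ω n l) (hk : k ≤ l) :
    IsRun ω n k := fun j hj => h j (hj.trans_le hk)

theorem IsRun.add_le_of_ne_zero {ω : SymbolicSpace m} {n l i : ℕ} (h : IsRun ω n l) (hi : n ≤ i)
    (hω : ω i ≠ 0) : n + l ≤ i := by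
  by_contra! hlt
  obtain ⟨j, rfl⟩ := Nat.exists_eq_add_of_le hi
  exact hω (h j (by omega))

theorem natCast_le_zeroRun_iff {ω : SymbolicSpace m} {n l : ℕ} :
    (l : ℕ∞) ≤ zeroRun ω n ↔ IsRun ω n l := by
  constructor
  · intro h
    by_contra hne
    have hlt : ∀ k, (∀ j < k, ω (n + j) = 0) → k < l := fun k hk => by
      by_contra! hlk
      exact hne fun j hj => hk j (hj.trans_le hlk)
    have hl : 0 < l := by
      rcases Nat.eq_zero_or_pos l with rfl | h0
      · exact absurd (fun j hj => absurd hj (Nat.not_lt_zero j)) hne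
      · exact h0
    have : zeroRun ω n ≤ ((l - 1 : ℕ) : ℕ∞) :=
      iSup₂_le fun k hk => Nat.cast_le.2 (Nat.le_sub_one_of_lt (hlt k hk))
    have := Nat.cast_le.1 (h.trans this)
    omega
  · intro h
    exact le_iSup₂ (f := fun (k : ℕ) (_ : ∀ j < k, ω (n + j) = 0) => (k : ℕ∞)) l h

theorem natCast_le_maxZeroRun {ω : SymbolicSpace m} {n l N : ℕ} (hn : 1 ≤ n) (hN : n ≤ N)
    (h : IsRun ω n l) : (l : ℕ∞) ≤ maxZeroRun ω N :=
  (natCast_le_zeroRun_iff.2 h).trans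
    (Finset.le_sup (f := zeroRun ω) (Finset.mem_Icc.2 ⟨hn, hN⟩))

theorem exists_isRun_of_le_maxZeroRun {ω : SymbolicSpace m} {l N : ℕ} (hN : 1 ≤ N)
    (h : (l : ℕ∞) ≤ maxZeroRun ω N) : ∃ n, 1 ≤ n ∧ n ≤ N ∧ IsRun ω n l := by
  rcases Nat.eq_zero_or_pos l with rfl | hl
  · exact ⟨1, le_rfl, hN, fun j hj => absurd hj (Nat.not_lt_zero j)⟩
  · have hl' : (⊥ : ℕ∞) < l := by simpa using hl
    obtain ⟨n, hn, hle⟩ := (Finset.le_sup_iff hl').1 h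
    rw [Finset.mem_Icc] at hn
    exact ⟨n, hn.1, hn.2, natCast_le_zeroRun_iff.1 hle⟩

theorem maxZeroRun_le_natCast {ω : SymbolicSpace m} {N k : ℕ}
    (h : ∀ n l, 1 ≤ n → n ≤ N → IsRun ω n l → l ≤ k) : maxZeroRun ω N ≤ (k : ℕ∞) := by
  refine Finset.sup_le fun n hn => iSup₂_le fun l hl => ?_
  rw [Finset.mem_Icc] at hn
  exact Nat.cast_le.2 (h n l hn.1 hn.2 hl)

/-- A run of zeros extends to the left up to position `1` or a nonzero letter. -/
theorem IsRun.exists_extend {ω : SymbolicSpace m} {n l : ℕ} (h : IsRun ω n l) (hn : 1 ≤ n) :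
    ∃ s k, 1 ≤ s ∧ s ≤ n ∧ s + k = n + l ∧ IsRun ω s k ∧ (s = 1 ∨ ω (s - 1) ≠ 0) := by
  induction n, hn using Nat.le_induction generalizing l with
  | base => exact ⟨1, l, le_rfl, le_rfl, rfl, h, Or.inl rfl⟩
  | succ n hn ih =>
    by_cases h0 : ω n = 0
    · have h' : IsRun ω n (l + 1) := by
        intro j hj
        rcases Nat.eq_zero_or_pos j with rfl | hj0
        · exact h0
        · have := h (j - 1) (by omega)
          rwa [show n + 1 + (j - 1) = n + j by omega] at this
      obtain ⟨s, k, h1, h2, h3, h4, h5⟩ := ih h'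
      exact ⟨s, k, h1, by omega, by omega, h4, h5⟩
    · exact ⟨n + 1, l, by omega, le_rfl, rfl, h, Or.inr h0⟩

/-- The conversion of `L_N` to `[0, ∞]` used in `runRatio`. -/
theorem toENNReal_maxZeroRun_le {ω : SymbolicSpace m} {N k : ℕ}
    (h : maxZeroRun ω N ≤ (k : ℕ∞)) : (maxZeroRun ω N : ℝ≥0∞) ≤ (k : ℝ≥0∞) := by
  have := ENat.toENNReal_le.2 h
  simpa using this

theorem natCast_le_toENNReal_maxZeroRun {ω : SymbolicSpace m} {N k : ℕ} :
    (k : ℝ≥0∞) ≤ (maxZeroRun ω N : ℝ≥0∞) ↔ (k : ℕ∞) ≤ maxZeroRun ω N := by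
  rw [← ENat.toENNReal_le]
  simp

/-- A real lower bound for `L_N` gives a run of at least that length. -/
theorem exists_isRun_of_ofReal_le {ω : SymbolicSpace m} {N : ℕ} {r : ℝ} (hN : 1 ≤ N)
    (h : ENNReal.ofReal r ≤ (maxZeroRun ω N : ℝ≥0∞)) :
    ∃ n l : ℕ, 1 ≤ n ∧ n ≤ N ∧ r ≤ l ∧ IsRun ω n l := by
  have hk : ((⌈r⌉₊ : ℕ) : ℕ∞) ≤ maxZeroRun ω N := by
    cases hx : maxZeroRun ω N with
    | top => exact le_top
    | coe k =>
      rw [hx] at h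
      have h' : ENNReal.ofReal r ≤ ENNReal.ofReal k := by simpa using h
      rw [ENNReal.ofReal_le_ofReal_iff (Nat.cast_nonneg _)] at h'
      exact Nat.cast_le.2 (Nat.ceil_le.2 h')
  obtain ⟨n, h1, h2, h3⟩ := exists_isRun_of_le_maxZeroRun hN hk
  exact ⟨n, _, h1, h2, Nat.le_ceil _, h3⟩

/-- A real upper bound for `L_N` bounds the runs. -/
theorem IsRun.le_of_le_ofReal {ω : SymbolicSpace m} {N n l : ℕ} {r : ℝ} (hr : 0 ≤ r)
    (h : IsRun ω n l) (hn : 1 ≤ n) (hN : n ≤ N)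
    (hle : (maxZeroRun ω N : ℝ≥0∞) ≤ ENNReal.ofReal r) : (l : ℝ) ≤ r := by
  have h1 := natCast_le_toENNReal_maxZeroRun.2 (natCast_le_maxZeroRun hn hN h)
  have h2 := h1.trans hle
  rw [← ENNReal.ofReal_natCast, ENNReal.ofReal_le_ofReal_iff hr] at h2
  exact h2

end Runs

/-! ### Upper bounds for the Hausdorff dimension by coverings -/

section Covering

variable {m : ℕ}

theorem ediam_setOf_pref_le (w : List (Fin m)) (n : ℕ) :
    Metric.ediam {x : SymbolicSpace m | pref x n = w} ≤ ENNReal.ofReal (((m : ℝ)⁻¹) ^ (n + 1)) := by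
  refine Metric.ediam_le fun x hx y hy => ?_
  rw [edist_dist]
  exact ENNReal.ofReal_le_ofReal (dist_le_of_agree (pref_eq_iff.1 (hx.trans hy.symm)))

theorem inv_pow_succ_rpow_le (hm : 2 ≤ m) (n : ℕ) {s : ℝ} (hs : 0 ≤ s) :
    (((m : ℝ)⁻¹) ^ (n + 1)) ^ s ≤ (m : ℝ) ^ (-(s * n)) := by
  have hm' : (1 : ℝ) < m := by exact_mod_cast hm
  rw [← Real.rpow_natCast, ← Real.rpow_mul (by positivity), Real.inv_rpow (by positivity),
    ← Real.rpow_neg (by positivity)]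
  refine Real.rpow_le_rpow_of_exponent_le hm'.le ?_
  push_cast
  nlinarith

/-- A Borel-Cantelli type covering bound: points lying in infinitely many of the sets `A n`, where
`A n` is covered by its cylinders of length `len n`. -/
theorem dimH_le_of_frequently (hm : 2 ≤ m) {E : Set (SymbolicSpace m)}
    (A : ℕ → Set (SymbolicSpace m)) (len : ℕ → ℕ) (s : ℝ≥0)
    (hE : ∀ x ∈ E, ∃ᶠ n in atTop, x ∈ A n) (hlen : Tendsto len atTop atTop)
    (hsum : Summable fun n => ((words (A n) (len n)).ncard : ℝ) * (m : ℝ) ^ (-(s * len n : ℝ))) :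
    dimH E ≤ s := by
  borelize (SymbolicSpace m)
  have hm' : (1 : ℝ) < m := by exact_mod_cast hm
  refine dimH_le_of_hausdorffMeasure_ne_top (ne_top_of_le_ne_top hsum.tsum_ofReal_ne_top ?_)
  have hN : ∀ j : ℕ, ∃ N, ∀ n ≥ N, j ≤ len n := fun j =>
    eventually_atTop.1 (hlen.eventually_ge_atTop j)
  choose N hN using hN
  -- Only indices from `N j` on are used at stage `j`: all cylinders then have length at least `j`,
  -- and diameters tend to zero.
  let t : (j : ℕ) → (Σ n : ℕ, words (A (n + N j)) (len (n + N j))) → Set (SymbolicSpace m) :=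
    fun j p => {x | pref x (len (p.1 + N j)) = p.2}
  have hfin : ∀ n k, Finite (words (A n) k) := fun n k => (words_finite (A n) k).to_subtype
  refine (Measure.hausdorffMeasure_le_liminf_tsum (s : ℝ) E (l := atTop)
    (fun j : ℕ => ENNReal.ofReal (((m : ℝ)⁻¹) ^ j)) ?_ t ?_ ?_).trans ?_
  · rw [← ENNReal.ofReal_zero]
    exact ENNReal.tendsto_ofReal
      (tendsto_pow_atTop_nhds_zero_of_lt_one (by positivity) (inv_lt_one_of_one_lt₀ hm'))
  · refine Eventually.of_forall fun j p => (ediam_setOf_pref_le _ _).trans ?_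
    refine ENNReal.ofReal_le_ofReal (pow_le_pow_of_le_one (by positivity)
      (inv_lt_one_of_one_lt₀ hm').le ?_)
    have := hN j (p.1 + N j) (by omega)
    omega
  · refine Eventually.of_forall fun j x hx => ?_
    obtain ⟨n, hn, hxn⟩ := frequently_atTop.1 (hE x hx) (N j)
    obtain ⟨n, rfl⟩ := Nat.exists_eq_add_of_le' hn
    exact Set.mem_iUnion.2 ⟨⟨n, ⟨_, x, hxn, rfl⟩⟩, rfl⟩
  · refine liminf_le_of_le (by isBoundedDefault) fun c hc => ?_
    obtain ⟨j, hj⟩ := hc.exists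
    refine hj.trans ?_
    rw [ENNReal.tsum_sigma']
    refine le_trans (ENNReal.tsum_le_tsum (g := fun n => ENNReal.ofReal
      (((words (A (n + N j)) (len (n + N j))).ncard : ℝ) *
        (m : ℝ) ^ (-(s * len (n + N j) : ℝ)))) fun n => ?_) ?_
    · have hle : ∀ w : words (A (n + N j)) (len (n + N j)), Metric.ediam (t j ⟨n, w⟩) ^ (s : ℝ) ≤
          ENNReal.ofReal ((m : ℝ) ^ (-(s * len (n + N j) : ℝ))) := fun w => by
        refine (ENNReal.rpow_le_rpow (ediam_setOf_pref_le _ _) s.2).trans ?_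
        rw [ENNReal.ofReal_rpow_of_nonneg (by positivity) s.2]
        exact ENNReal.ofReal_le_ofReal (inv_pow_succ_rpow_le hm _ s.2)
      refine (ENNReal.tsum_le_tsum hle).trans (le_of_eq ?_)
      rw [ENNReal.tsum_const, ENNReal.ofReal_mul (Nat.cast_nonneg _), ENNReal.ofReal_natCast]
      congr 1
      have : (words (A (n + N j)) (len (n + N j))).encard =
          ((words (A (n + N j)) (len (n + N j))).ncard : ℕ∞) :=
        (words_finite _ _).cast_ncard_eq.symm
      rw [ENat.card_coe_set_eq, this, ENat.toENNReal_coe]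
    · exact ENNReal.tsum_comp_le_tsum_of_injective (add_left_injective (N j))
        (fun n => ENNReal.ofReal (((words (A n) (len n)).ncard : ℝ) *
          (m : ℝ) ^ (-(s * len n : ℝ))))

theorem rpow_neg_mul_natCast_eq (hm : 2 ≤ m) (c : ℝ) (n : ℕ) :
    (m : ℝ) ^ (-(c * n)) = ((m : ℝ) ^ (-c)) ^ n := by
  have hm' : (1 : ℝ) < m := by exact_mod_cast hm
  rw [← Real.rpow_natCast, ← Real.rpow_mul (by positivity)]
  ring_nf

theorem summable_rpow_neg_mul (hm : 2 ≤ m) {c : ℝ} (hc : 0 < c) :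
    Summable fun n : ℕ => (m : ℝ) ^ (-(c * n)) := by
  have hm' : (1 : ℝ) < m := by exact_mod_cast hm
  simp_rw [rpow_neg_mul_natCast_eq hm]
  exact summable_geometric_of_lt_one (by positivity)
    (Real.rpow_lt_one_of_one_lt_of_neg hm' (by linarith))

/-- Only finiteness matters: it permits limits in products with `dimH S`. The constant 2, rather
than 1, makes the series summable. -/
theorem dimH_le_two (hm : 2 ≤ m) (E : Set (SymbolicSpace m)) : dimH E ≤ 2 := by
  have hm' : (1 : ℝ) < m := by exact_mod_cast hm
  refine dimH_le_of_frequently hm (fun _ => univ) id 2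
    (fun x _ => (Eventually.of_forall fun _ => mem_univ x).frequently) tendsto_id ?_
  refine (summable_rpow_neg_mul hm one_pos).of_nonneg_of_le (fun n => by positivity) fun n => ?_
  calc ((words (univ : Set (SymbolicSpace m)) n).ncard : ℝ) * (m : ℝ) ^ (-(((2 : ℝ≥0) : ℝ) * n))
      ≤ (m : ℝ) ^ (n : ℝ) * (m : ℝ) ^ (-((2 : ℝ) * n)) := by
        refine mul_le_mul ?_ (le_of_eq (by simp)) (by positivity) (by positivity)
        rw [Real.rpow_natCast]
        exact_mod_cast ncard_words_le_pow _ _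
    _ = (m : ℝ) ^ (-(1 * (n : ℝ))) := by
        rw [← Real.rpow_add (by positivity)]
        ring_nf

theorem dimH_ne_top (hm : 2 ≤ m) (E : Set (SymbolicSpace m)) : dimH E ≠ ∞ :=
  ne_top_of_le_ne_top (by simp) (dimH_le_two hm E)

/-- The words whose longest run of zeros up to time `N` is infinitely often at least `K N` form a
set of dimension at most `2 / K`. -/
theorem dimH_setOf_frequently_long_runs_le [NeZero m] (hm : 2 ≤ m) {K : ℕ} (hK : 0 < K) :
    dimH {ω : SymbolicSpace m | ∃ᶠ N in atTop, ((K * N : ℕ) : ℕ∞) ≤ maxZeroRun ω N} ≤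
      ((2 / K : ℝ≥0) : ℝ≥0∞) := by
  have hm' : (1 : ℝ) < m := by exact_mod_cast hm
  refine dimH_le_of_frequently hm
    (fun N => {ω | 1 ≤ N ∧ ((K * N : ℕ) : ℕ∞) ≤ maxZeroRun ω N}) (fun N => K * N) (2 / K)
    (fun x hx => (hx.and_eventually (eventually_ge_atTop 1)).mono fun N h => ⟨h.2, h.1⟩)
    (tendsto_id.const_mul_atTop' hK) ?_
  refine (summable_rpow_neg_mul hm one_pos).of_nonneg_of_le (fun n => by positivity) fun N => ?_
  have hcard : (words {ω : SymbolicSpace m | 1 ≤ N ∧ ((K * N : ℕ) : ℕ∞) ≤ maxZeroRun ω N}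
      (K * N)).ncard ≤ m ^ N := by
    refine (ncard_words_le_of_agree (k := N) (subset_univ _) ?_).trans (ncard_words_le_pow _ _)
    -- A run of length `K * N` that starts by time `N` covers every position from `N` up to `K * N`,
    -- so the first `N` letters determine the first `K * N`.
    have hz : ∀ u ∈ {ω : SymbolicSpace m | 1 ≤ N ∧ ((K * N : ℕ) : ℕ∞) ≤ maxZeroRun ω N},
        ∀ i, N ≤ i → i < K * N → u i = 0 := by
      rintro u ⟨hN, hu⟩ i hi hiK
      obtain ⟨n, -, hn, hrun⟩ := exists_isRun_of_le_maxZeroRun hN hu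
      obtain ⟨j, rfl⟩ := Nat.exists_eq_add_of_le (hn.trans hi)
      exact hrun j (by omega)
    intro u hu v hv huv i hi
    rcases lt_or_ge i N with hiN | hiN
    · exact huv i hiN
    · rw [hz u hu i hiN hi, hz v hv i hiN hi]
  have hK' : (K : ℝ) ≠ 0 := by positivity
  calc ((words {ω : SymbolicSpace m | 1 ≤ N ∧ ((K * N : ℕ) : ℕ∞) ≤ maxZeroRun ω N}
          (K * N)).ncard : ℝ) * (m : ℝ) ^ (-(((2 / K : ℝ≥0) : ℝ) * ((K * N : ℕ) : ℝ)))
      ≤ (m : ℝ) ^ (N : ℝ) * (m : ℝ) ^ (-((2 : ℝ) * N)) := by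
        refine mul_le_mul ?_ (le_of_eq ?_) (by positivity) (by positivity)
        · rw [Real.rpow_natCast]
          exact_mod_cast hcard
        · congr 1
          push_cast
          field_simp
    _ = (m : ℝ) ^ (-(1 * (N : ℝ))) := by
        rw [← Real.rpow_add (by positivity)]
        ring_nf

end Covering

/-! ### Counting words -/

section Counting

variable {m : ℕ}

/-- A set of diameter less than one lies in a cylinder of comparable diameter. -/
theorem exists_cylinder_weight_le (hm : 2 ≤ m) {t : Set (SymbolicSpace m)} (ht : t.Nonempty)
    {s : ℝ} (hs : 0 < s) {e : ℝ≥0∞} (he : 0 < e) (hd : Metric.ediam t ^ s + e <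
      ENNReal.ofReal ((m : ℝ) ^ (-(2 * s)))) :
    ∃ (x : SymbolicSpace m) (n : ℕ), 1 ≤ n ∧ (∀ y ∈ t, Agree x y n) ∧
      ENNReal.ofReal ((m : ℝ) ^ (-(s * n))) ≤
        ENNReal.ofReal ((m : ℝ) ^ (2 * s)) * (Metric.ediam t ^ s + e) := by
  have hm' : (1 : ℝ) < m := by exact_mod_cast hm
  obtain ⟨x, hx⟩ := ht
  set δ : ℝ := (Metric.ediam t ^ s + e).toReal with hδ
  have htop : Metric.ediam t ^ s + e ≠ ∞ := hd.ne_top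
  have hδe : Metric.ediam t ^ s + e = ENNReal.ofReal δ := (ENNReal.ofReal_toReal htop).symm
  have hδ0 : 0 < δ := ENNReal.toReal_pos (by positivity) htop
  have hδ1 : δ < (m : ℝ) ^ (-(2 * s)) := by
    rw [hδe] at hd
    exact (ENNReal.ofReal_lt_ofReal_iff (by positivity)).1 hd
  set c : ℝ := (m : ℝ) ^ (-s) with hc
  have hc0 : 0 < c := by positivity
  have hc1 : c < 1 := Real.rpow_lt_one_of_one_lt_of_neg hm' (by linarith)
  have hcn : ∀ n : ℕ, (m : ℝ) ^ (-(s * n)) = c ^ n := fun n => rpow_neg_mul_natCast_eq hm s n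
  -- The length `n` is chosen with `c ^ (n + 2) < δ ≤ c ^ (n + 1)`: the right inequality gives
  -- agreement, the left one costs the factor `m ^ (2 * s)`. The summand `e` keeps `δ` positive when
  -- `t` is a single point, and `δ < c ^ 2` forces `n ≥ 1`.
  have hex : ∃ n : ℕ, c ^ n < δ := exists_pow_lt_of_lt_one hδ0 hc1
  classical
  have h2 : c ^ 2 = (m : ℝ) ^ (-(2 * s)) := by
    rw [← hcn]
    congr 1
    push_cast
    ring
  have hn : c ^ (Nat.find hex) < δ := Nat.find_spec hex
  have hn3 : 2 < Nat.find hex := by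
    by_contra! hle
    have := pow_le_pow_of_le_one hc0.le hc1.le hle
    linarith
  obtain ⟨n, hn'⟩ : ∃ n, Nat.find hex = n + 2 := ⟨Nat.find hex - 2, by omega⟩
  have hlow : δ ≤ c ^ (n + 1) := not_lt.1 (Nat.find_min hex (by omega))
  rw [hn'] at hn
  refine ⟨x, n, by omega, fun y hy => agree_of_dist_le hm ?_, ?_⟩
  · have h1 : edist x y ≤ Metric.ediam t := Metric.edist_le_ediam_of_mem hx hy
    have h3 : ENNReal.ofReal (dist x y ^ s) ≤ ENNReal.ofReal δ := by
      rw [← hδe, ← ENNReal.ofReal_rpow_of_nonneg dist_nonneg hs.le, ← edist_dist]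
      exact (ENNReal.rpow_le_rpow h1 hs.le).trans le_self_add
    rw [ENNReal.ofReal_le_ofReal_iff hδ0.le] at h3
    have h4 : (((m : ℝ)⁻¹) ^ (n + 1)) ^ s = c ^ (n + 1) := by
      rw [hc, ← Real.rpow_natCast, ← Real.rpow_mul (by positivity), Real.inv_rpow (by positivity),
        ← Real.rpow_neg (by positivity), ← Real.rpow_natCast, ← Real.rpow_mul (by positivity)]
      ring_nf
    rw [← Real.rpow_le_rpow_iff dist_nonneg (by positivity) hs, h4]
    exact h3.trans hlow
  · rw [hδe, ← ENNReal.ofReal_mul (by positivity)]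
    refine ENNReal.ofReal_le_ofReal ?_
    have h5 : (m : ℝ) ^ (2 * s) * c ^ 2 = 1 := by
      rw [h2, ← Real.rpow_add (by positivity)]
      simp
    rw [hcn]
    calc c ^ n = (m : ℝ) ^ (2 * s) * c ^ (n + 2) := by
          rw [pow_add, mul_comm (c ^ n), ← mul_assoc, h5, one_mul]
      _ ≤ (m : ℝ) ^ (2 * s) * δ := by gcongr

/-- A subshift of dimension less than `s` has a finite cover by cylinders of total weight at most
one. -/
theorem exists_finite_cylinder_cover (hm : 2 ≤ m) {S : Set (SymbolicSpace m)} (hS : IsClosed S)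
    {s : ℝ≥0} (hs : 0 < s) (hdim : dimH S < s) :
    ∃ (F : Finset ℕ) (x : ℕ → SymbolicSpace m) (n : ℕ → ℕ), (∀ i ∈ F, 1 ≤ n i) ∧
      (∀ y ∈ S, ∃ i ∈ F, Agree (x i) y (n i)) ∧ ∑ i ∈ F, (m : ℝ) ^ (-(s * n i : ℝ)) ≤ 1 := by
  classical
  borelize (SymbolicSpace m)
  have hm' : (1 : ℝ) < m := by exact_mod_cast hm
  rcases S.eq_empty_or_nonempty with rfl | ⟨x₀, hx₀⟩
  · exact ⟨∅, fun _ _ => ⟨0, by omega⟩, fun _ => 1, by simp, by simp, by simp⟩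
  have hzero : Measure.hausdorffMeasure (s : ℝ) S = 0 := hausdorffMeasure_of_dimH_lt hdim
  -- `w` is both the threshold required by `exists_cylinder_weight_le` and the inverse of the factor
  -- lost there, so a total below `w` becomes a total weight at most one.
  set w : ℝ≥0∞ := ENNReal.ofReal ((m : ℝ) ^ (-(2 * (s : ℝ)))) with hw
  have hw0 : w ≠ 0 := by
    rw [hw, ne_eq, ENNReal.ofReal_eq_zero, not_le]
    positivity
  have hww : ENNReal.ofReal ((m : ℝ) ^ (2 * (s : ℝ))) * w = 1 := by
    rw [hw, ← ENNReal.ofReal_mul (by positivity), ← Real.rpow_add (by positivity)]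
    simp
  have hw2 : 0 < w / 2 := ENNReal.half_pos hw0
  obtain ⟨e, he0, hesum⟩ := ENNReal.exists_pos_sum_of_countable' hw2.ne' ℕ
  have hlt : Measure.hausdorffMeasure (s : ℝ) S < w / 2 := by rw [hzero]; exact hw2
  rw [Measure.hausdorffMeasure_apply] at hlt
  have hlt1 := (le_iSup₂ (f := fun (r : ℝ≥0∞) (_ : 0 < r) =>
    ⨅ (t : ℕ → Set (SymbolicSpace m)) (_ : S ⊆ ⋃ n, t n) (_ : ∀ n, Metric.ediam (t n) ≤ r),
      ∑' n, ⨆ _ : (t n).Nonempty, Metric.ediam (t n) ^ (s : ℝ)) 1 one_pos).trans_lt hlt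
  simp only [iInf_lt_iff] at hlt1
  obtain ⟨t, hcov, -, hsum⟩ := hlt1
  have htot : ∑' n, ((⨆ _ : (t n).Nonempty, Metric.ediam (t n) ^ (s : ℝ)) + e n) < w := by
    rw [ENNReal.tsum_add]
    calc _ < w / 2 + w / 2 := ENNReal.add_lt_add hsum hesum
      _ = w := ENNReal.add_halves w
  have hsel : ∀ i, ∃ (x : SymbolicSpace m) (n : ℕ), (t i).Nonempty → (1 ≤ n ∧
      (∀ y ∈ t i, Agree x y n) ∧ ENNReal.ofReal ((m : ℝ) ^ (-((s : ℝ) * n))) ≤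
        ENNReal.ofReal ((m : ℝ) ^ (2 * (s : ℝ))) *
          ((⨆ _ : (t i).Nonempty, Metric.ediam (t i) ^ (s : ℝ)) + e i)) := by
    intro i
    by_cases hi : (t i).Nonempty
    · have hlt2 := (ENNReal.le_tsum i).trans_lt htot
      simp only [hi, iSup_pos] at hlt2 ⊢
      obtain ⟨x, n, h⟩ := exists_cylinder_weight_le hm hi (NNReal.coe_pos.2 hs) (he0 i) hlt2
      exact ⟨x, n, fun _ => h⟩
    · exact ⟨x₀, 0, fun h => absurd h hi⟩
  choose x n hxn using hsel
  have := compactSpace hm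
  obtain ⟨F, hF⟩ := hS.isCompact.elim_finite_subcover
    (fun i : {i // (t i).Nonempty} => {y | Agree (x i) y (n i)})
    (fun i => isOpen_setOf_agree hm _ _) (fun y hy => by
      obtain ⟨i, hi⟩ := Set.mem_iUnion.1 (hcov hy)
      exact Set.mem_iUnion.2 ⟨⟨i, ⟨y, hi⟩⟩, (hxn i ⟨y, hi⟩).2.1 y hi⟩)
  refine ⟨F.map (Function.Embedding.subtype _), x, n, ?_, ?_, ?_⟩
  · intro i hi
    obtain ⟨j, -, rfl⟩ := Finset.mem_map.1 hi
    exact (hxn j j.2).1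
  · intro y hy
    obtain ⟨i, hiF, hi⟩ := Set.mem_iUnion₂.1 (hF hy)
    exact ⟨i, Finset.mem_map.2 ⟨i, hiF, rfl⟩, hi⟩
  · rw [← ENNReal.ofReal_le_ofReal_iff zero_le_one, ENNReal.ofReal_one,
      ENNReal.ofReal_sum_of_nonneg (fun i _ => by positivity)]
    calc ∑ i ∈ F.map (Function.Embedding.subtype _), ENNReal.ofReal ((m : ℝ) ^ (-(s * n i : ℝ)))
        ≤ ∑ i ∈ F.map (Function.Embedding.subtype _), ENNReal.ofReal ((m : ℝ) ^ (2 * (s : ℝ))) *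
          ((⨆ _ : (t i).Nonempty, Metric.ediam (t i) ^ (s : ℝ)) + e i) := by
          refine Finset.sum_le_sum fun i hi => ?_
          obtain ⟨j, -, rfl⟩ := Finset.mem_map.1 hi
          exact (hxn j j.2).2.2
      _ ≤ ENNReal.ofReal ((m : ℝ) ^ (2 * (s : ℝ))) *
          ∑' i, ((⨆ _ : (t i).Nonempty, Metric.ediam (t i) ^ (s : ℝ)) + e i) := by
          rw [← Finset.mul_sum]
          gcongr
          exact ENNReal.sum_le_tsum _
      _ ≤ ENNReal.ofReal ((m : ℝ) ^ (2 * (s : ℝ))) * w := by gcongr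
      _ = 1 := hww

theorem pref_add (u : SymbolicSpace m) (k l : ℕ) :
    pref u (k + l) = pref u k ++ pref (shift^[k] u) l := by
  simp [pref, List.ofFn_add, shift_iterate_apply]

/-- The number of words of length `n` of a subshift is at most of order `m ^ (s n)` for every `s`
larger than the Hausdorff dimension. -/
theorem exists_ncard_words_le (hm : 2 ≤ m) {S : Set (SymbolicSpace m)} (hS : IsSubshift S)
    {s : ℝ} (hdim : dimH S < ENNReal.ofReal s) :
    ∃ C : ℝ, 1 ≤ C ∧ ∀ n, ((words S n).ncard : ℝ) ≤ C * (m : ℝ) ^ (s * n) := by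
  classical
  have hm' : (1 : ℝ) < m := by exact_mod_cast hm
  have hs : 0 < s := ENNReal.ofReal_pos.1 (lt_of_le_of_lt zero_le hdim)
  obtain ⟨F, x, n, hn1, hcov, hsum⟩ := exists_finite_cylinder_cover hm hS.isClosed
    (s := s.toNNReal) (Real.toNNReal_pos.2 hs) hdim
  rw [Real.coe_toNNReal _ hs.le] at hsum
  set K := F.sup n with hK
  have hC : (1 : ℝ) ≤ (m : ℝ) ^ K := one_le_pow₀ hm'.le
  refine ⟨(m : ℝ) ^ K, hC, fun k => ?_⟩
  induction k using Nat.strong_induction_on with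
  | _ k ih =>
  rcases lt_or_ge k K with hk | hk
  · calc ((words S k).ncard : ℝ) ≤ (m : ℝ) ^ k := by exact_mod_cast ncard_words_le_pow S k
      _ ≤ (m : ℝ) ^ K := pow_le_pow_right₀ hm'.le hk.le
      _ ≤ (m : ℝ) ^ K * (m : ℝ) ^ (s * k) := by
        refine le_mul_of_one_le_right (by positivity) (Real.one_le_rpow hm'.le (by positivity))
  · have hnk : ∀ i ∈ F, n i ≤ k := fun i hi => (Finset.le_sup hi).trans hk
    -- Every word of length `k` begins with one of the finitely many cylinder words, and what
    -- remains is a shorter word of `S`. Since the weights sum to at most one, the bound reproduces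
    -- itself without loss; `n i ≥ 1` makes the recursion strict.
    have hsub : words S k ⊆ ⋃ i : F, (fun v => pref (x i) (n i) ++ v) '' words S (k - n i) := by
      rintro _ ⟨u, hu, rfl⟩
      obtain ⟨i, hi, hiu⟩ := hcov u hu
      refine Set.mem_iUnion.2 ⟨⟨i, hi⟩, pref (shift^[n i] u) (k - n i),
        ⟨_, shift_iterate_mem hS hu _, rfl⟩, ?_⟩
      dsimp only
      rw [pref_eq_iff.2 hiu, ← pref_add, Nat.add_sub_cancel' (hnk i hi)]
    have hcard : (words S k).ncard ≤ ∑ i : F, (words S (k - n i)).ncard := by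
      refine (Set.ncard_le_ncard hsub (Set.finite_iUnion fun i => (words_finite _ _).image _)).trans
        ((Set.ncard_iUnion_le_of_fintype _).trans (Finset.sum_le_sum fun i _ => ?_))
      exact Set.ncard_image_le (words_finite _ _)
    rw [Finset.sum_coe_sort F fun i => (words S (k - n i)).ncard] at hcard
    calc ((words S k).ncard : ℝ) ≤ ∑ i ∈ F, ((words S (k - n i)).ncard : ℝ) := by
          exact_mod_cast hcard
      _ ≤ ∑ i ∈ F, (m : ℝ) ^ K * (m : ℝ) ^ (s * k) * (m : ℝ) ^ (-(s * n i)) := by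
          refine Finset.sum_le_sum fun i hi => ?_
          have h1 := hn1 i hi
          have h2 := hnk i hi
          refine (ih (k - n i) (by omega)).trans (le_of_eq ?_)
          rw [mul_assoc, ← Real.rpow_add (by positivity), Nat.cast_sub h2]
          ring_nf
      _ = (m : ℝ) ^ K * (m : ℝ) ^ (s * k) * ∑ i ∈ F, (m : ℝ) ^ (-(s * n i)) := by
          rw [Finset.mul_sum]
      _ ≤ (m : ℝ) ^ K * (m : ℝ) ^ (s * k) :=
          mul_le_of_le_one_right (by positivity) hsum

end Counting

/-! ### Words all of whose prefixes have runs of zeros of proportional length -/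

section RunSet

variable {m : ℕ} [NeZero m]

/-- The points of `S` with `A N ≤ L_N ≤ B N` for all `N ≥ N₀`. -/
def runSet (S : Set (SymbolicSpace m)) (A B : ℝ) (N₀ : ℕ) : Set (SymbolicSpace m) :=
  {ω ∈ S | (∀ N ≥ N₀, ∃ n l : ℕ, 1 ≤ n ∧ n ≤ N ∧ A * N ≤ l ∧ IsRun ω n l) ∧
    ∀ N ≥ N₀, ∀ n l : ℕ, 1 ≤ n → n ≤ N → IsRun ω n l → (l : ℝ) ≤ B * N}

/-- A run longer than `B * K` cannot extend back to a start before `K`, since it would violate the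
upper bound at time `K`. As `K ≥ 2`, the leftward extension stops at a nonzero letter and not at
position 1. -/
theorem exists_maximal_run_of_large {S : Set (SymbolicSpace m)} {A B : ℝ} {N₀ K : ℕ}
    (hK : N₀ ≤ K) (hK2 : 2 ≤ K) {ω : SymbolicSpace m} (hω : ω ∈ runSet S A B N₀) {n l : ℕ}
    (hn : 1 ≤ n) (hl : B * K < l) (hrun : IsRun ω n l) :
    ∃ s k : ℕ, K ≤ s ∧ s ≤ n ∧ s + k = n + l ∧ ω (s - 1) ≠ 0 ∧ IsRun ω s k := by
  obtain ⟨s, k, h1, h2, h3, h4, h5⟩ := hrun.exists_extend hn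
  have hKs : K ≤ s := by
    by_contra! hlt
    have := hω.2.2 K hK s k h1 hlt.le h4
    have hlk : (l : ℝ) ≤ k := by exact_mod_cast (by omega : l ≤ k)
    linarith
  exact ⟨s, k, hKs, h2, h3, h5.resolve_left (by omega), h4⟩

/-- The lower bound at time `n - 1` supplies the run. It is too long to start before `N₀`, and the
nonzero letter at index `n - 1` ends it before `n`. -/
theorem exists_run_before (S : Set (SymbolicSpace m)) {A : ℝ} (B : ℝ) (hA : 0 < A) {N₀ : ℕ}
    (hN₀ : 2 ≤ N₀) : ∃ N₁ : ℕ, ∀ ω ∈ runSet S A B N₀, ∀ n ≥ N₁, ω (n - 1) ≠ 0 →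
      ∃ s l : ℕ, N₀ ≤ s ∧ s + l < n ∧ ω (s - 1) ≠ 0 ∧ IsRun ω s l ∧ A * (n - 1) ≤ l ∧
        (l : ℝ) ≤ B * s := by
  obtain ⟨K, hK⟩ := exists_nat_gt (B * N₀ / A)
  refine ⟨N₀ + K + 1, fun ω hω n hn hne => ?_⟩
  obtain ⟨n₁, l₁, h1, h2, h3, h4⟩ := hω.2.1 (n - 1) (by omega)
  have hcast : ((n - 1 : ℕ) : ℝ) = n - 1 := by
    rw [Nat.cast_sub (by omega)]
    simp
  rw [hcast] at h3
  have hnK : (K : ℝ) ≤ n - 1 := by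
    rw [← hcast]
    exact_mod_cast (by omega : K ≤ n - 1)
  rw [div_lt_iff₀ hA] at hK
  obtain ⟨s, k, hs1, hs2, hs3, hs4, hs5⟩ := exists_maximal_run_of_large le_rfl hN₀ hω h1
    (by nlinarith) h4
  have hend := h4.add_le_of_ne_zero h2 hne
  refine ⟨s, k, hs1, by omega, hs4, hs5, h3.trans ?_, hω.2.2 s hs1 s k (by omega) le_rfl hs5⟩
  exact_mod_cast (by omega : l₁ ≤ k)

/-- Nonzero letters occur arbitrarily late, since otherwise runs would be unbounded. Before one of
them, `A * (s + l) ≤ l ≤ B * s`; hence `A * s ≤ (1 - A) * l`, which contradicts `B * (1 - A) < A`.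
-/
theorem runSet_eq_empty (S : Set (SymbolicSpace m)) {A B : ℝ} (hA : 0 < A)
    (hAB : B * (1 - A) < A) {N₀ : ℕ} (hN₀ : 2 ≤ N₀) : runSet S A B N₀ = ∅ := by
  refine Set.eq_empty_of_forall_notMem fun ω hω => ?_
  obtain ⟨N₁, hN₁⟩ := exists_run_before S B hA hN₀
  obtain ⟨n, hn, hne⟩ : ∃ n ≥ N₁, ω (n - 1) ≠ 0 := by
    by_contra! h
    obtain ⟨K, hK⟩ := exists_nat_gt (B * ((N₀ + N₁ : ℕ) : ℝ))
    have := hω.2.2 (N₀ + N₁) (by omega) (N₀ + N₁) K (by omega) le_rfl fun j _ => by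
      have := h (N₀ + N₁ + j + 1) (by omega)
      simpa using this
    linarith
  obtain ⟨s, l, h1, h2, -, -, h3, h4⟩ := hN₁ ω hω n hn hne
  have hs : (0 : ℝ) < s := by exact_mod_cast (by omega : 0 < s)
  have hsl : (s : ℝ) + l ≤ n - 1 := by
    have : s + l + 1 ≤ n := h2
    have : (s : ℝ) + l + 1 ≤ n := by exact_mod_cast this
    linarith
  have h5 : A * (s + l) ≤ l := (mul_le_mul_of_nonneg_left hsl hA.le).trans h3
  have hl0 : (0 : ℝ) ≤ l := Nat.cast_nonneg _
  rcases le_or_gt (1 - A) 0 with h6 | h6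
  · nlinarith
  · nlinarith

/-- The words of length `n` of `runSet S A B N₀` which end with a nonzero letter. -/
def cutWords (S : Set (SymbolicSpace m)) (A B : ℝ) (N₀ n : ℕ) : Set (List (Fin m)) :=
  words {ω ∈ runSet S A B N₀ | ω (n - 1) ≠ 0} n

theorem cutWords_finite (S : Set (SymbolicSpace m)) (A B : ℝ) (N₀ n : ℕ) :
    (cutWords S A B N₀ n).Finite := words_finite _ _

theorem cutWords_subset_words (S : Set (SymbolicSpace m)) (A B : ℝ) (N₀ n : ℕ) :
    cutWords S A B N₀ n ⊆ words S n := words_mono (fun _ h => h.1.1) n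

theorem pref_eq_replicate {ω : SymbolicSpace m} {n l : ℕ} (h : IsRun ω n l) :
    pref (shift^[n] ω) l = List.replicate l 0 := by
  rw [pref, ← List.ofFn_const]
  congr 1
  ext i
  rw [shift_iterate_apply, h i i.2]

/-- Cutting at the run of `exists_run_before` writes a word as a shorter cut word, a block of zeros,
and an arbitrary word of `S`. The conditions on the pair `p` are those satisfied by the start and
the length of the run. -/
theorem ncard_cutWords_le {S : Set (SymbolicSpace m)} (hS : IsSubshift S) {A : ℝ} (B : ℝ)
    (hA : 0 < A) {N₀ : ℕ} (hN₀ : 2 ≤ N₀) : ∃ N₁ : ℕ, ∀ n ≥ N₁,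
      (cutWords S A B N₀ n).ncard ≤ ∑ p ∈ (Finset.range n ×ˢ Finset.range n) with
        p.1 + p.2 < n ∧ A * (n - 1) ≤ p.2 ∧ (p.2 : ℝ) ≤ B * p.1,
        (cutWords S A B N₀ p.1).ncard * (words S (n - p.1 - p.2)).ncard := by
  classical
  obtain ⟨N₁, hN₁⟩ := exists_run_before S B hA hN₀
  refine ⟨N₁, fun n hn => ?_⟩
  set G := (Finset.range n ×ˢ Finset.range n).filter fun p : ℕ × ℕ =>
    p.1 + p.2 < n ∧ A * (n - 1) ≤ p.2 ∧ (p.2 : ℝ) ≤ B * p.1 with hG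
  let T : ℕ × ℕ → Set (List (Fin m)) := fun p =>
    (fun q : List (Fin m) × List (Fin m) => q.1 ++ List.replicate p.2 0 ++ q.2) ''
      (cutWords S A B N₀ p.1 ×ˢ words S (n - p.1 - p.2))
  have hTfin : ∀ p, (T p).Finite := fun p =>
    ((cutWords_finite S A B N₀ p.1).prod (words_finite _ _)).image _
  have hsub : cutWords S A B N₀ n ⊆ ⋃ p : G, T p := by
    rintro _ ⟨ω, ⟨hω, hne⟩, rfl⟩
    obtain ⟨s, l, h1, h2, h3, h4, h5, h6⟩ := hN₁ ω hω n hn hne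
    have hmem : (s, l) ∈ G := by
      rw [hG, Finset.mem_filter, Finset.mem_product, Finset.mem_range, Finset.mem_range]
      exact ⟨⟨by omega, by omega⟩, h2, h5, h6⟩
    refine Set.mem_iUnion.2 ⟨⟨(s, l), hmem⟩, (pref ω s, pref (shift^[s + l] ω) (n - s - l)),
      ⟨⟨ω, ⟨hω, h3⟩, rfl⟩, ⟨_, shift_iterate_mem hS hω.1 _, rfl⟩⟩, ?_⟩
    dsimp only
    rw [← pref_eq_replicate h4, ← pref_add, ← pref_add]
    congr 1
    omega
  refine (Set.ncard_le_ncard hsub (Set.finite_iUnion fun i => hTfin _)).trans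
    ((Set.ncard_iUnion_le_of_fintype _).trans ?_)
  rw [Finset.sum_coe_sort G fun p => (T p).ncard]
  refine Finset.sum_le_sum fun p _ => ?_
  refine (Set.ncard_image_le ((cutWords_finite S A B N₀ p.1).prod (words_finite _ _))).trans
    (le_of_eq ?_)
  rw [Set.ncard_prod]

/-- Since `n - 1 ≤ l / A` and `s ≥ l / B`, the stretch satisfies `n - s ≤ l * (B - A) / (A * B) +
1`, so zeros occupy a proportion `A * B / (B - A)` of it. Only the share `1 - ζ` of `l` is spent on
this; the share `ζ` is saved as an extra gain `ζ * A * n`. -/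
theorem exponent_le {A B ζ n s l : ℝ} (hA : 0 < A) (hA1 : A ≤ 1) (hB : A < B)
    (hAB : A * B ≤ B - A) (hζ0 : 0 ≤ ζ) (hζ1 : ζ ≤ 1) (hl : A * (n - 1) ≤ l) (hs : l ≤ B * s) :
    (1 - (1 - ζ) * (A * B / (B - A))) * s + (n - s - l) ≤
      (1 - (1 - ζ) * (A * B / (B - A)) - ζ * A) * n + 2 := by
  have hBA : 0 < B - A := by linarith
  have hB0 : 0 < B := by linarith
  set κ := A * B / (B - A) with hκ
  have hκ1 : κ ≤ 1 := by rw [hκ, div_le_one hBA]; exact hAB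
  have hκ0 : 0 ≤ κ := by positivity
  have key : κ * (n - s) ≤ l + κ := by
    have h1 : n - s ≤ l * (B - A) / (A * B) + 1 := by
      have e : l * (B - A) / (A * B) = l / A - l / B := by field_simp
      have h2 : n - 1 ≤ l / A := by rw [le_div_iff₀ hA]; linarith
      have h3 : l / B ≤ s := by rw [div_le_iff₀ hB0]; linarith
      rw [e]
      linarith
    have h4 : κ * (l * (B - A) / (A * B)) = l := by
      rw [hκ]
      field_simp
    nlinarith [mul_le_mul_of_nonneg_left h1 hκ0]
  have h5 : (1 - ζ) * (κ * (n - s)) ≤ (1 - ζ) * (l + κ) :=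
    mul_le_mul_of_nonneg_left key (by linarith)
  have h6 : ζ * (A * (n - 1)) ≤ ζ * l := mul_le_mul_of_nonneg_left hl hζ0
  have h7 : ζ * A ≤ 1 := by nlinarith
  have h8 : (1 - ζ) * κ ≤ 1 := by nlinarith
  nlinarith

/-- Strong induction on the recursion of `ncard_cutWords_le`. There are at most `n ^ 2` pairs, and
the gain `m ^ (-(σ * (ζ * A) * n))` saved in `exponent_le` absorbs this polynomial factor once `n`
is large. -/
theorem exists_ncard_cutWords_le (hm : 2 ≤ m) {S : Set (SymbolicSpace m)} (hS : IsSubshift S)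
    {σ C₁ : ℝ} (hσ : 0 < σ) (hC₁ : ∀ n, ((words S n).ncard : ℝ) ≤ C₁ * (m : ℝ) ^ (σ * n))
    {A B ζ : ℝ} (hA : 0 < A) (hA1 : A ≤ 1) (hB : A < B) (hAB : A * B ≤ B - A) (hζ0 : 0 < ζ)
    (hζ1 : ζ ≤ 1) {N₀ : ℕ} (hN₀ : 2 ≤ N₀) :
    ∃ C : ℝ, ∀ n, ((cutWords S A B N₀ n).ncard : ℝ) ≤
      C * (m : ℝ) ^ (σ * (1 - (1 - ζ) * (A * B / (B - A))) * n) := by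
  have hm' : (1 : ℝ) < m := by exact_mod_cast hm
  set θ := 1 - (1 - ζ) * (A * B / (B - A)) with hθ
  have hBA : 0 < B - A := by linarith
  have hθ0 : 0 ≤ θ := by
    have h1 : A * B / (B - A) ≤ 1 := by rw [div_le_one hBA]; exact hAB
    have h2 : 0 ≤ A * B / (B - A) := by
      have : 0 < B := by linarith
      positivity
    rw [hθ]
    nlinarith
  have hC₁0 : 0 ≤ C₁ := by
    have := hC₁ 0
    simp only [Nat.cast_zero, mul_zero, Real.rpow_zero, mul_one] at this
    exact (Nat.cast_nonneg _).trans this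
  obtain ⟨N₁, hN₁⟩ := ncard_cutWords_le hS B hA hN₀
  have hr : (m : ℝ) ^ (-(σ * (ζ * A))) < 1 := Real.rpow_lt_one_of_one_lt_of_neg hm' (by
    have := mul_pos hσ (mul_pos hζ0 hA)
    linarith)
  have hlim : Tendsto (fun n : ℕ => C₁ * (m : ℝ) ^ (2 * σ) *
      ((n : ℝ) ^ 2 * ((m : ℝ) ^ (-(σ * (ζ * A)))) ^ n)) atTop (𝓝 0) := by
    have := (tendsto_pow_const_mul_const_pow_of_abs_lt_one 2
      (r := (m : ℝ) ^ (-(σ * (ζ * A)))) (by rwa [abs_of_pos (by positivity)])).const_mul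
        (C₁ * (m : ℝ) ^ (2 * σ))
    simpa using this
  obtain ⟨N₂, hN₂⟩ := eventually_atTop.1 (hlim.eventually_le_const one_pos)
  set K := max N₁ N₂ with hK
  refine ⟨(m : ℝ) ^ K, fun n => ?_⟩
  induction n using Nat.strong_induction_on with
  | _ n ih =>
  rcases lt_or_ge n K with hn | hn
  · calc ((cutWords S A B N₀ n).ncard : ℝ) ≤ (m : ℝ) ^ n := by
          exact_mod_cast ncard_words_le_pow _ _
      _ ≤ (m : ℝ) ^ K := pow_le_pow_right₀ hm'.le hn.le
      _ ≤ _ := le_mul_of_one_le_right (by positivity)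
        (Real.one_le_rpow hm'.le (by positivity))
  · have h1 := hN₁ n ((le_max_left _ _).trans hn)
    have h2 := hN₂ n ((le_max_right _ _).trans hn)
    calc ((cutWords S A B N₀ n).ncard : ℝ)
        ≤ ∑ p ∈ (Finset.range n ×ˢ Finset.range n) with
            p.1 + p.2 < n ∧ A * (n - 1) ≤ p.2 ∧ (p.2 : ℝ) ≤ B * p.1,
          ((cutWords S A B N₀ p.1).ncard : ℝ) * ((words S (n - p.1 - p.2)).ncard : ℝ) := by
          exact_mod_cast h1
      _ ≤ ∑ p ∈ (Finset.range n ×ˢ Finset.range n) with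
            p.1 + p.2 < n ∧ A * (n - 1) ≤ p.2 ∧ (p.2 : ℝ) ≤ B * p.1,
          (m : ℝ) ^ K * C₁ * (m : ℝ) ^ (σ * ((θ - ζ * A) * n + 2)) := by
          refine Finset.sum_le_sum fun p hp => ?_
          rw [Finset.mem_filter, Finset.mem_product, Finset.mem_range, Finset.mem_range] at hp
          obtain ⟨⟨hp1, -⟩, hp2, hp3, hp4⟩ := hp
          have hexp := exponent_le hA hA1 hB hAB hζ0.le hζ1 hp3 hp4
          rw [← hθ] at hexp
          calc ((cutWords S A B N₀ p.1).ncard : ℝ) * ((words S (n - p.1 - p.2)).ncard : ℝ)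
              ≤ ((m : ℝ) ^ K * (m : ℝ) ^ (σ * θ * p.1)) *
                (C₁ * (m : ℝ) ^ (σ * ((n - p.1 - p.2 : ℕ) : ℝ))) :=
                mul_le_mul (ih p.1 hp1) (hC₁ _) (by positivity) (by positivity)
            _ = (m : ℝ) ^ K * C₁ * (m : ℝ) ^ (σ * (θ * p.1 + (n - p.1 - p.2))) := by
                have hc : ((n - p.1 - p.2 : ℕ) : ℝ) = n - p.1 - p.2 := by
                  rw [Nat.cast_sub (by omega), Nat.cast_sub (by omega)]
                have e : σ * (θ * p.1 + (n - p.1 - p.2)) =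
                    σ * θ * p.1 + σ * (n - p.1 - p.2) := by ring
                rw [hc, e, Real.rpow_add (by positivity)]
                ring
            _ ≤ (m : ℝ) ^ K * C₁ * (m : ℝ) ^ (σ * ((θ - ζ * A) * n + 2)) := by
                refine mul_le_mul_of_nonneg_left ?_ (by positivity)
                exact Real.rpow_le_rpow_of_exponent_le hm'.le
                  (mul_le_mul_of_nonneg_left hexp hσ.le)
      _ ≤ (n : ℝ) ^ 2 * ((m : ℝ) ^ K * C₁ * (m : ℝ) ^ (σ * ((θ - ζ * A) * n + 2))) := by
          rw [Finset.sum_const, nsmul_eq_mul]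
          refine mul_le_mul_of_nonneg_right ?_ (by positivity)
          have := (Finset.card_filter_le (Finset.range n ×ˢ Finset.range n) fun p : ℕ × ℕ =>
            p.1 + p.2 < n ∧ A * (n - 1) ≤ p.2 ∧ (p.2 : ℝ) ≤ B * p.1)
          rw [Finset.card_product, Finset.card_range, ← sq] at this
          exact_mod_cast this
      _ = (m : ℝ) ^ K * (m : ℝ) ^ (σ * θ * n) * (C₁ * (m : ℝ) ^ (2 * σ) *
            ((n : ℝ) ^ 2 * ((m : ℝ) ^ (-(σ * (ζ * A)))) ^ n)) := by
          rw [← rpow_neg_mul_natCast_eq hm]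
          have e : σ * ((θ - ζ * A) * n + 2) = σ * θ * n + 2 * σ + -(σ * (ζ * A) * n) := by ring
          rw [e, Real.rpow_add (by positivity), Real.rpow_add (by positivity)]
          ring
      _ ≤ (m : ℝ) ^ K * (m : ℝ) ^ (σ * θ * n) := mul_le_of_le_one_right (by positivity) h2

/-- A long run starts, after extension, at some large `s` just after a nonzero letter. The cut word
of length `s` then determines `s + ⌈β * s⌉₊` letters, so the covering series is geometric with ratio
`m ^ (γ - t * (1 + β))`. -/
theorem dimH_runSet_le (hm : 2 ≤ m) {S : Set (SymbolicSpace m)} {A B : ℝ} {N₀ : ℕ} {γ C : ℝ}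
    (hC : ∀ n, ((cutWords S A B N₀ n).ncard : ℝ) ≤ C * (m : ℝ) ^ (γ * n)) {β : ℝ} (hβ : 0 < β)
    {t : ℝ≥0} (ht : γ < t * (1 + β)) :
    dimH {ω ∈ runSet S A B N₀ | ∃ᶠ N : ℕ in atTop, ∃ n l : ℕ, 1 ≤ n ∧ n ≤ N ∧ β * N ≤ l ∧
      IsRun ω n l} ≤ t := by
  have hm' : (1 : ℝ) < m := by exact_mod_cast hm
  have hC0 : 0 ≤ C := by
    have := hC 0
    simp only [Nat.cast_zero, mul_zero, Real.rpow_zero, mul_one] at this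
    exact (Nat.cast_nonneg _).trans this
  refine dimH_le_of_frequently hm
    (fun s => {ω | (ω ∈ runSet S A B N₀ ∧ ω (s - 1) ≠ 0) ∧ IsRun ω s ⌈β * s⌉₊})
    (fun s => s + ⌈β * s⌉₊) t ?_
    (tendsto_atTop_mono (fun n => Nat.le_add_right _ _) tendsto_id) ?_
  · rintro ω ⟨hω, hfreq⟩
    rw [frequently_atTop] at hfreq ⊢
    intro s₀
    set K := max (max s₀ 2) N₀ with hK
    obtain ⟨N₁, hN₁⟩ := exists_nat_gt (B * K / β)
    obtain ⟨N, hN, n, l, h1, h2, h3, h4⟩ := hfreq (max N₁ K)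
    rw [div_lt_iff₀ hβ] at hN₁
    have hN' : (N₁ : ℝ) ≤ N := by exact_mod_cast (le_max_left _ _).trans hN
    obtain ⟨s, k, hs1, hs2, hs3, hs4, hs5⟩ := exists_maximal_run_of_large (K := K)
      (le_max_right _ _) ((le_max_right _ _).trans (le_max_left _ _)) hω h1 (by nlinarith) h4
    refine ⟨s, (((le_max_left _ _).trans (le_max_left _ _)).trans hs1), ⟨hω, hs4⟩,
      hs5.mono (Nat.ceil_le.2 ?_)⟩
    have hlk : (l : ℝ) ≤ k := by exact_mod_cast (by omega : l ≤ k)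
    have hsN : (s : ℝ) ≤ N := by exact_mod_cast hs2.trans h2
    nlinarith
  · refine ((summable_rpow_neg_mul hm (sub_pos.2 ht)).mul_left C).of_nonneg_of_le
      (fun n => by positivity) fun s => ?_
    have hcard : (words {ω | (ω ∈ runSet S A B N₀ ∧ ω (s - 1) ≠ 0) ∧ IsRun ω s ⌈β * s⌉₊}
        (s + ⌈β * s⌉₊)).ncard ≤ (cutWords S A B N₀ s).ncard := by
      refine ncard_words_le_of_agree (fun ω h => h.1) ?_
      intro u hu v hv huv i hi
      rcases lt_or_ge i s with his | his
      · exact huv i his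
      · obtain ⟨j, rfl⟩ := Nat.exists_eq_add_of_le his
        rw [hu.2 j (by omega), hv.2 j (by omega)]
    have hlen : (1 + β) * (s : ℝ) ≤ ((s + ⌈β * s⌉₊ : ℕ) : ℝ) := by
      push_cast
      linarith [Nat.le_ceil (β * s)]
    calc _ ≤ (C * (m : ℝ) ^ (γ * s)) * (m : ℝ) ^ (-(t * ((1 + β) * s))) := by
          refine mul_le_mul ((Nat.cast_le.2 hcard).trans (hC s)) ?_ (by positivity)
            (by positivity)
          refine Real.rpow_le_rpow_of_exponent_le hm'.le (neg_le_neg ?_)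
          exact mul_le_mul_of_nonneg_left hlen t.2
      _ = C * (m : ℝ) ^ (-((t * (1 + β) - γ) * s)) := by
          rw [mul_assoc, ← Real.rpow_add (by positivity)]
          ring_nf

end RunSet

/-! ### Level sets for a general normalization -/

section Ratio

variable {m : ℕ} [NeZero m]

/-- The points of `S` with `liminf L_N / F N ≥ a` and `limsup L_N / F N = b`. -/
def ratioSet (S : Set (SymbolicSpace m)) (F : ℕ → ℝ≥0∞) (a b : ℝ≥0∞) :
    Set (SymbolicSpace m) :=
  {ω ∈ S | a ≤ liminf (fun N => (maxZeroRun ω N : ℝ≥0∞) / F N) atTop ∧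
    limsup (fun N => (maxZeroRun ω N : ℝ≥0∞) / F N) atTop = b}

/-- The points of `S` with `liminf L_N / F N = a` and `limsup L_N / F N = b`. -/
def ratioSetStar (S : Set (SymbolicSpace m)) (F : ℕ → ℝ≥0∞) (a b : ℝ≥0∞) :
    Set (SymbolicSpace m) :=
  {ω ∈ S | liminf (fun N => (maxZeroRun ω N : ℝ≥0∞) / F N) atTop = a ∧
    limsup (fun N => (maxZeroRun ω N : ℝ≥0∞) / F N) atTop = b}

theorem ratioSetStar_subset (S : Set (SymbolicSpace m)) (F : ℕ → ℝ≥0∞) (a b : ℝ≥0∞) :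
    ratioSetStar S F a b ⊆ ratioSet S F a b := fun _ h => ⟨h.1, h.2.1.ge, h.2.2⟩

theorem ofReal_mul_le_of_lt_div {x : ℝ≥0∞} {N : ℕ} {r : ℝ} (hN : 1 ≤ N)
    (h : ENNReal.ofReal r ≤ x / (N : ℝ≥0∞)) : ENNReal.ofReal (r * N) ≤ x := by
  rw [ENNReal.ofReal_mul' (Nat.cast_nonneg _), ENNReal.ofReal_natCast]
  exact (ENNReal.le_div_iff_mul_le (Or.inl (by simp; omega)) (Or.inl (by simp))).1 h

/-- A countable union is harmless for the dimension. The shift by 2 provides the condition `2 ≤ N₀`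
of the counting lemmas. -/
theorem ratioSet_subset_iUnion_runSet (S : Set (SymbolicSpace m)) {A B ε : ℝ}
    (hB : 0 ≤ B) (hε : 0 < ε) :
    ratioSet S (fun N => N) (ENNReal.ofReal A) (ENNReal.ofReal B) ⊆
      ⋃ N₀ : ℕ, runSet S (A - ε) (B + ε) (N₀ + 2) := by
  rintro ω ⟨hω, hinf, hsup⟩
  have h1 : ∀ᶠ N : ℕ in atTop, ENNReal.ofReal (A - ε) ≤ (maxZeroRun ω N : ℝ≥0∞) / (N : ℝ≥0∞) := by
    rcases le_or_gt (A - ε) 0 with h0 | h0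
    · rw [ENNReal.ofReal_of_nonpos h0]
      exact Eventually.of_forall fun _ => zero_le
    · refine (eventually_lt_of_lt_liminf (lt_of_lt_of_le ?_ hinf)).mono fun N h => h.le
      rw [ENNReal.ofReal_lt_ofReal_iff (by linarith)]
      linarith
  have h2 : ∀ᶠ N : ℕ in atTop, (maxZeroRun ω N : ℝ≥0∞) / (N : ℝ≥0∞) < ENNReal.ofReal (B + ε) := by
    refine eventually_lt_of_limsup_lt ?_
    rw [hsup, ENNReal.ofReal_lt_ofReal_iff (by linarith)]
    linarith
  obtain ⟨N₀, hN₀⟩ := eventually_atTop.1 (h1.and h2)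
  refine Set.mem_iUnion.2 ⟨N₀, hω, fun N hN => ?_, fun N hN n l hn hnN hrun => ?_⟩
  · exact exists_isRun_of_ofReal_le (by omega)
      (ofReal_mul_le_of_lt_div (by omega) (hN₀ N (by omega)).1)
  · refine hrun.le_of_le_ofReal (by positivity) hn hnN ?_
    rw [ENNReal.ofReal_mul' (Nat.cast_nonneg _), ENNReal.ofReal_natCast]
    exact (ENNReal.div_le_iff (by simp; omega) (by simp)).1 (hN₀ N (by omega)).2.le

theorem frequently_long_run_of_mem_ratioSet {S : Set (SymbolicSpace m)} {a : ℝ≥0∞} {B β : ℝ}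
    (hB : 0 < B) (hβ : β < B) {ω : SymbolicSpace m}
    (hω : ω ∈ ratioSet S (fun N => N) a (ENNReal.ofReal B)) :
    ∃ᶠ N : ℕ in atTop, ∃ n l : ℕ, 1 ≤ n ∧ n ≤ N ∧ β * N ≤ l ∧ IsRun ω n l := by
  have h : ∃ᶠ N : ℕ in atTop, ENNReal.ofReal β < (maxZeroRun ω N : ℝ≥0∞) / (N : ℝ≥0∞) := by
    refine frequently_lt_of_lt_limsup (by isBoundedDefault) ?_
    rw [hω.2.2, ENNReal.ofReal_lt_ofReal_iff hB]
    exact hβ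
  refine (h.and_eventually (eventually_ge_atTop 1)).mono fun N hN => ?_
  exact exists_isRun_of_ofReal_le hN.2 (ofReal_mul_le_of_lt_div hN.2 hN.1.le)

theorem ratioSet_eq_empty (S : Set (SymbolicSpace m)) {A B : ℝ} (hA : 0 < A)
    (hB : 0 ≤ B) (hAB : B * (1 - A) < A) :
    ratioSet S (fun N => N) (ENNReal.ofReal A) (ENNReal.ofReal B) = ∅ := by
  have h1 : ∀ᶠ ε in 𝓝[>] (0 : ℝ), (B + ε) * (1 - (A - ε)) < A - ε := by
    refine Filter.Eventually.filter_mono nhdsWithin_le_nhds ?_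
    have hc1 : ContinuousAt (fun ε : ℝ => (B + ε) * (1 - (A - ε))) 0 := by fun_prop
    have hc2 : ContinuousAt (fun ε : ℝ => A - ε) 0 := by fun_prop
    exact hc1.eventually_lt hc2 (by simpa using hAB)
  have h2 : ∀ᶠ ε in 𝓝[>] (0 : ℝ), ε ∈ Ioo 0 A := Ioo_mem_nhdsGT hA
  obtain ⟨ε, h3, h4⟩ := (h1.and h2).exists
  rw [Set.eq_empty_iff_forall_notMem]
  intro ω hω
  obtain ⟨N₀, hN₀⟩ := Set.mem_iUnion.1 (ratioSet_subset_iUnion_runSet S hB h4.1 hω)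
  rw [runSet_eq_empty S (by linarith [h4.2]) h3 (by omega)] at hN₀
  exact hN₀

theorem dimH_ratioSet_le_of_cutWords (hm : 2 ≤ m) {S : Set (SymbolicSpace m)} {A B ε γ : ℝ}
    (hε : 0 < ε) (hεB : ε < B)
    (hC : ∀ N₀ ≥ 2, ∃ C : ℝ, ∀ n, ((cutWords S (A - ε) (B + ε) N₀ n).ncard : ℝ) ≤
      C * (m : ℝ) ^ (γ * n)) {t : ℝ≥0} (ht : γ < t * (1 + (B - ε))) :
    dimH (ratioSet S (fun N => N) (ENNReal.ofReal A) (ENNReal.ofReal B)) ≤ t := by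
  have hsub : ratioSet S (fun N => N) (ENNReal.ofReal A) (ENNReal.ofReal B) ⊆
      ⋃ N₀ : ℕ, {ω ∈ runSet S (A - ε) (B + ε) (N₀ + 2) | ∃ᶠ N : ℕ in atTop, ∃ n l : ℕ,
        1 ≤ n ∧ n ≤ N ∧ (B - ε) * N ≤ l ∧ IsRun ω n l} := by
    intro ω hω
    obtain ⟨N₀, hN₀⟩ := Set.mem_iUnion.1
      (ratioSet_subset_iUnion_runSet S (by linarith) hε hω)
    exact Set.mem_iUnion.2 ⟨N₀, hN₀,
      frequently_long_run_of_mem_ratioSet (by linarith) (by linarith) hω⟩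
  refine (dimH_mono hsub).trans ?_
  rw [dimH_iUnion]
  refine iSup_le fun N₀ => ?_
  obtain ⟨C, hC⟩ := hC (N₀ + 2) (by omega)
  exact dimH_runSet_le hm hC (by linarith) ht

/-- One small `ε` perturbs `A`, `B` and the exponent `D`, and also serves as `ζ`. The slack `δ` in
`t` makes the required inequality strict at `ε = 0`, so it persists by continuity. -/
theorem dimH_ratioSet_le (hm : 2 ≤ m) {S : Set (SymbolicSpace m)} (hS : IsSubshift S) {A B : ℝ}
    (hA : 0 ≤ A) (hB : 0 < B) (hAB : A * (1 + B) ≤ B) :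
    dimH (ratioSet S (fun N => N) (ENNReal.ofReal A) (ENNReal.ofReal B)) ≤
      ENNReal.ofReal ((B * (1 - A) - A) / ((1 + B) * (B - A))) * dimH S := by
  set D := (dimH S).toReal with hD
  have hD0 : 0 ≤ D := ENNReal.toReal_nonneg
  have hDS : dimH S = ENNReal.ofReal D := (ENNReal.ofReal_toReal (dimH_ne_top hm S)).symm
  have hBA : A < B := by nlinarith
  have hf0 : 0 ≤ (B * (1 - A) - A) / ((1 + B) * (B - A)) :=
    div_nonneg (by nlinarith) (mul_nonneg (by linarith) (by linarith))
  rw [hDS, ← ENNReal.ofReal_mul hf0]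
  refine ENNReal.le_of_forall_pos_le_add fun δ hδ _ => ?_
  set t : ℝ≥0 := Real.toNNReal ((B * (1 - A) - A) / ((1 + B) * (B - A)) * D) + δ with ht
  have htcoe : (t : ℝ) = (B * (1 - A) - A) / ((1 + B) * (B - A)) * D + δ := by
    rw [ht, NNReal.coe_add, Real.coe_toNNReal _ (by positivity)]
  have htt : ENNReal.ofReal ((B * (1 - A) - A) / ((1 + B) * (B - A)) * D) + δ = (t : ℝ≥0∞) := by
    rw [ht, ENNReal.coe_add]
    rfl
  rw [htt]
  have hδ' : (0 : ℝ) < δ := hδ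
  have h2 : ∀ᶠ ε in 𝓝[>] (0 : ℝ), ε ∈ Ioo 0 (min B 1) := Ioo_mem_nhdsGT (lt_min hB one_pos)
  have hcount : ∀ ε : ℝ, 0 < ε → ∃ C : ℝ, 1 ≤ C ∧ ∀ n, ((words S n).ncard : ℝ) ≤
      C * (m : ℝ) ^ ((D + ε) * n) := fun ε hε => by
    refine exists_ncard_words_le hm hS ?_
    rw [hDS, ENNReal.ofReal_lt_ofReal_iff (by linarith)]
    linarith
  -- For `A = 0` the recursion is not available because `A - ε` is negative; no zeros are forced,
  -- and counting all words of `S` suffices.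
  rcases hA.eq_or_lt with rfl | hA0
  · have h1 : ∀ᶠ ε in 𝓝[>] (0 : ℝ), D + ε < t * (1 + (B - ε)) := by
      refine Filter.Eventually.filter_mono nhdsWithin_le_nhds ?_
      have hc1 : ContinuousAt (fun ε : ℝ => D + ε) 0 := by fun_prop
      have hc2 : ContinuousAt (fun ε : ℝ => t * (1 + (B - ε))) 0 := by fun_prop
      refine hc1.eventually_lt hc2 ?_
      rw [htcoe]
      have e : (B * (1 - 0) - 0) / ((1 + B) * (B - 0)) * D * (1 + B) = D := by
        simp only [sub_zero, mul_one]
        field_simp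
      nlinarith
    obtain ⟨ε, h3, h4⟩ := (h1.and h2).exists
    obtain ⟨C, -, hC⟩ := hcount ε h4.1
    refine dimH_ratioSet_le_of_cutWords hm h4.1 (h4.2.trans_le (min_le_left _ _))
      (fun N₀ _ => ⟨C, fun n => le_trans ?_ (hC n)⟩) h3
    exact Nat.cast_le.2 (Set.ncard_le_ncard (cutWords_subset_words S _ _ N₀ n)
      (words_finite _ _))
  · have h1 : ∀ᶠ ε in 𝓝[>] (0 : ℝ), (D + ε) * (1 - (1 - ε) * ((A - ε) * (B + ε) /
        (B + ε - (A - ε)))) < t * (1 + (B - ε)) := by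
      refine Filter.Eventually.filter_mono nhdsWithin_le_nhds ?_
      have hne : B + 0 - (A - 0) ≠ 0 := by
        have : 0 < B - A := by linarith
        simp only [add_zero, sub_zero]
        exact this.ne'
      have hc1 : ContinuousAt (fun ε : ℝ => (D + ε) * (1 - (1 - ε) * ((A - ε) * (B + ε) /
        (B + ε - (A - ε))))) 0 := by fun_prop (disch := exact hne)
      have hc2 : ContinuousAt (fun ε : ℝ => t * (1 + (B - ε))) 0 := by fun_prop
      refine hc1.eventually_lt hc2 ?_
      rw [htcoe]
      have hBA' : B - A ≠ 0 := by linarith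
      have e : (B * (1 - A) - A) / ((1 + B) * (B - A)) * D * (1 + B) =
          D * (1 - A * B / (B - A)) := by field_simp; ring
      simp only [add_zero, sub_zero, one_mul]
      rw [add_mul, e]
      nlinarith
    have h2' : ∀ᶠ ε in 𝓝[>] (0 : ℝ), ε ∈ Ioo 0 A := Ioo_mem_nhdsGT hA0
    obtain ⟨ε, h3, h4, h5⟩ := (h1.and (h2.and h2')).exists
    obtain ⟨hε0, hε1⟩ := h4
    obtain ⟨hεB, hε1⟩ := lt_min_iff.1 hε1
    have hεA := h5.2
    obtain ⟨C, -, hC⟩ := hcount ε hε0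
    refine dimH_ratioSet_le_of_cutWords hm hε0 hεB (fun N₀ hN₀ => ?_) h3
    exact exists_ncard_cutWords_le hm hS (by linarith) hC (by linarith) (by nlinarith)
      (by linarith) (by nlinarith) hε0 hε1.le hN₀

end Ratio

/-! ### Gluing words with specification -/

section Gluing

variable {m : ℕ}

/-- Prefixes of points of `S` can be joined by fillers of length `M`. -/
def CanGlue (S : Set (SymbolicSpace m)) (M : ℕ) : Prop :=
  ∀ u ∈ S, ∀ n ≥ 1, ∀ v ∈ S, ∀ k ≥ 1, ∃ y ∈ S, Agree y u n ∧ ∀ i < k, y (n + M + i) = v i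

/-- A word of the language is a prefix of a point of `S`, so joining words amounts to joining
points. Only the length of the filler is remembered. -/
theorem HasSpecification.exists_canGlue {S : Set (SymbolicSpace m)} (h : HasSpecification S) :
    ∃ M, CanGlue S M := by
  obtain ⟨M, hM⟩ := h
  refine ⟨M, fun u hu n hn v hv k hk => ?_⟩
  obtain ⟨w, ⟨z, -, rfl⟩, hlang⟩ := hM (pref u n) (Set.mem_iUnion₂.2 ⟨n, hn, u, hu, rfl⟩)
    (pref v k) (Set.mem_iUnion₂.2 ⟨k, hk, v, hv, rfl⟩)
  obtain ⟨N, -, y, hy, hpref⟩ := Set.mem_iUnion₂.1 hlang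
  dsimp only at hpref
  have hN : N = n + M + k := by
    have := congrArg List.length hpref
    simpa [pref, add_assoc] using this
  subst hN
  rw [pref_add, pref_add] at hpref
  have hlen : (pref y n ++ pref (shift^[n] y) M).length =
      (pref u n ++ pref z M).length := by simp [pref]
  obtain ⟨h1, h2⟩ := List.append_inj hpref hlen
  obtain ⟨h3, -⟩ := List.append_inj h1 (by simp [pref])
  refine ⟨y, hy, pref_eq_iff.1 h3, fun i hi => ?_⟩
  rw [← pref_eq_iff.1 h2 i hi, shift_iterate_apply]

/-- A map which has a Hölder inverse of exponent `r` decreases the dimension by at most the factor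
`r`. -/
theorem mul_dimH_le_dimH_image (hm : 2 ≤ m) {S : Set (SymbolicSpace m)}
    (g : SymbolicSpace m → SymbolicSpace m) {r : ℝ≥0} (hr : 0 < r) (C : ℝ)
    (h : ∀ x ∈ S, ∀ x' ∈ S, ∀ n : ℕ, Agree (g x) (g x') n →
      ∃ j : ℕ, r * (n + 1) - C ≤ j ∧ Agree x x' j) : r * dimH S ≤ dimH (g '' S) := by
  have hm' : (1 : ℝ) < m := by exact_mod_cast hm
  rcases S.eq_empty_or_nonempty with rfl | ⟨x₀, -⟩
  · simp
  have : Nonempty (SymbolicSpace m) := ⟨x₀⟩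
  have hdist : ∀ x ∈ S, ∀ x' ∈ S, dist x x' ≤ (m : ℝ) ^ C * dist (g x) (g x') ^ (r : ℝ) := by
    intro x hx x' hx'
    by_cases hg : g x = g x'
    · have hxx : x = x' := by
        funext i
        obtain ⟨n, hn⟩ := exists_nat_gt ((C + i + 1) / r)
        rw [div_lt_iff₀ (NNReal.coe_pos.2 hr)] at hn
        obtain ⟨j, hj, hagree⟩ := h x hx x' hx' n (by rw [hg]; exact fun _ _ => rfl)
        refine hagree i ?_
        have hr' : (0 : ℝ) < r := hr
        have : (i : ℝ) < j := by nlinarith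
        exact_mod_cast this
      rw [hxx, dist_self]
      positivity
    · obtain ⟨n, hn, -, hd⟩ := exists_agree_dist_eq hg
      obtain ⟨j, hj, hagree⟩ := h x hx x' hx' n hn
      refine (dist_le_of_agree hagree).trans ?_
      rw [hd, ← Real.rpow_natCast, ← Real.rpow_natCast, Real.inv_rpow (by positivity),
        Real.inv_rpow (by positivity), ← Real.rpow_neg (by positivity),
        ← Real.rpow_neg (by positivity), ← Real.rpow_mul (by positivity),
        ← Real.rpow_add (by positivity)]
      refine Real.rpow_le_rpow_of_exponent_le hm'.le ?_
      push_cast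
      nlinarith
  have hinj : Set.InjOn g S := by
    intro x hx x' hx' hg
    have := hdist x hx x' hx'
    rw [hg, dist_self, Real.zero_rpow (NNReal.coe_pos.2 hr).ne', mul_zero] at this
    exact dist_le_zero.1 this
  have hleft : ∀ x ∈ S, Function.invFunOn g S (g x) = x := fun x hx => hinj.leftInvOn_invFunOn hx
  have hholder : HolderOnWith (Real.toNNReal ((m : ℝ) ^ C)) r (Function.invFunOn g S)
      (g '' S) := by
    rintro _ ⟨x, hx, rfl⟩ _ ⟨x', hx', rfl⟩
    rw [hleft x hx, hleft x' hx', edist_dist, edist_dist,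
      ENNReal.ofReal_rpow_of_nonneg dist_nonneg r.coe_nonneg]
    refine (ENNReal.ofReal_le_ofReal (hdist x hx x' hx')).trans (le_of_eq ?_)
    rw [ENNReal.ofReal_mul (by positivity)]
    rfl
  have himage : Function.invFunOn g S '' (g '' S) = S := by
    rw [← Set.image_comp]
    refine (Set.image_congr hleft).trans ?_
    simp
  have := hholder.dimH_image_le hr
  rw [himage, ENNReal.le_div_iff_mul_le (Or.inl (by simpa using hr.ne')) (Or.inl (by simp)),
    mul_comm] at this
  exact this

variable [NeZero m]

/-- One stage of the construction: a point of `S` is continued by a filler, `p` prescribed letters,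
a filler, a nonzero letter, a filler and `l` zeros. -/
theorem CanGlue.exists_stage {S : Set (SymbolicSpace m)} {M : ℕ} (h : CanGlue S M)
    (hzero : zeroWord m ∈ S) {ζ : SymbolicSpace m} (hζ : ζ ∈ S) (hζ0 : ζ 0 ≠ 0)
    {u : SymbolicSpace m} (hu : u ∈ S) {n : ℕ} (hn : 1 ≤ n) {v : SymbolicSpace m} (hv : v ∈ S)
    {p : ℕ} (hp : 1 ≤ p) {l : ℕ} (hl : 1 ≤ l) :
    ∃ y ∈ S, Agree y u n ∧ (∀ i < p, y (n + M + i) = v i) ∧ y (n + 2 * M + p) ≠ 0 ∧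
      IsRun y (n + 3 * M + p + 1) l := by
  obtain ⟨y₁, hy₁, ha₁, hb₁⟩ := h u hu n hn v hv p hp
  obtain ⟨y₂, hy₂, ha₂, hb₂⟩ := h y₁ hy₁ (n + M + p) (by omega) ζ hζ 1 le_rfl
  obtain ⟨y₃, hy₃, ha₃, hb₃⟩ := h y₂ hy₂ (n + M + p + M + 1) (by omega) _ hzero l hl
  refine ⟨y₃, hy₃, fun i hi => ?_, fun i hi => ?_, ?_, fun i hi => ?_⟩
  · rw [ha₃ i (by omega), ha₂ i (by omega), ha₁ i hi]
  · rw [ha₃ _ (by omega), ha₂ _ (by omega), hb₁ i hi]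
  · have := hb₂ 0 one_pos
    rw [ha₃ _ (by omega), show n + 2 * M + p = n + M + p + M + 0 by omega, this]
    exact hζ0
  · have := hb₃ i hi
    rw [show n + 3 * M + p + 1 + i = n + M + p + M + 1 + M + i by omega, this]
    rfl

/-- Inserting fillers, nonzero letters and runs of zeros of prescribed lengths into a point of
`S`. -/
theorem CanGlue.exists_insertion (hm : 2 ≤ m) {S : Set (SymbolicSpace m)} (hS : IsSubshift S)
    {M : ℕ} (h : CanGlue S M) (hzero : zeroWord m ∈ S) {ζ : SymbolicSpace m} (hζ : ζ ∈ S)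
    (hζ0 : ζ 0 ≠ 0) {p : ℕ} (hp : 1 ≤ p) {l : ℕ → ℕ} (hl : ∀ k, 1 ≤ l k) {T : ℕ → ℕ}
    (hT0 : T 0 = 1) (hT : ∀ k, T (k + 1) = T k + (3 * M + p + 1) + l k)
    {x : SymbolicSpace m} (hx : x ∈ S) :
    ∃ y ∈ S, ∀ k, (∀ i < p, y (T k + M + i) = x (p * k + i)) ∧ y (T k + 2 * M + p) ≠ 0 ∧
      IsRun y (T k + 3 * M + p + 1) (l k) := by
  have hT1 : ∀ k, 1 ≤ T k := fun k => by
    induction k with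
    | zero => omega
    | succ k ih => rw [hT]; omega
  have hTk : ∀ k, k ≤ T k := fun k => by
    induction k with
    | zero => omega
    | succ k ih => rw [hT]; omega
  have hstep : ∀ (k : ℕ) (u : S), ∃ y : S, Agree y.1 u.1 (T k) ∧
      (∀ i < p, y.1 (T k + M + i) = x (p * k + i)) ∧ y.1 (T k + 2 * M + p) ≠ 0 ∧
      IsRun y.1 (T k + 3 * M + p + 1) (l k) := by
    intro k u
    obtain ⟨y, hy, h1, h2, h3, h4⟩ := h.exists_stage hzero hζ hζ0 u.2 (hT1 k)
      (shift_iterate_mem hS hx (p * k)) hp (hl k)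
    refine ⟨⟨y, hy⟩, h1, fun i hi => ?_, h3, h4⟩
    have := h2 i hi
    rwa [shift_iterate_apply] at this
  choose next hn1 hn2 hn3 hn4 using hstep
  let u : ℕ → S := fun k => Nat.rec ⟨x, hx⟩ next k
  have hu : ∀ k, u (k + 1) = next k (u k) := fun k => rfl
  have hagree : ∀ k j, k ≤ j → Agree (u j).1 (u k).1 (T k) := by
    intro k j hkj
    induction j, hkj using Nat.le_induction with
    | base => exact fun _ _ => rfl
    | succ j hkj ih =>
      have hTj : T k ≤ T j := (monotone_nat_of_le_succ fun i => by rw [hT]; omega) hkj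
      rw [hu]
      exact ((hn1 j (u j)).mono hTj).trans ih
  -- Stage `k` never alters the first `T k` letters, and `i < T (i + 1)`; so letter `i` is final
  -- from `u (i + 1)` on. The limit stays in `S` because `S` is closed.
  let y : SymbolicSpace m := fun i => (u (i + 1)).1 i
  have hy : ∀ k, Agree y (u k).1 (T k) := by
    intro k i hi
    rcases le_total k (i + 1) with hk | hk
    · exact hagree k (i + 1) hk i hi
    · exact (hagree (i + 1) k hk i ((Nat.lt_succ_self i).trans_le (hTk _))).symm
  refine ⟨y, mem_of_agree hm hS.isClosed fun n => ⟨(u n).1, (u n).2, (hy n).mono (hTk n)⟩,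
    fun k => ?_⟩
  have hyk := hy (k + 1)
  rw [hu, hT] at hyk
  refine ⟨fun i hi => ?_, ?_, fun i hi => ?_⟩
  · rw [hyk _ (by omega), hn2 k _ i hi]
  · rw [hyk _ (by omega)]
    exact hn3 k _
  · rw [hyk _ (by omega)]
    exact hn4 k _ i hi

/-- A subshift of positive entropy containing `0^∞` has a point starting with a nonzero letter. -/
theorem exists_mem_apply_zero_ne_zero {S : Set (SymbolicSpace m)} (hS : IsSubshift S)
    (hent : 0 < entropy S) (hzero : zeroWord m ∈ S) : ∃ ζ ∈ S, ζ 0 ≠ 0 := by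
  by_contra! h
  have hall : ∀ u ∈ S, u = zeroWord m := fun u hu => by
    funext i
    have := h _ (shift_iterate_mem hS hu i)
    rwa [shift_iterate_apply] at this
  have hSeq : S = {zeroWord m} := Set.eq_singleton_iff_unique_mem.2 ⟨hzero, hall⟩
  have hlim := tendsto_entropy hS ⟨_, hzero⟩
  have h0 : (fun n : ℕ => Real.log (words S n).ncard / n) = fun _ => 0 := by
    funext n
    simp [hSeq, words]
  rw [h0] at hlim
  exact hent.ne (tendsto_nhds_unique tendsto_const_nhds hlim)

end Gluing

/-! ### Plans for the record runs of zeros -/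

section Plan

/-- A plan for record runs of zeros: a record run inserted at time `R` has length about `len R`, and
the next record run is inserted at the first opportunity after time `next R`. The constants bound
the proportion of zeros inserted before a record run, and the length of a record run. -/
structure IsPlan (len next : ℕ → ℕ) (κ B C₀ : ℝ) : Prop where
  one_le : ∀ R, 1 ≤ len R
  mono : ∀ R T, next R ≤ T → len R ≤ len T
  gap : ∀ R, (len R : ℝ) ≤ κ * (next R - R)
  bound : ∀ R, (len R : ℝ) ≤ B * R + C₀
  kappa_pos : 0 < κ
  kappa_lt_one : κ < 1
  B_nonneg : 0 ≤ B

/-- The time at which a stage starts, together with the time of the last record run. -/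
def planState (len next : ℕ → ℕ) (c : ℕ) : ℕ → ℕ × ℕ
  | 0 => (1, 0)
  | k + 1 =>
    let s := planState len next c k
    if next s.2 ≤ s.1 then (s.1 + c + len s.1, s.1) else (s.1 + c + 1, s.2)

variable (len next : ℕ → ℕ) (c : ℕ)

/-- The time at which stage `k` starts. -/
def planTime (k : ℕ) : ℕ := (planState len next c k).1

/-- The time of the last record run before stage `k`. -/
def planRecord (k : ℕ) : ℕ := (planState len next c k).2

/-- The length of the run of zeros inserted in stage `k`. -/
def planLen (k : ℕ) : ℕ :=
  if next (planRecord len next c k) ≤ planTime len next c k then len (planTime len next c k) else 1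

theorem planTime_zero : planTime len next c 0 = 1 := rfl

theorem planRecord_zero : planRecord len next c 0 = 0 := rfl

theorem planTime_succ (k : ℕ) :
    planTime len next c (k + 1) = planTime len next c k + c + planLen len next c k := by
  rw [planLen, planTime, planState]
  split_ifs with h1 h2 h2
  · rfl
  · exact absurd h1 h2
  · exact absurd h2 h1
  · rfl

theorem planRecord_succ (k : ℕ) : planRecord len next c (k + 1) =
    if next (planRecord len next c k) ≤ planTime len next c k then planTime len next c k
    else planRecord len next c k := by
  rw [planRecord, planState]
  split_ifs with h1 h2 h2
  · rfl
  · exact absurd h1 h2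
  · exact absurd h2 h1
  · rfl

variable {len next} {κ B C₀ : ℝ}

namespace IsPlan

theorem add_len_le_next (h : IsPlan len next κ B C₀) (R : ℕ) : R + len R ≤ next R := by
  have h1 := h.gap R
  have h2 : (1 : ℝ) ≤ len R := by exact_mod_cast h.one_le R
  have h3 := h.kappa_pos
  have h4 := h.kappa_lt_one
  have h5 : (0 : ℝ) < next R - R := by
    by_contra! hle
    nlinarith
  have : (R : ℝ) + len R ≤ next R := by nlinarith
  exact_mod_cast this

theorem one_le_planLen (h : IsPlan len next κ B C₀) (k : ℕ) : 1 ≤ planLen len next c k := by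
  rw [planLen]
  split_ifs
  · exact h.one_le _
  · exact le_rfl

theorem strictMono_planTime (h : IsPlan len next κ B C₀) : StrictMono (planTime len next c) :=
  strictMono_nat_of_lt_succ fun k => by
    have := h.one_le_planLen c k
    rw [planTime_succ]
    omega

theorem planRecord_lt_planTime (h : IsPlan len next κ B C₀) (k : ℕ) :
    planRecord len next c k < planTime len next c k := by
  induction k with
  | zero => exact one_pos
  | succ k ih =>
    have := h.strictMono_planTime c (Nat.lt_succ_self k)
    rw [planRecord_succ]
    split_ifs
    · exact this
    · exact ih.trans this

theorem planRecord_succ_le (h : IsPlan len next κ B C₀) (k : ℕ) :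
    planRecord len next c (k + 1) ≤ planTime len next c k := by
  rw [planRecord_succ]
  split_ifs
  · exact le_rfl
  · exact (h.planRecord_lt_planTime c k).le

theorem monotone_planRecord (h : IsPlan len next κ B C₀) : Monotone (planRecord len next c) :=
  monotone_nat_of_le_succ fun k => by
    rw [planRecord_succ]
    split_ifs
    · exact (h.planRecord_lt_planTime c k).le
    · exact le_rfl

theorem len_planRecord_le_succ (h : IsPlan len next κ B C₀) (k : ℕ) :
    len (planRecord len next c k) ≤ len (planRecord len next c (k + 1)) := by
  rw [planRecord_succ]
  split_ifs with h1
  · exact h.mono _ _ h1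
  · exact le_rfl

theorem planLen_le (h : IsPlan len next κ B C₀) (k : ℕ) :
    planLen len next c k ≤ len (planRecord len next c (k + 1)) := by
  rw [planLen, planRecord_succ]
  split_ifs
  · exact le_rfl
  · exact h.one_le _

/-- A stage without a record starts before `next` and lasts only `c + 1`, so the threshold is
overshot by at most `c`. -/
theorem planTime_le_next_add (h : IsPlan len next κ B C₀) (k : ℕ) :
    planTime len next c k ≤ next (planRecord len next c k) + c := by
  induction k with
  | zero =>
    have := h.add_len_le_next 0
    have := h.one_le 0
    rw [planTime_zero, planRecord_zero]
    omega
  | succ k ih =>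
    rw [planTime_succ, planRecord_succ, planLen]
    split_ifs with h1
    · have := h.add_len_le_next (planTime len next c k)
      omega
    · omega

/-- If no record occurred after stage `K`, the threshold would stay fixed while the stage times grow
past it. -/
theorem frequently_trigger (h : IsPlan len next κ B C₀) (K : ℕ) :
    ∃ k ≥ K, next (planRecord len next c k) ≤ planTime len next c k := by
  by_contra! hlt
  have hconst : ∀ k ≥ K, planRecord len next c k = planRecord len next c K := by
    intro k hk
    induction k, hk using Nat.le_induction with
    | base => rfl
    | succ k hk ih => rw [planRecord_succ, if_neg (not_le.2 (hlt k hk)), ih]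
  have h1 := hlt (K + next (planRecord len next c K)) (by omega)
  rw [hconst (K + next (planRecord len next c K)) (by omega)] at h1
  have h2 := (h.strictMono_planTime c).le_apply (x := K + next (planRecord len next c K))
  omega

theorem tendsto_planRecord (h : IsPlan len next κ B C₀) :
    Tendsto (planRecord len next c) atTop atTop := by
  refine tendsto_atTop_atTop_of_monotone (h.monotone_planRecord c) fun b => ?_
  obtain ⟨k, hk, htr⟩ := h.frequently_trigger c b
  refine ⟨k + 1, ?_⟩
  rw [planRecord_succ, if_pos htr]
  exact hk.trans (h.strictMono_planTime c).le_apply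

/-- All inserted runs except the last record are charged to the terms `k * (c + 1)` and `κ * R`:
when a new record starts at `T ≥ next R`, the gap condition bounds the old length by `κ * (T - R)`.
-/
theorem planTime_le (h : IsPlan len next κ B C₀) (k : ℕ) :
    (planTime len next c k : ℝ) ≤ 1 + k * (c + 1) + κ * planRecord len next c k +
      len (planRecord len next c k) := by
  induction k with
  | zero =>
    rw [planTime_zero, planRecord_zero]
    simp
  | succ k ih =>
    rw [planTime_succ, planRecord_succ, planLen]
    split_ifs with h1
    · have h2 := h.gap (planRecord len next c k)
      have h3 : (next (planRecord len next c k) : ℝ) ≤ planTime len next c k := by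
        exact_mod_cast h1
      have h4 := h.kappa_pos
      push_cast
      nlinarith
    · push_cast
      linarith

/-- The last record run fits before the current stage. The correction `len 0` is due to the
fictitious record at time 0, for which no run is inserted. -/
theorem planRecord_add_len_le (len next : ℕ → ℕ) (c k : ℕ) :
    planRecord len next c k + len (planRecord len next c k) ≤ planTime len next c k + len 0 := by
  induction k with
  | zero =>
    rw [planTime_zero, planRecord_zero]
    omega
  | succ k ih =>
    rw [planTime_succ, planRecord_succ, planLen]
    split_ifs with h1
    · omega
    · omega

/-- The stages fill a proportion `(1 - κ) / (1 + B)` of all times. -/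
theorem mul_planTime_le (h : IsPlan len next κ B C₀) (k : ℕ) :
    (1 - κ) / (1 + B) * planTime len next c k ≤ k * (c + 1) + (1 + |C₀| + len 0) := by
  have hκ0 := h.kappa_pos
  have hκ1 := h.kappa_lt_one
  have hB := h.B_nonneg
  set ρ := (1 - κ) / (1 + B) with hρ
  have hρ0 : 0 ≤ ρ := div_nonneg (by linarith) (by linarith)
  have hρ1 : ρ ≤ 1 := by
    rw [hρ, div_le_one (by linarith)]
    linarith
  have hρB : ρ * (1 + B) = 1 - κ := by
    rw [hρ]
    field_simp
  have h1 := h.planTime_le c k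
  have h2 : (planRecord len next c k : ℝ) + len (planRecord len next c k) ≤
      planTime len next c k + len 0 := by exact_mod_cast planRecord_add_len_le len next c k
  have h3 := h.bound (planRecord len next c k)
  set T : ℝ := (planTime len next c k : ℝ)
  set R : ℝ := (planRecord len next c k : ℝ)
  set l : ℝ := (len (planRecord len next c k) : ℝ)
  -- The worst time is the end `R + l` of the last record run, where a free part `(1 - κ) * R` is
  -- compared with at most `(1 + B) * R + C₀`. Past that time no record has been added, and `ρ ≤ 1`
  -- is enough.
  have h4 : ρ * (R + l) ≤ (1 - κ) * R + |C₀| := by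
    calc ρ * (R + l) ≤ ρ * ((1 + B) * R + |C₀|) :=
          mul_le_mul_of_nonneg_left (by linarith [le_abs_self C₀]) hρ0
      _ = (1 - κ) * R + ρ * |C₀| := by rw [← hρB]; ring
      _ ≤ (1 - κ) * R + |C₀| := by
          linarith [mul_le_of_le_one_left (abs_nonneg C₀) hρ1]
  have h5 : 0 ≤ (1 - ρ) * (T + len 0 - (R + l)) := mul_nonneg (by linarith) (by linarith)
  have h6 : 0 ≤ ρ * (len 0 : ℝ) := by positivity
  nlinarith

end IsPlan

end Plan

theorem exists_le_lt_succ_of_strictMono {T : ℕ → ℕ} (hT : StrictMono T) {K N : ℕ}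
    (hN : T K ≤ N) : ∃ k ≥ K, T k ≤ N ∧ N < T (k + 1) := by
  have hex : ∃ k, N < T k := ⟨N + 1, (Nat.lt_succ_self N).trans_le hT.le_apply⟩
  classical
  have h1 : N < T (Nat.find hex) := Nat.find_spec hex
  have h2 : K < Nat.find hex := hT.lt_iff_lt.1 (hN.trans_lt h1)
  refine ⟨Nat.find hex - 1, by omega, not_lt.1 (Nat.find_min hex (by omega)), ?_⟩
  rwa [Nat.sub_add_cancel (by omega)]

/-! ### Words realizing a plan -/

section Realize

variable {m : ℕ} [NeZero m] {len next : ℕ → ℕ} {κ B C₀ : ℝ}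

/-- The nonzero letter of each stage stops every run, so a run contains at most one inserted block
of zeros, plus neighbouring fillers and letters of bounded total length. -/
theorem IsPlan.run_le (h : IsPlan len next κ B C₀) {M p : ℕ} {y : SymbolicSpace m}
    (hy : ∀ k, y (planTime len next (3 * M + p + 1) k + 2 * M + p) ≠ 0) (k : ℕ) {n l : ℕ}
    (hn : n ≤ planTime len next (3 * M + p + 1) k + 2 * M + p) (hrun : IsRun y n l) :
    l ≤ len (planRecord len next (3 * M + p + 1) k) + (3 * M + p + 2) := by
  induction k with
  | zero =>
    have := hrun.add_le_of_ne_zero hn (hy 0)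
    rw [planTime_zero] at this
    omega
  | succ k ih =>
    have h1 := h.len_planRecord_le_succ (3 * M + p + 1) k
    have h2 := h.planLen_le (3 * M + p + 1) k
    rcases le_or_gt n (planTime len next (3 * M + p + 1) k + 2 * M + p) with h3 | h3
    · have := ih h3
      omega
    · have := hrun.add_le_of_ne_zero hn (hy (k + 1))
      rw [planTime_succ] at this
      omega

/-- Two bounds on the starting point are kept: the run is seen at time `R + 3 * M + p + 1`, which
matters right after the record, and also from stage `k` on. -/
theorem IsPlan.exists_run (h : IsPlan len next κ B C₀) {M p : ℕ} {y : SymbolicSpace m}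
    (hy : ∀ k, IsRun y (planTime len next (3 * M + p + 1) k + 3 * M + p + 1)
      (planLen len next (3 * M + p + 1) k)) (k : ℕ)
    (hk : 1 ≤ planRecord len next (3 * M + p + 1) k) :
    ∃ n, 1 ≤ n ∧ n ≤ planRecord len next (3 * M + p + 1) k + (3 * M + p + 1) ∧
      n ≤ planTime len next (3 * M + p + 1) k ∧
      IsRun y n (len (planRecord len next (3 * M + p + 1) k)) := by
  induction k with
  | zero => exact absurd hk (by rw [planRecord_zero]; omega)
  | succ k ih =>
    have hlt := h.strictMono_planTime (3 * M + p + 1) (Nat.lt_succ_self k)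
    rw [planRecord_succ] at hk ⊢
    split_ifs at hk ⊢ with h1
    · refine ⟨planTime len next (3 * M + p + 1) k + 3 * M + p + 1, by omega, by omega, ?_,
        by simpa [planLen, h1] using hy k⟩
      rw [planTime_succ]
      omega
    · obtain ⟨n, h2, h3, h4, h5⟩ := ih hk
      exact ⟨n, h2, h3, h4.trans hlt.le, h5⟩

/-- The conditions under which a plan produces the prescribed lower and upper limits. -/
structure PlanLimits (len next : ℕ → ℕ) (F : ℕ → ℝ≥0∞) (a b : ℝ≥0∞) : Prop where
  mono : ∀ i j, 1 ≤ i → i ≤ j → F i ≤ F j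
  record_add : ∀ C : ℕ, Tendsto (fun R => ((len R + C : ℕ) : ℝ≥0∞) / F R) atTop (𝓝 b)
  record_shift : ∀ C : ℕ, Tendsto (fun R => (len R : ℝ≥0∞) / F (R + C)) atTop (𝓝 b)
  next_add : ∀ C : ℕ, Tendsto (fun R => ((len R + C : ℕ) : ℝ≥0∞) / F (next R)) atTop (𝓝 a)
  next_shift : ∀ C : ℕ, Tendsto (fun R => (len R : ℝ≥0∞) / F (next R + C)) atTop (𝓝 a)

/-- Up to bounded errors in time and length, `L_N` equals `len R` from a record time `R` until the
next one near `next R`. As `F` is monotone, the ratio peaks near `N = R` and is lowest near `N =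
next R`. -/
theorem PlanLimits.liminf_limsup_eq {F : ℕ → ℝ≥0∞} {a b : ℝ≥0∞} (hF : PlanLimits len next F a b)
    (h : IsPlan len next κ B C₀) {M p : ℕ} {y : SymbolicSpace m}
    (hy : ∀ k, y (planTime len next (3 * M + p + 1) k + 2 * M + p) ≠ 0)
    (hy' : ∀ k, IsRun y (planTime len next (3 * M + p + 1) k + 3 * M + p + 1)
      (planLen len next (3 * M + p + 1) k)) :
    liminf (fun N => (maxZeroRun y N : ℝ≥0∞) / F N) atTop = a ∧
      limsup (fun N => (maxZeroRun y N : ℝ≥0∞) / F N) atTop = b := by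
  have hrun_le := fun k => @IsPlan.run_le m _ len next κ B C₀ h M p y hy k
  have hexists := h.exists_run hy'
  set c := 3 * M + p + 1 with hc
  have hRlim := h.tendsto_planRecord c
  have hTmono := h.strictMono_planTime c
  have hR1 : ∀ᶠ k in atTop, 1 ≤ planRecord len next c k := hRlim.eventually_ge_atTop 1
  have hupper : ∀ k N, N ≤ planTime len next c k + 2 * M + p →
      (maxZeroRun y N : ℝ≥0∞) ≤ ((len (planRecord len next c k) + (c + 1) : ℕ) : ℝ≥0∞) :=
    fun k N hN => toENNReal_maxZeroRun_le (maxZeroRun_le_natCast fun n l _ hn hrun =>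
      hrun_le k (hn.trans hN) hrun)
  have hlower : ∀ k N, 1 ≤ planRecord len next c k →
      (planTime len next c k ≤ N ∨ planRecord len next c k + c ≤ N) →
      ((len (planRecord len next c k) : ℕ) : ℝ≥0∞) ≤ (maxZeroRun y N : ℝ≥0∞) := by
    intro k N hk hN
    obtain ⟨n, h1, h2, h3, h4⟩ := hexists k hk
    refine natCast_le_toENNReal_maxZeroRun.2 (natCast_le_maxZeroRun h1 ?_ h4)
    rcases hN with hN | hN <;> omega
  refine ⟨le_antisymm ?_ ?_, le_antisymm ?_ ?_⟩
  · refine le_of_forall_gt_imp_ge_of_dense fun a' ha' => ?_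
    refine liminf_le_of_frequently_le' (frequently_atTop.2 fun N₀ => ?_)
    have h1 := hRlim.eventually ((hF.next_add (c + 1)).eventually_lt_const ha')
    obtain ⟨K, hK⟩ := eventually_atTop.1 h1
    obtain ⟨k, hk, htr⟩ := h.frequently_trigger c (max K N₀)
    refine ⟨planTime len next c k, ((le_max_right _ _).trans hk).trans hTmono.le_apply, ?_⟩
    refine le_trans ?_ (hK k ((le_max_left _ _).trans hk)).le
    refine ENNReal.div_le_div (hupper k _ (by omega)) (hF.mono _ _ ?_ htr)
    have h2 := h.add_len_le_next (planRecord len next c k)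
    have h3 := h.one_le (planRecord len next c k)
    omega
  · refine le_of_forall_lt_imp_le_of_dense fun a' ha' => ?_
    refine le_liminf_of_le (by isBoundedDefault) ?_
    have h1 := hRlim.eventually ((hF.next_shift (2 * c)).eventually_const_lt ha')
    obtain ⟨K, hK⟩ := eventually_atTop.1 (h1.and hR1)
    filter_upwards [eventually_ge_atTop (planTime len next c K)] with N hN
    obtain ⟨k, hk, hk1, hk2⟩ := exists_le_lt_succ_of_strictMono hTmono hN
    have hN1 : 1 ≤ N := (h.planRecord_lt_planTime c k).trans_le hk1 |>.trans_le' (Nat.zero_le _)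
    -- During the first `c` letters of stage `k` the old record is used, with `N` at most `next R +
    -- 2 * c`; later, a record possibly inserted in this stage is already visible.
    rcases lt_or_ge N (planTime len next c k + c) with h2 | h2
    · have h3 := h.planTime_le_next_add c k
      refine (hK k hk).1.le.trans (ENNReal.div_le_div (hlower k N (hK k hk).2 (Or.inl hk1)) ?_)
      exact hF.mono _ _ hN1 (by omega)
    · have h3 := h.planTime_le_next_add c (k + 1)
      have h4 := h.planRecord_succ_le c k
      obtain ⟨h5, h6⟩ := hK (k + 1) (by omega)
      refine h5.le.trans (ENNReal.div_le_div (hlower (k + 1) N h6 (Or.inr (by omega))) ?_)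
      exact hF.mono _ _ hN1 (by omega)
  · refine le_of_forall_gt_imp_ge_of_dense fun b' hb' => ?_
    refine limsup_le_of_le (by isBoundedDefault) ?_
    have h1 := hRlim.eventually ((hF.record_add (c + 1)).eventually_lt_const hb')
    obtain ⟨K, hK⟩ := eventually_atTop.1 (h1.and hR1)
    filter_upwards [eventually_ge_atTop (planTime len next c K)] with N hN
    obtain ⟨k, hk, hk1, hk2⟩ := exists_le_lt_succ_of_strictMono hTmono hN
    obtain ⟨h5, h6⟩ := hK (k + 1) (by omega)
    refine le_trans (ENNReal.div_le_div (hupper (k + 1) N (by omega)) ?_) h5.le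
    exact hF.mono _ _ h6 ((h.planRecord_succ_le c k).trans hk1)
  · refine le_of_forall_lt_imp_le_of_dense fun b' hb' => ?_
    refine le_limsup_of_frequently_le' (frequently_atTop.2 fun N₀ => ?_)
    have h1 := hRlim.eventually ((hF.record_shift c).eventually_const_lt hb')
    obtain ⟨k, ⟨h2, h3⟩, h4⟩ :=
      ((h1.and hR1).and (hRlim.eventually_ge_atTop N₀)).exists
    refine ⟨planRecord len next c k + c, by omega, h2.le.trans ?_⟩
    gcongr
    exact hlower k _ h3 (Or.inr le_rfl)

/-- If two images agree on `n` letters, all stages completed by then agree, hence so do the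
corresponding blocks of `p` letters of the original points. `mul_planTime_le` bounds the number of
stages from below. The fixed overhead `3 * M + 2` per stage disappears as `p → ∞`. -/
theorem IsPlan.mul_dimH_le (h : IsPlan len next κ B C₀) (hm : 2 ≤ m)
    {S : Set (SymbolicSpace m)} (hS : IsSubshift S) (hspec : HasSpecification S)
    (hent : 0 < entropy S) (hzero : zeroWord m ∈ S) {F : ℕ → ℝ≥0∞} {a b : ℝ≥0∞}
    (hF : PlanLimits len next F a b) :
    ENNReal.ofReal ((1 - κ) / (1 + B)) * dimH S ≤ dimH (ratioSetStar S F a b) := by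
  obtain ⟨M, hM⟩ := hspec.exists_canGlue
  obtain ⟨ζ, hζ, hζ0⟩ := exists_mem_apply_zero_ne_zero hS hent hzero
  set ρ := (1 - κ) / (1 + B) with hρ
  have hρ0 : 0 < ρ := div_pos (by linarith [h.kappa_lt_one]) (by linarith [h.B_nonneg])
  have hstage : ∀ p : ℕ, 1 ≤ p →
      ENNReal.ofReal ((p : ℝ) / (p + (3 * M + 2)) * ρ) * dimH S ≤
        dimH (ratioSetStar S F a b) := by
    intro p hp
    have : Nonempty (SymbolicSpace m) := ⟨ζ⟩
    have hins : ∀ x ∈ S, _ := fun x hx => hM.exists_insertion hm hS hzero hζ hζ0 hp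
      (h.one_le_planLen (3 * M + p + 1)) (planTime_zero len next (3 * M + p + 1))
      (planTime_succ len next (3 * M + p + 1)) (x := x) hx
    choose! g hgS hg using hins
    have hsub : g '' S ⊆ ratioSetStar S F a b := by
      rintro _ ⟨x, hx, rfl⟩
      exact ⟨hgS x hx, hF.liminf_limsup_eq h (fun k => (hg x hx k).2.1) fun k => (hg x hx k).2.2⟩
    refine le_trans ?_ (dimH_mono hsub)
    set r : ℝ≥0 := Real.toNNReal ((p : ℝ) / (p + (3 * M + 2)) * ρ) with hr
    have hp0 : (0 : ℝ) < p := by exact_mod_cast hp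
    have hrpos : 0 < (p : ℝ) / (p + (3 * M + 2)) * ρ := by positivity
    refine mul_dimH_le_dimH_image hm g (Real.toNNReal_pos.2 hrpos)
      (p / (p + (3 * M + 2)) * (1 + |C₀| + len 0) + p) ?_
    intro x hx x' hx' n hn
    have hTmono := h.strictMono_planTime (3 * M + p + 1)
    obtain ⟨k, -, hk1, hk2⟩ := exists_le_lt_succ_of_strictMono hTmono (K := 0) (N := n + 1)
      (by rw [planTime_zero]; omega)
    refine ⟨p * k, ?_, fun i hi => ?_⟩
    · rw [Real.coe_toNNReal _ hrpos.le]
      have h1 := h.mul_planTime_le (3 * M + p + 1) (k + 1)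
      have h2 : ((n + 1 : ℕ) : ℝ) ≤ planTime len next (3 * M + p + 1) (k + 1) := by
        exact_mod_cast hk2.le
      rw [← hρ] at h1
      push_cast at h1 h2 ⊢
      have h3 : ρ * (n + 1) ≤ (k + 1) * (3 * M + p + 1 + 1) + (1 + |C₀| + len 0) :=
        (mul_le_mul_of_nonneg_left h2 hρ0.le).trans h1
      have h4 : (p : ℝ) / (p + (3 * M + 2)) * ((k + 1) * (3 * M + p + 1 + 1)) = p * (k + 1) := by
        have : (p : ℝ) + (3 * M + 2) ≠ 0 := by positivity
        field_simp
        ring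
      have h5 := mul_le_mul_of_nonneg_left h3 (by positivity : 0 ≤ (p : ℝ) / (p + (3 * M + 2)))
      rw [mul_add _ ((k + 1 : ℝ) * _), h4] at h5
      linarith
    · have hq : i / p < k := Nat.div_lt_of_lt_mul hi
      have hmod : i % p < p := Nat.mod_lt _ hp
      have hi' : p * (i / p) + i % p = i := Nat.div_add_mod i p
      have h1 := (hg x hx (i / p)).1 _ hmod
      have h2 := (hg x' hx' (i / p)).1 _ hmod
      rw [hi'] at h1 h2
      rw [← h1, ← h2]
      have h3 := hTmono.monotone (show i / p + 1 ≤ k from hq)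
      have h4 := h.one_le_planLen (3 * M + p + 1) (i / p)
      rw [planTime_succ] at h3
      exact hn _ (by omega)
  have hlim : Tendsto (fun p : ℕ => (p : ℝ) / (p + (3 * M + 2)) * ρ) atTop (𝓝 ρ) := by
    simpa using (tendsto_natCast_div_add_atTop (3 * M + 2 : ℝ)).mul_const ρ
  refine le_of_tendsto (ENNReal.Tendsto.mul_const (ENNReal.tendsto_ofReal hlim)
    (Or.inr (dimH_ne_top hm S))) ?_
  filter_upwards [eventually_ge_atTop 1] with p hp
  exact hstage p hp

end Realize

/-! ### Construction of plans -/

section Construction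

/-- Finitely many values are replaced by runs of length one with a constant waiting time `K > 1 /
κ`; neither limit sees the change. -/
theorem exists_isPlan_of_eventually {len next : ℕ → ℕ} {κ B : ℝ} (hκ0 : 0 < κ) (hκ1 : κ < 1)
    (hB : 0 ≤ B) (h : ∀ᶠ R : ℕ in atTop, 1 ≤ len R ∧ (len R : ℝ) ≤ κ * (next R - R) ∧
      (len R : ℝ) ≤ B * R + 1 ∧ ∀ T ≥ next R, len R ≤ len T) :
    ∃ len' next' : ℕ → ℕ, IsPlan len' next' κ B 1 ∧ len' =ᶠ[atTop] len ∧
      next' =ᶠ[atTop] next := by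
  obtain ⟨N, hN⟩ := eventually_atTop.1 h
  obtain ⟨K, hK⟩ := exists_nat_gt (1 / κ)
  rw [div_lt_iff₀ hκ0] at hK
  have hlt : ∀ R, N ≤ R → R ≤ next R := fun R hR => by
    obtain ⟨h1, h2, -, -⟩ := hN R hR
    have h3 : (1 : ℝ) ≤ len R := by exact_mod_cast h1
    have h4 : (R : ℝ) < next R := by
      by_contra! hle
      nlinarith
    exact_mod_cast h4.le
  refine ⟨fun R => if R < N then 1 else len R, fun R => if R < N then R + K else next R,
    ⟨fun R => ?_, fun R T hRT => ?_, fun R => ?_, fun R => ?_, hκ0, hκ1, hB⟩, ?_, ?_⟩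
  · split_ifs with h1
    · exact le_rfl
    · exact (hN R (not_lt.1 h1)).1
  · split_ifs at hRT ⊢ with h1 h2 h2
    · exact le_rfl
    · exact (hN T (not_lt.1 h2)).1
    · have := hlt R (not_lt.1 h1)
      omega
    · exact (hN R (not_lt.1 h1)).2.2.2 T hRT
  · split_ifs with h1
    · push_cast
      nlinarith
    · exact (hN R (not_lt.1 h1)).2.1
  · split_ifs with h1
    · push_cast
      have : 0 ≤ B * R := by positivity
      linarith
    · exact (hN R (not_lt.1 h1)).2.2.1
  · filter_upwards [eventually_ge_atTop N] with R hR
    rw [if_neg (not_lt.2 hR)]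
  · filter_upwards [eventually_ge_atTop N] with R hR
    rw [if_neg (not_lt.2 hR)]

/-- A normalization which is increasing, unbounded, and insensitive to bounded shifts. -/
structure IsNormalization (F : ℕ → ℝ≥0∞) : Prop where
  mono : ∀ i j, 1 ≤ i → i ≤ j → F i ≤ F j
  tendsto_top : Tendsto F atTop (𝓝 ∞)
  ne_top : ∀ n, F n ≠ ∞
  shift : ∀ C : ℕ, Tendsto (fun n => F n / F (n + C)) atTop (𝓝 1)

/-- Bounded additions to lengths vanish because `F → ∞`, and bounded delays are harmless because `F
n / F (n + C) → 1`. -/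
theorem IsNormalization.planLimits {F : ℕ → ℝ≥0∞} (hF : IsNormalization F) {len next : ℕ → ℕ}
    {a b : ℝ≥0∞} (hnext : Tendsto next atTop atTop)
    (hb : Tendsto (fun R => (len R : ℝ≥0∞) / F R) atTop (𝓝 b))
    (ha : Tendsto (fun R => (len R : ℝ≥0∞) / F (next R)) atTop (𝓝 a)) :
    PlanLimits len next F a b := by
  have hzero : ∀ C : ℕ, Tendsto (fun n => (C : ℝ≥0∞) / F n) atTop (𝓝 0) := fun C => by
    simpa using ENNReal.Tendsto.const_div hF.tendsto_top (a := (C : ℝ≥0∞)) (Or.inr (by simp))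
  have hF0 : ∀ᶠ n in atTop, F n ≠ 0 :=
    (hF.tendsto_top.eventually_ne ENNReal.top_ne_zero)
  have hmul : ∀ C : ℕ, ∀ᶠ n in atTop, ∀ x : ℝ≥0∞, x / F n * (F n / F (n + C)) = x / F (n + C) := by
    intro C
    filter_upwards [hF0] with n hn x
    rw [div_eq_mul_inv, div_eq_mul_inv, div_eq_mul_inv, mul_assoc, ← mul_assoc (F n)⁻¹,
      ENNReal.inv_mul_cancel hn (hF.ne_top n), one_mul]
  refine ⟨hF.mono, fun C => ?_, fun C => ?_, fun C => ?_, fun C => ?_⟩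
  · have := hb.add (hzero C)
    rw [add_zero] at this
    refine this.congr fun R => ?_
    rw [Nat.cast_add, ENNReal.add_div]
  · have := ENNReal.Tendsto.mul hb (Or.inr ENNReal.one_ne_top) (hF.shift C)
      (Or.inl one_ne_zero)
    rw [mul_one] at this
    refine this.congr' ?_
    filter_upwards [hmul C] with R hR
    exact hR _
  · have := ha.add ((hzero C).comp hnext)
    rw [add_zero] at this
    refine this.congr fun R => ?_
    rw [Nat.cast_add, ENNReal.add_div]
    rfl
  · have := ENNReal.Tendsto.mul ha (Or.inr ENNReal.one_ne_top) ((hF.shift C).comp hnext)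
      (Or.inl one_ne_zero)
    rw [mul_one] at this
    refine this.congr' ?_
    filter_upwards [hnext.eventually (hmul C)] with R hR
    exact hR _

/-- The hypotheses on the subshift which are used in the constructions. -/
structure IsGoodSubshift {m : ℕ} [NeZero m] (S : Set (SymbolicSpace m)) : Prop where
  two_le : 2 ≤ m
  isSubshift : IsSubshift S
  spec : HasSpecification S
  entropy_pos : 0 < entropy S
  zero_mem : zeroWord m ∈ S

variable {m : ℕ} [NeZero m] {S : Set (SymbolicSpace m)}

theorem IsNormalization.mul_dimH_le {F : ℕ → ℝ≥0∞} (hF : IsNormalization F)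
    (hS : IsGoodSubshift S) {len next : ℕ → ℕ} {κ B : ℝ} (hκ0 : 0 < κ) (hκ1 : κ < 1)
    (hB : 0 ≤ B) (h : ∀ᶠ R : ℕ in atTop, 1 ≤ len R ∧ (len R : ℝ) ≤ κ * (next R - R) ∧
      (len R : ℝ) ≤ B * R + 1 ∧ ∀ T ≥ next R, len R ≤ len T) {a b : ℝ≥0∞}
    (hb : Tendsto (fun R => (len R : ℝ≥0∞) / F R) atTop (𝓝 b))
    (ha : Tendsto (fun R => (len R : ℝ≥0∞) / F (next R)) atTop (𝓝 a)) :
    ENNReal.ofReal ((1 - κ) / (1 + B)) * dimH S ≤ dimH (ratioSetStar S F a b) := by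
  obtain ⟨len', next', hplan, hlen, hnext⟩ := exists_isPlan_of_eventually hκ0 hκ1 hB h
  refine hplan.mul_dimH_le hS.two_le hS.isSubshift hS.spec hS.entropy_pos hS.zero_mem
    (hF.planLimits (tendsto_atTop_mono (fun R => ?_) tendsto_id) (hb.congr' ?_) (ha.congr' ?_))
  · exact (Nat.le_add_right _ _).trans (hplan.add_len_le_next R)
  · filter_upwards [hlen] with R h1
    rw [h1]
  · filter_upwards [hlen, hnext] with R h1 h2
    rw [h1, h2]

/-- Records of constant length one keep `L_N` bounded while `F → ∞`. Here `B = 0`, and spacing the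
records makes `κ` arbitrarily small. -/
theorem IsNormalization.dimH_zero_zero {F : ℕ → ℝ≥0∞} (hF : IsNormalization F)
    (hS : IsGoodSubshift S) : dimH S ≤ dimH (ratioSetStar S F 0 0) := by
  have hstep : ∀ κ ∈ Ioo (0 : ℝ) 1, ENNReal.ofReal (1 - κ) * dimH S ≤
      dimH (ratioSetStar S F 0 0) := by
    intro κ hκ
    obtain ⟨K, hK⟩ := exists_nat_gt (1 / κ)
    rw [div_lt_iff₀ hκ.1] at hK
    have h0 : Tendsto (fun n => ((1 : ℕ) : ℝ≥0∞) / F n) atTop (𝓝 0) := by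
      simpa using ENNReal.Tendsto.const_div hF.tendsto_top (a := ((1 : ℕ) : ℝ≥0∞))
        (Or.inr (by simp))
    have := hF.mul_dimH_le hS (len := fun _ => 1) (next := fun R => R + K) hκ.1 hκ.2
      (le_refl (0 : ℝ)) (Eventually.of_forall fun R => ⟨le_rfl, by push_cast; nlinarith,
        by simp, fun _ _ => le_rfl⟩) h0 (h0.comp (tendsto_add_atTop_nat K))
    simpa using this
  have hlim : Tendsto (fun κ : ℝ => ENNReal.ofReal (1 - κ) * dimH S) (𝓝[>] 0) (𝓝 (dimH S)) := by
    have h1 : Tendsto (fun κ : ℝ => 1 - κ) (𝓝[>] 0) (𝓝 1) := by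
      have : ContinuousAt (fun κ : ℝ => 1 - κ) 0 := by fun_prop
      simpa using this.tendsto.mono_left nhdsWithin_le_nhds
    simpa using ENNReal.Tendsto.mul_const (ENNReal.tendsto_ofReal h1)
      (b := dimH S) (Or.inr (dimH_ne_top hS.two_le S))
  exact le_of_tendsto hlim (Filter.mem_of_superset (Ioo_mem_nhdsGT one_pos) hstep)

theorem natCast_div_natCast_eq_ofReal {i j : ℕ} (hj : 1 ≤ j) :
    (i : ℝ≥0∞) / (j : ℝ≥0∞) = ENNReal.ofReal ((i : ℝ) / j) := by
  rw [ENNReal.ofReal_div_of_pos (by exact_mod_cast hj), ENNReal.ofReal_natCast,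
    ENNReal.ofReal_natCast]

theorem isNormalization_natCast : IsNormalization (fun N => (N : ℝ≥0∞)) := by
  refine ⟨fun i j _ h => Nat.cast_le.2 h, ENNReal.tendsto_nat_nhds_top,
    fun n => ENNReal.natCast_ne_top n, fun C => ?_⟩
  have h1 : Tendsto (fun n : ℕ => ENNReal.ofReal ((n : ℝ) / (n + (C : ℝ)))) atTop (𝓝 1) := by
    simpa using ENNReal.tendsto_ofReal (tendsto_natCast_div_add_atTop (C : ℝ))
  refine h1.congr' ?_
  filter_upwards [eventually_ge_atTop 1] with n hn
  rw [natCast_div_natCast_eq_ofReal (by omega), Nat.cast_add]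

/-- The lower bound for the linear normalization. -/
theorem mul_dimH_le_dimH_ratioSetStar_natCast (hS : IsGoodSubshift S) {A B : ℝ} (hA : 0 ≤ A)
    (hB : 0 < B) (hAB : A * (1 + B) < B) :
    ENNReal.ofReal ((B * (1 - A) - A) / ((1 + B) * (B - A))) * dimH S ≤
      dimH (ratioSetStar S (fun N => N) (ENNReal.ofReal A) (ENNReal.ofReal B)) := by
  have hBA : 0 < B - A := by nlinarith
  -- With `len R ≈ B * R` and `next R ≈ (B / A) * R`, the ratio `len R / (next R - R)` tends to
  -- `κ₀`; every larger `κ` satisfies the gap condition eventually.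
  set κ₀ := A * B / (B - A) with hκ₀
  have hκ₀0 : 0 ≤ κ₀ := by positivity
  have hκ₀1 : κ₀ < 1 := by
    rw [hκ₀, div_lt_one hBA]
    linarith
  have hstep : ∀ κ ∈ Ioo κ₀ 1, ENNReal.ofReal ((1 - κ) / (1 + B)) * dimH S ≤
      dimH (ratioSetStar S (fun N => N) (ENNReal.ofReal A) (ENNReal.ofReal B)) := by
    rintro κ ⟨hκ0, hκ1⟩
    have hκpos : 0 < κ := hκ₀0.trans_lt hκ0
    -- The added term keeps the slope positive, so that `next` makes sense also for `A = 0`.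
    set α : ℕ → ℝ := fun R => A + 1 / ((R : ℝ) + 1) with hα
    have hαpos : ∀ R, 0 < α R := fun R => by positivity
    have hαlim : Tendsto α atTop (𝓝 A) := by
      simpa [hα] using (tendsto_one_div_add_atTop_nhds_zero_nat (𝕜 := ℝ)).const_add A
    set len : ℕ → ℕ := fun R => ⌈B * (R : ℝ)⌉₊ with hlen
    set next : ℕ → ℕ := fun R => ⌈(len R : ℝ) / α R⌉₊ with hnext
    have hlenR : ∀ R, B * R ≤ len R := fun R => Nat.le_ceil _
    have hnextR : ∀ R, (len R : ℝ) / α R ≤ next R := fun R => Nat.le_ceil _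
    have hBlim : Tendsto (fun R : ℕ => (len R : ℝ) / R) atTop (𝓝 B) :=
      (tendsto_nat_ceil_mul_div_atTop hB.le).comp tendsto_natCast_atTop_atTop
    have hlentop : Tendsto (fun R : ℕ => (len R : ℝ)) atTop atTop :=
      tendsto_atTop_mono hlenR (tendsto_natCast_atTop_atTop.const_mul_atTop hB)
    have hgap : ∀ᶠ R : ℕ in atTop, (len R : ℝ) ≤ κ * (next R - R) := by
      have h1 : ∀ᶠ R in atTop, B * α R < κ * (B - α R) := by
        refine (hαlim.const_mul B).eventually_lt ((hαlim.const_sub B).const_mul κ) ?_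
        rw [hκ₀, div_lt_iff₀ hBA] at hκ0
        linarith
      filter_upwards [h1] with R hR
      have h2 := hαpos R
      have h3 : (len R : ℝ) * α R ≤ κ * (len R - R * α R) := by
        have h4 : 0 ≤ (κ - α R) := by
          by_contra! h5
          nlinarith
        have h6 := mul_le_mul_of_nonneg_left (hlenR R) h4
        have h7 : (0 : ℝ) ≤ R := Nat.cast_nonneg R
        nlinarith
      have h8 : (len R : ℝ) ≤ κ * (len R / α R - R) := by
        have e : κ * (len R / α R - R) = κ * (len R - R * α R) / α R := by field_simp
        rw [e, le_div_iff₀ h2]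
        exact h3
      exact h8.trans (mul_le_mul_of_nonneg_left (by linarith [hnextR R]) hκpos.le)
    have hnexttop : Tendsto (fun R : ℕ => (len R : ℝ) / α R) atTop atTop :=
      tendsto_atTop_mono (fun R => div_le_div_of_nonneg_left (Nat.cast_nonneg _) (hαpos R)
        (add_le_add_right (div_le_one_of_le₀ (by simp) (by positivity)) A))
        (hlentop.atTop_div_const (by positivity : (0 : ℝ) < A + 1))
    refine isNormalization_natCast.mul_dimH_le hS hκpos hκ1 hB.le (len := len) (next := next)
      ?_ ?_ ?_
    · filter_upwards [hgap, hlentop.eventually_ge_atTop 1] with R h1 h2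
      refine ⟨by exact_mod_cast h2, h1, (Nat.ceil_lt_add_one (by positivity)).le, fun T hT => ?_⟩
      have hRT : (R : ℝ) ≤ T := by
        have : (next R : ℝ) ≤ T := by exact_mod_cast hT
        by_contra! h3
        nlinarith
      exact Nat.ceil_le_ceil (mul_le_mul_of_nonneg_left hRT hB.le)
    · refine (ENNReal.tendsto_ofReal hBlim).congr' ?_
      filter_upwards [eventually_ge_atTop 1] with R hR
      rw [natCast_div_natCast_eq_ofReal hR]
    · have h1 : Tendsto (fun R => α R * ((⌈(len R : ℝ) / α R⌉₊ : ℝ) / ((len R : ℝ) / α R))⁻¹)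
          atTop (𝓝 A) := by
        have := hαlim.mul (((tendsto_nat_ceil_div_atTop (R := ℝ)).comp hnexttop).inv₀ one_ne_zero)
        simpa using this
      refine (ENNReal.tendsto_ofReal h1).congr' ?_
      filter_upwards [hlentop.eventually_ge_atTop 1] with R hR
      have h2 := hαpos R
      have h3 : 0 < (len R : ℝ) / α R := by positivity
      rw [natCast_div_natCast_eq_ofReal (Nat.ceil_pos.2 h3)]
      congr 1
      field_simp
  have hlim : Tendsto (fun κ : ℝ => ENNReal.ofReal ((1 - κ) / (1 + B)) * dimH S) (𝓝[>] κ₀)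
      (𝓝 (ENNReal.ofReal ((B * (1 - A) - A) / ((1 + B) * (B - A))) * dimH S)) := by
    refine ENNReal.Tendsto.mul_const (ENNReal.tendsto_ofReal ?_)
      (Or.inr (dimH_ne_top hS.two_le S))
    have : ContinuousAt (fun κ : ℝ => (1 - κ) / (1 + B)) κ₀ := by fun_prop
    have e : (B * (1 - A) - A) / ((1 + B) * (B - A)) = (1 - κ₀) / (1 + B) := by
      rw [hκ₀]
      field_simp
      ring
    rw [e]
    exact this.tendsto.mono_left nhdsWithin_le_nhds
  exact le_of_tendsto hlim (Filter.mem_of_superset (Ioo_mem_nhdsGT hκ₀1) hstep)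

end Construction

/-! ### Slowly varying normalizations -/

section Slow

/-- Diagonal choice of a slowly growing parameter. -/
theorem exists_monotone_tendsto_eventually {P : ℕ → ℕ → Prop} (h : ∀ i, ∀ᶠ N in atTop, P i N) :
    ∃ c : ℕ → ℕ, Monotone c ∧ Tendsto c atTop atTop ∧ ∀ᶠ N in atTop, P (c N) N := by
  classical
  choose t ht using fun i => eventually_atTop.1 (h i)
  -- Requiring all thresholds up to `i` makes the choice well defined from `t 0` on; the search is
  -- capped at `N` so that it is finite.
  let Q : ℕ → ℕ → Prop := fun N i => ∀ j ≤ i, t j ≤ N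
  refine ⟨fun N => Nat.findGreatest (Q N) N, fun N N' hN => ?_, ?_, ?_⟩
  · exact Nat.findGreatest_mono (fun i hi j hj => (hi j hj).trans hN) hN
  · refine tendsto_atTop.2 fun i => ?_
    filter_upwards [eventually_ge_atTop i,
      (Finset.range (i + 1)).eventually_all.2 fun j _ => eventually_ge_atTop (t j)] with N h1 h2
    exact Nat.le_findGreatest h1 fun j hj => h2 j (Finset.mem_range.2 (by omega))
  · filter_upwards [eventually_ge_atTop (t 0)] with N hN
    have h0 : Q N 0 := fun j hj => by
      rw [Nat.le_zero.1 hj]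
      exact hN
    exact ht _ N (Nat.findGreatest_spec (P := Q N) (Nat.zero_le N) h0 _ le_rfl)

/-- A positive unbounded increasing function with `f N = o(N)` and `f (N + f N) ∼ f N`. -/
structure IsSlow (f : ℕ → ℝ) : Prop where
  mono : ∀ i j, 1 ≤ i → i ≤ j → f i ≤ f j
  tendsto_atTop : Tendsto f atTop atTop
  tendsto_div : Tendsto (fun N : ℕ => f N / N) atTop (𝓝 0)
  slow : ∀ η > 0, ∀ᶠ N : ℕ in atTop, ∀ n : ℕ, 1 ≤ n → (n : ℝ) ≤ N + f N → f n ≤ (1 + η) * f N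

variable {f : ℕ → ℝ}

/-- Iterates the one-step estimate `K` times. Each step moves to the integer `N + ⌊f N⌋₊`, which
exceeds `N + f N - 1`; this rounding explains the `f N - 1`. -/
theorem IsSlow.slow_mul_sub_one (hf : IsSlow f) (K : ℕ) : ∀ η > 0, ∀ᶠ N : ℕ in atTop,
    ∀ n : ℕ, 1 ≤ n → (n : ℝ) ≤ N + K * (f N - 1) → f n ≤ (1 + η) * f N := by
  induction K with
  | zero =>
    intro η hη
    filter_upwards [hf.tendsto_atTop.eventually_ge_atTop 0] with N hN n hn hle
    have hnN : n ≤ N := by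
      have : (n : ℝ) ≤ N := by simpa using hle
      exact_mod_cast this
    have := hf.mono n N hn hnN
    nlinarith
  | succ K ih =>
    intro η hη
    -- Chosen so that `(1 + δ) ^ 2 ≤ 1 + 3 * δ ≤ 1 + η`.
    set δ := min η 1 / 3 with hδ
    have hδ0 : 0 < δ := by positivity
    have hδη : δ * 3 ≤ η := by
      rw [hδ]
      linarith [min_le_left η 1]
    have hδ1 : δ * 3 ≤ 1 := by
      rw [hδ]
      linarith [min_le_right η 1]
    obtain ⟨N₁, hN₁⟩ := eventually_atTop.1 (ih δ hδ0)
    filter_upwards [hf.slow δ hδ0, eventually_ge_atTop (max N₁ 1),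
      hf.tendsto_atTop.eventually_ge_atTop 0] with N h1 h2 h3 n hn hle
    have hN1 : 1 ≤ N := (le_max_right _ _).trans h2
    have hfl := Nat.floor_le h3
    have hfl' := Nat.lt_floor_add_one (f N)
    have h4 := h1 (N + ⌊f N⌋₊) (by omega) (by push_cast; linarith)
    have h5 := hf.mono N (N + ⌊f N⌋₊) hN1 (by omega)
    have h6 := hN₁ (N + ⌊f N⌋₊) (((le_max_left _ _).trans h2).trans (by omega)) n hn (by
      push_cast at hle ⊢
      have : (K : ℝ) * (f N - 1) ≤ K * (f (N + ⌊f N⌋₊) - 1) := by gcongr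
      linarith)
    calc f n ≤ (1 + δ) * f (N + ⌊f N⌋₊) := h6
      _ ≤ (1 + δ) * ((1 + δ) * f N) := by gcongr
      _ ≤ (1 + η) * f N := by
        rw [← mul_assoc]
        refine mul_le_mul_of_nonneg_right ?_ h3
        nlinarith

theorem IsSlow.slow_mul (hf : IsSlow f) (K : ℝ) {η : ℝ} (hη : 0 < η) : ∀ᶠ N : ℕ in atTop,
    ∀ n : ℕ, 1 ≤ n → (n : ℝ) ≤ N + K * f N → f n ≤ (1 + η) * f N := by
  -- Once `f N ≥ 2`, one has `f N - 1 ≥ f N / 2`, so doubling `K` compensates for the rounding.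
  obtain ⟨K', hK'⟩ := exists_nat_ge (2 * K)
  filter_upwards [hf.slow_mul_sub_one K' η hη, hf.tendsto_atTop.eventually_ge_atTop 2] with
    N h1 h2 n hn hle
  refine h1 n hn (hle.trans ?_)
  have : (0 : ℝ) ≤ K' := Nat.cast_nonneg _
  nlinarith

theorem IsSlow.isNormalization (hf : IsSlow f) :
    IsNormalization (fun N => ENNReal.ofReal (f N)) := by
  refine ⟨fun i j hi hij => ENNReal.ofReal_le_ofReal (hf.mono i j hi hij),
    ENNReal.tendsto_ofReal_atTop.comp hf.tendsto_atTop, fun n => ENNReal.ofReal_ne_top,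
    fun C => ?_⟩
  have hlim : Tendsto (fun n => f (n + C) / f n) atTop (𝓝 1) := by
    rw [Metric.tendsto_nhds]
    intro ε hε
    filter_upwards [hf.slow (ε / 2) (by positivity), hf.tendsto_atTop.eventually_ge_atTop (C : ℝ),
      hf.tendsto_atTop.eventually_gt_atTop 0, eventually_ge_atTop 1] with n h1 h2 h3 h4
    have h5 := h1 (n + C) (by omega) (by push_cast; linarith)
    have h6 := hf.mono n (n + C) h4 (by omega)
    have h7 : f (n + C) / f n ≤ 1 + ε / 2 := (div_le_iff₀ h3).2 h5
    have h8 : 1 ≤ f (n + C) / f n := (one_le_div h3).2 h6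
    rw [Real.dist_eq, abs_of_nonneg (by linarith)]
    linarith
  have hlim' := ENNReal.tendsto_ofReal (hlim.inv₀ one_ne_zero)
  rw [inv_one, ENNReal.ofReal_one] at hlim'
  refine hlim'.congr' ?_
  filter_upwards [hf.tendsto_atTop.eventually_gt_atTop 0,
    (hf.tendsto_atTop.comp (tendsto_add_atTop_nat C)).eventually_gt_atTop 0] with n h1 h2
  have h2' : 0 < f (n + C) := h2
  rw [← ENNReal.ofReal_div_of_pos h2', inv_div]

/-- Approximation of `a ≤ b` by sequences of positive reals, increasing from `α` to `β`. -/
theorem exists_approx {a b : ℝ≥0∞} (hab : a ≤ b) (hb : 0 < b) : ∃ α β : ℕ → ℝ,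
    (∀ i, 0 < α i) ∧ (∀ i, α i < β i) ∧ (∀ i j, i ≤ j → α i ≤ β j) ∧
      Tendsto (fun i => ENNReal.ofReal (α i)) atTop (𝓝 a) ∧
      Tendsto (fun i => ENNReal.ofReal (β i)) atTop (𝓝 b) := by
  have hnat : Tendsto (fun i : ℕ => (i : ℝ)) atTop atTop := tendsto_natCast_atTop_atTop
  by_cases hbt : b = ∞
  · subst hbt
    by_cases hat : a = ∞
    · subst hat
      refine ⟨fun i => i + 1, fun i => i + 2, fun i => by positivity, fun i => by linarith,
        fun i j hij => ?_, ENNReal.tendsto_ofReal_atTop.comp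
          (tendsto_atTop_add_const_right _ _ hnat),
        ENNReal.tendsto_ofReal_atTop.comp (tendsto_atTop_add_const_right _ _ hnat)⟩
      have : (i : ℝ) ≤ j := by exact_mod_cast hij
      linarith
    · refine ⟨fun i => a.toReal + 1 / ((i : ℝ) + 1), fun i => i + (a.toReal + 2),
        fun i => by positivity, ?_, ?_, ?_, ENNReal.tendsto_ofReal_atTop.comp
          (tendsto_atTop_add_const_right _ _ hnat)⟩
      · intro i
        have h1 : 1 / ((i : ℝ) + 1) ≤ 1 := div_le_one_of_le₀ (by simp) (by positivity)
        have h2 : (0 : ℝ) ≤ i := Nat.cast_nonneg i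
        dsimp only
        linarith
      · intro i j _
        have h1 : 1 / ((i : ℝ) + 1) ≤ 1 := div_le_one_of_le₀ (by simp) (by positivity)
        have h2 : (0 : ℝ) ≤ j := Nat.cast_nonneg j
        dsimp only
        linarith
      · have := ENNReal.tendsto_ofReal
          ((tendsto_one_div_add_atTop_nhds_zero_nat (𝕜 := ℝ)).const_add a.toReal)
        rwa [add_zero, ENNReal.ofReal_toReal hat] at this
  · have hat : a ≠ ∞ := ne_top_of_le_ne_top hbt hab
    have hb0 : 0 < b.toReal := ENNReal.toReal_pos hb.ne' hbt
    have hab' : a.toReal ≤ b.toReal := ENNReal.toReal_mono hbt hab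
    have ha0 : 0 ≤ a.toReal := ENNReal.toReal_nonneg
    have hlt : ∀ i : ℕ, (a.toReal * (i + 1) + b.toReal) / (i + 3) < b.toReal := fun i => by
      rw [div_lt_iff₀ (by positivity)]
      have : (0 : ℝ) ≤ i := Nat.cast_nonneg i
      nlinarith
    -- A weighted mean of `a`, `b` and 0 with weights `i + 1`, 1, 1: the weight on `b` makes it
    -- positive when `a = 0`, and the weight on 0 puts it below `b` when `a = b`.
    refine ⟨fun i => (a.toReal * (i + 1) + b.toReal) / (i + 3), fun _ => b.toReal,
      fun i => by positivity, hlt, fun i _ _ => (hlt i).le, ?_, ?_⟩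
    · have h1 : Tendsto (fun i : ℕ => a.toReal + (b.toReal - 2 * a.toReal) / ((i : ℝ) + 3)) atTop
          (𝓝 a.toReal) := by
        simpa using ((tendsto_atTop_add_const_right _ (3 : ℝ) hnat).const_div_atTop
          (b.toReal - 2 * a.toReal)).const_add a.toReal
      have h2 := ENNReal.tendsto_ofReal h1
      rw [ENNReal.ofReal_toReal hat] at h2
      refine h2.congr fun i => ?_
      congr 1
      have : (i : ℝ) + 3 ≠ 0 := by positivity
      field_simp
      ring
    · simp only [ENNReal.ofReal_toReal hbt]
      exact tendsto_const_nhds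

variable {m : ℕ} [NeZero m] {S : Set (SymbolicSpace m)}

/-- A record at `R` has length about `β * f R`, and the next one waits until `α * f` reaches that
length. Since `α < β` and `f` is nearly constant on windows of size a multiple of `f R`, the wait
exceeds `len R / κ`, for any `κ`; and `len R ≤ B * R + 1` for any `B` because `f N = o(N)`. Letting
`α`, `β` vary slowly with `R` reaches all pairs, including `a = b`, `a = 0` and infinite values. -/
theorem IsSlow.mul_dimH_le (hf : IsSlow f) (hS : IsGoodSubshift S) {a b : ℝ≥0∞} (hab : a ≤ b)
    (hb : 0 < b) {κ B : ℝ} (hκ0 : 0 < κ) (hκ1 : κ < 1) (hB : 0 < B) :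
    ENNReal.ofReal ((1 - κ) / (1 + B)) * dimH S ≤
      dimH (ratioSetStar S (fun N => ENNReal.ofReal (f N)) a b) := by
  classical
  obtain ⟨α, β, hα0, hαβ, hmono, hαlim, hβlim⟩ := exists_approx hab hb
  have hβ0 : ∀ i, 0 < β i := fun i => (hα0 i).trans (hαβ i)
  -- In order: the rounding error of `len` is relatively small; records are short compared with
  -- time; the waiting time is long; and `f` has small jumps, so `α * f (next R)` barely overshoots
  -- `len R`.
  have hP : ∀ i : ℕ, ∀ᶠ N : ℕ in atTop, (i : ℝ) + 1 ≤ f N ∧ β i * f N ≤ B * N ∧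
      (∀ n : ℕ, 1 ≤ n → (n : ℝ) ≤ N + (β i * f N + 1) / κ → α i * f n < β i * f N) ∧
      ∀ n ≥ N, f (n + 1) ≤ (1 + 1 / ((i : ℝ) + 1)) * f n := by
    intro i
    have h1 : ∀ᶠ N : ℕ in atTop, f N / N < B / β i :=
      hf.tendsto_div.eventually_lt_const (div_pos hB (hβ0 i))
    obtain ⟨η, hη0, hη⟩ : ∃ η > 0, (1 + η) * α i < β i := by
      refine ⟨(β i - α i) / (2 * α i), div_pos (by linarith [hαβ i]) (by linarith [hα0 i]), ?_⟩
      have := (hα0 i).ne'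
      have e : (1 + (β i - α i) / (2 * α i)) * α i = (α i + β i) / 2 := by
        field_simp
        ring
      rw [e]
      linarith [hαβ i]
    have h2 := hf.slow_mul ((β i + 1) / κ) hη0
    obtain ⟨N₁, hN₁⟩ := eventually_atTop.1 ((hf.slow (1 / ((i : ℝ) + 1)) (by positivity)).and
      (hf.tendsto_atTop.eventually_ge_atTop 1))
    filter_upwards [h1, h2, hf.tendsto_atTop.eventually_ge_atTop ((i : ℝ) + 1),
      eventually_ge_atTop N₁, eventually_ge_atTop 1] with N h3 h4 h5 h6 h7
    have hi0 : (0 : ℝ) ≤ i := Nat.cast_nonneg i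
    have hN0 : (0 : ℝ) < N := by exact_mod_cast h7
    refine ⟨h5, ?_, fun n hn hle => ?_, fun n hn => ?_⟩
    · rw [div_lt_div_iff₀ hN0 (hβ0 i)] at h3
      linarith
    · have h8 := h4 n hn (hle.trans (by
        rw [div_mul_eq_mul_div]
        gcongr
        nlinarith))
      have h9 := mul_le_mul_of_nonneg_left h8 (hα0 i).le
      nlinarith
    · have h8 := hN₁ n (h6.trans hn)
      exact h8.1 (n + 1) (by omega) (by push_cast; linarith [h8.2])
  obtain ⟨c, hcmono, hclim, hc⟩ := exists_monotone_tendsto_eventually hP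
  set len : ℕ → ℕ := fun R => ⌈β (c R) * f R⌉₊ with hlen
  have hex : ∀ R, ∃ n, 1 ≤ n ∧ (len R : ℝ) ≤ α (c R) * f n := fun R =>
    ((eventually_ge_atTop 1).and
      ((hf.tendsto_atTop.const_mul_atTop (hα0 (c R))).eventually_ge_atTop (len R : ℝ))).exists
  set next : ℕ → ℕ := fun R => Nat.find (hex R) with hnext
  have hnext1 : ∀ R, 1 ≤ next R := fun R => (Nat.find_spec (hex R)).1
  have hnext2 : ∀ R, (len R : ℝ) ≤ α (c R) * f (next R) := fun R => (Nat.find_spec (hex R)).2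
  have hnext3 : ∀ R n, 1 ≤ n → n < next R → α (c R) * f n < len R := fun R n hn hlt => by
    have := Nat.find_min (hex R) hlt
    rw [not_and, not_le] at this
    exact this hn
  have hlenlow : ∀ R, β (c R) * f R ≤ len R := fun R => Nat.le_ceil _
  have hgap : ∀ᶠ R : ℕ in atTop, 0 < f R ∧ (len R : ℝ) < β (c R) * f R + 1 ∧
      (R : ℝ) + len R / κ < next R := by
    filter_upwards [hc, hf.tendsto_atTop.eventually_gt_atTop 0] with R hR hR0
    have h1 : (len R : ℝ) < β (c R) * f R + 1 :=
      Nat.ceil_lt_add_one (mul_nonneg (hβ0 _).le hR0.le)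
    refine ⟨hR0, h1, ?_⟩
    by_contra! hle
    have h2 := hR.2.2.1 (next R) (hnext1 R) (hle.trans (by gcongr))
    linarith [hnext2 R, hlenlow R]
  have hRnext : ∀ᶠ R : ℕ in atTop, R < next R := by
    filter_upwards [hgap] with R hR
    have : (R : ℝ) < next R := lt_of_le_of_lt (by
      have : (0 : ℝ) ≤ len R / κ := by positivity
      linarith) hR.2.2
    exact_mod_cast this
  have hclim' : Tendsto (fun R => ENNReal.ofReal (1 / ((c R : ℝ) + 1))) atTop (𝓝 0) := by
    have := ENNReal.tendsto_ofReal
      ((tendsto_one_div_add_atTop_nhds_zero_nat (𝕜 := ℝ)).comp hclim)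
    rwa [ENNReal.ofReal_zero] at this
  refine hf.isNormalization.mul_dimH_le hS hκ0 hκ1 hB.le (len := len) (next := next) ?_ ?_ ?_
  · filter_upwards [hc, hgap, hRnext, eventually_ge_atTop 1] with R hR ⟨h0, h1, h2⟩ h3 h4
    refine ⟨?_, ?_, by linarith [hR.2.1], fun T hT => ?_⟩
    · exact Nat.ceil_pos.2 (mul_pos (hβ0 _) h0)
    · have h5 : (len R : ℝ) / κ ≤ next R - R := by linarith
      rwa [div_le_iff₀' hκ0] at h5
    · have h6 : (len R : ℝ) ≤ len T := by
        calc (len R : ℝ) ≤ α (c R) * f (next R) := hnext2 R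
          _ ≤ β (c T) * f T := by
            refine mul_le_mul (hmono _ _ (hcmono (h3.le.trans hT)))
              (hf.mono _ _ (hnext1 R) hT) ?_ (hβ0 _).le
            exact h0.le.trans (hf.mono _ _ h4 h3.le)
          _ ≤ len T := hlenlow T
      exact_mod_cast h6
  · have hup : Tendsto (fun R => ENNReal.ofReal (β (c R)) + ENNReal.ofReal (1 / ((c R : ℝ) + 1)))
        atTop (𝓝 b) := by
      simpa using (hβlim.comp hclim).add hclim'
    refine tendsto_of_tendsto_of_tendsto_of_le_of_le' (hβlim.comp hclim) hup ?_ ?_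
    · filter_upwards [hgap] with R hR
      rw [← ENNReal.ofReal_natCast, ← ENNReal.ofReal_div_of_pos hR.1]
      exact ENNReal.ofReal_le_ofReal ((le_div_iff₀ hR.1).2 (hlenlow R))
    · filter_upwards [hgap, hc] with R hR hR'
      rw [← ENNReal.ofReal_natCast, ← ENNReal.ofReal_div_of_pos hR.1,
        ← ENNReal.ofReal_add (hβ0 _).le (by positivity)]
      refine ENNReal.ofReal_le_ofReal ((div_le_iff₀ hR.1).2 (hR.2.1.le.trans ?_))
      have h1 : 1 ≤ 1 / ((c R : ℝ) + 1) * f R := by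
        rw [one_div_mul_eq_div, le_div_iff₀ (by positivity), one_mul]
        exact hR'.1
      linarith
  · have hlow : Tendsto (fun R => ENNReal.ofReal (α (c R)) *
        ENNReal.ofReal ((1 + 1 / ((c R : ℝ) + 1))⁻¹)) atTop (𝓝 a) := by
      have h1 : Tendsto (fun R => (1 + 1 / ((c R : ℝ) + 1))⁻¹) atTop (𝓝 1) := by
        have := (((tendsto_one_div_add_atTop_nhds_zero_nat (𝕜 := ℝ)).comp hclim).const_add
          1).inv₀ (by norm_num)
        simpa using this
      have := ENNReal.Tendsto.mul (hαlim.comp hclim) (Or.inr ENNReal.ofReal_ne_top)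
        (ENNReal.tendsto_ofReal h1) (Or.inl (by simp))
      simpa using this
    refine tendsto_of_tendsto_of_tendsto_of_le_of_le' hlow (hαlim.comp hclim) ?_ ?_
    · filter_upwards [hgap, hc, hRnext, eventually_ge_atTop 1] with R hR hR' h1 h2
      have hpos : 0 < f (next R) := hR.1.trans_le (hf.mono _ _ h2 h1.le)
      rw [← ENNReal.ofReal_natCast, ← ENNReal.ofReal_div_of_pos hpos,
        ← ENNReal.ofReal_mul (hα0 _).le]
      refine ENNReal.ofReal_le_ofReal ((le_div_iff₀ hpos).2 ?_)
      have h3 := hR'.2.2.2 (next R - 1) (by omega)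
      rw [Nat.sub_add_cancel (by omega)] at h3
      have h4 := hnext3 R (next R - 1) (by omega) (by omega)
      have hq : 0 < 1 + 1 / ((c R : ℝ) + 1) := by positivity
      have h5 : (1 + 1 / ((c R : ℝ) + 1))⁻¹ * f (next R) ≤ f (next R - 1) := by
        rw [inv_mul_le_iff₀ hq]
        exact h3
      have h6 := mul_le_mul_of_nonneg_left h5 (hα0 (c R)).le
      linarith
    · filter_upwards [hgap, hRnext, eventually_ge_atTop 1] with R hR h1 h2
      have hpos : 0 < f (next R) := hR.1.trans_le (hf.mono _ _ h2 h1.le)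
      rw [← ENNReal.ofReal_natCast, ← ENNReal.ofReal_div_of_pos hpos]
      exact ENNReal.ofReal_le_ofReal ((div_le_iff₀ hpos).2 (hnext2 R))

theorem IsSlow.dimH_le (hf : IsSlow f) (hS : IsGoodSubshift S) {a b : ℝ≥0∞} (hab : a ≤ b) :
    dimH S ≤ dimH (ratioSetStar S (fun N => ENNReal.ofReal (f N)) a b) := by
  rcases eq_or_ne b 0 with rfl | hb
  · obtain rfl : a = 0 := le_antisymm hab zero_le
    exact hf.isNormalization.dimH_zero_zero hS
  · have hlim : Tendsto (fun κ : ℝ => ENNReal.ofReal ((1 - κ) / (1 + κ)) * dimH S) (𝓝[>] 0)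
        (𝓝 (dimH S)) := by
      have h1 : Tendsto (fun κ : ℝ => (1 - κ) / (1 + κ)) (𝓝[>] 0) (𝓝 1) := by
        have : ContinuousAt (fun κ : ℝ => (1 - κ) / (1 + κ)) 0 := by
          fun_prop (disch := norm_num)
        simpa using this.tendsto.mono_left nhdsWithin_le_nhds
      simpa using ENNReal.Tendsto.mul_const (ENNReal.tendsto_ofReal h1)
        (b := dimH S) (Or.inr (dimH_ne_top hS.two_le S))
    exact le_of_tendsto hlim (Filter.mem_of_superset (Ioo_mem_nhdsGT one_pos) fun κ hκ =>
      hf.mul_dimH_le hS hab (pos_iff_ne_zero.2 hb) hκ.1 hκ.2 hκ.1)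

end Slow

/-! ### Comparison of normalizations -/

section Compare

theorem liminf_mul_of_tendsto {u v : ℕ → ℝ≥0∞} {c : ℝ≥0∞} (hv : Tendsto v atTop (𝓝 c))
    (hc0 : c ≠ 0) (hct : c ≠ ∞) :
    liminf (fun n => v n * u n) atTop = c * liminf u atTop := by
  refine le_antisymm ?_ ?_
  · have := ENNReal.liminf_mul_le (f := atTop) (u := v) (v := u)
      (Or.inl (by rwa [hv.limsup_eq])) (Or.inl (by rwa [hv.limsup_eq]))
    rwa [hv.limsup_eq] at this
  · have := ENNReal.le_liminf_mul (f := atTop) (u := v) (v := u)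
    rwa [hv.liminf_eq] at this

theorem limsup_mul_of_tendsto {u v : ℕ → ℝ≥0∞} {c : ℝ≥0∞} (hv : Tendsto v atTop (𝓝 c))
    (hc0 : c ≠ 0) (hct : c ≠ ∞) :
    limsup (fun n => v n * u n) atTop = c * limsup u atTop := by
  refine le_antisymm ?_ ?_
  · have := ENNReal.limsup_mul_le' (f := atTop) (u := v) (v := u)
      (Or.inl (by rwa [hv.limsup_eq])) (Or.inl (by rwa [hv.limsup_eq]))
    rwa [hv.limsup_eq] at this
  · have := ENNReal.le_limsup_mul (f := atTop) (u := u) (v := v)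
    rw [hv.liminf_eq, mul_comm] at this
    exact this.trans_eq (by simp only [Pi.mul_def, mul_comm])

variable {m : ℕ} [NeZero m] {S : Set (SymbolicSpace m)} {F : ℕ → ℝ≥0∞} {τ : ℝ≥0∞}

theorem eventually_div_natCast_mul_div_eq (hF : ∀ᶠ N in atTop, F N ≠ 0)
    (hFt : ∀ N, F N ≠ ∞) : ∀ᶠ N : ℕ in atTop, ∀ x : ℝ≥0∞, F N / N * (x / F N) = x / N := by
  filter_upwards [hF] with N hN x
  calc F N / N * (x / F N) = x * (N : ℝ≥0∞)⁻¹ * (F N * (F N)⁻¹) := by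
        rw [div_eq_mul_inv, div_eq_mul_inv]
        ring
    _ = x / N := by rw [ENNReal.mul_inv_cancel hN (hFt N), mul_one, div_eq_mul_inv]

theorem limits_eq (hF : ∀ᶠ N in atTop, F N ≠ 0) (hFt : ∀ N, F N ≠ ∞)
    (hτ : Tendsto (fun N : ℕ => F N / N) atTop (𝓝 τ)) (hτ0 : τ ≠ 0) (hτt : τ ≠ ∞)
    (ω : SymbolicSpace m) :
    liminf (fun N : ℕ => (maxZeroRun ω N : ℝ≥0∞) / (N : ℝ≥0∞)) atTop =
        τ * liminf (fun N => (maxZeroRun ω N : ℝ≥0∞) / F N) atTop ∧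
      limsup (fun N : ℕ => (maxZeroRun ω N : ℝ≥0∞) / (N : ℝ≥0∞)) atTop =
        τ * limsup (fun N => (maxZeroRun ω N : ℝ≥0∞) / F N) atTop := by
  have h : (fun N : ℕ => F N / N * ((maxZeroRun ω N : ℝ≥0∞) / F N)) =ᶠ[atTop]
      fun N : ℕ => (maxZeroRun ω N : ℝ≥0∞) / (N : ℝ≥0∞) := by
    filter_upwards [eventually_div_natCast_mul_div_eq hF hFt] with N hN
    exact hN _
  rw [← liminf_congr h, ← limsup_congr h]
  exact ⟨liminf_mul_of_tendsto hτ hτ0 hτt, limsup_mul_of_tendsto hτ hτ0 hτt⟩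

theorem ratioSet_eq_natCast (hF : ∀ᶠ N in atTop, F N ≠ 0) (hFt : ∀ N, F N ≠ ∞)
    (hτ : Tendsto (fun N : ℕ => F N / N) atTop (𝓝 τ)) (hτ0 : τ ≠ 0) (hτt : τ ≠ ∞)
    (a b : ℝ≥0∞) : ratioSet S F a b = ratioSet S (fun N => N) (τ * a) (τ * b) := by
  ext ω
  obtain ⟨h1, h2⟩ := limits_eq hF hFt hτ hτ0 hτt ω
  rw [ratioSet, ratioSet, mem_ofPred_eq, mem_ofPred_eq, h1, h2,
    ENNReal.mul_le_mul_iff_right hτ0 hτt, ENNReal.mul_right_inj hτ0 hτt]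

theorem ratioSetStar_eq_natCast (hF : ∀ᶠ N in atTop, F N ≠ 0) (hFt : ∀ N, F N ≠ ∞)
    (hτ : Tendsto (fun N : ℕ => F N / N) atTop (𝓝 τ)) (hτ0 : τ ≠ 0) (hτt : τ ≠ ∞)
    (a b : ℝ≥0∞) : ratioSetStar S F a b = ratioSetStar S (fun N => N) (τ * a) (τ * b) := by
  ext ω
  obtain ⟨h1, h2⟩ := limits_eq hF hFt hτ hτ0 hτt ω
  rw [ratioSetStar, ratioSetStar, mem_ofPred_eq, mem_ofPred_eq, h1, h2,
    ENNReal.mul_right_inj hτ0 hτt, ENNReal.mul_right_inj hτ0 hτt]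

theorem tendsto_two_div_natCast :
    Tendsto (fun K : ℕ => ((2 / K : ℝ≥0) : ℝ≥0∞)) atTop (𝓝 0) := by
  have : Tendsto (fun K : ℕ => (2 / K : ℝ≥0)) atTop (𝓝 0) :=
    tendsto_const_div_atTop_nhds_zero_nat 2
  simpa using ENNReal.tendsto_coe.2 this

/-- The condition `b * τ = ∞` covers both `b = ∞` with `τ > 0` and `τ = ∞` with `b > 0`; either way
`L_N / N` has infinite upper limit. -/
theorem dimH_ratioSet_eq_zero (hm : 2 ≤ m) (hF : ∀ᶠ N in atTop, F N ≠ 0) (hFt : ∀ N, F N ≠ ∞)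
    (hτ : Tendsto (fun N : ℕ => F N / N) atTop (𝓝 τ)) (a : ℝ≥0∞) {b : ℝ≥0∞}
    (hb : b * τ = ∞) : dimH (ratioSet S F a b) = 0 := by
  refine le_antisymm (ge_of_tendsto tendsto_two_div_natCast ?_) zero_le
  filter_upwards [eventually_gt_atTop 0] with K hK
  refine (dimH_mono fun ω hω => ?_).trans (dimH_setOf_frequently_long_runs_le hm hK)
  have h1 := ENNReal.le_limsup_mul (f := atTop)
    (u := fun N => (maxZeroRun ω N : ℝ≥0∞) / F N) (v := fun N : ℕ => F N / N)
  rw [hω.2.2, hτ.liminf_eq, hb] at h1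
  have h2 := frequently_lt_of_lt_limsup (by isBoundedDefault)
    ((ENNReal.natCast_lt_top K).trans_le h1)
  refine (h2.and_eventually ((eventually_div_natCast_mul_div_eq hF hFt).and
    (eventually_ge_atTop 1))).mono fun N hN => ?_
  obtain ⟨h3, h4, h5⟩ := hN
  rw [Pi.mul_apply, mul_comm, h4] at h3
  have h6 := (ENNReal.le_div_iff_mul_le (Or.inl (by simp; omega)) (Or.inl (by simp))).1 h3.le
  rw [← Nat.cast_mul] at h6
  exact natCast_le_toENNReal_maxZeroRun.1 h6

/-- If `L_N < K * N` eventually, then `L_N / F N → 0` because `F N / N → ∞`. The other points form a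
set of dimension at most `2 / K`, and `K` is arbitrary. -/
theorem dimH_le_dimH_ratioSetStar_zero (hm : 2 ≤ m)
    (hτ : Tendsto (fun N : ℕ => F N / N) atTop (𝓝 ∞)) :
    dimH S ≤ dimH (ratioSetStar S F 0 0) := by
  have hlim : Tendsto (fun K : ℕ => max (dimH (ratioSetStar S F 0 0)) ((2 / K : ℝ≥0) : ℝ≥0∞))
      atTop (𝓝 (dimH (ratioSetStar S F 0 0))) := by
    simpa using (tendsto_const_nhds (x := dimH (ratioSetStar S F 0 0))).max
      tendsto_two_div_natCast
  refine ge_of_tendsto hlim ?_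
  filter_upwards [eventually_gt_atTop 0] with K hK
  refine le_trans (dimH_mono (t := ratioSetStar S F 0 0 ∪ {ω : SymbolicSpace m |
    ∃ᶠ N in atTop, ((K * N : ℕ) : ℕ∞) ≤ maxZeroRun ω N}) fun ω hω => ?_) ?_
  · by_cases hfreq : ∃ᶠ N in atTop, ((K * N : ℕ) : ℕ∞) ≤ maxZeroRun ω N
    · exact Or.inr hfreq
    · rw [not_frequently] at hfreq
      have hzero : Tendsto (fun N : ℕ => (K : ℝ≥0∞) * (F N / N)⁻¹) atTop (𝓝 0) := by
        have := ENNReal.Tendsto.const_mul (a := (K : ℝ≥0∞)) hτ.inv (Or.inr (by simp))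
        simpa using this
      have hratio : Tendsto (fun N => (maxZeroRun ω N : ℝ≥0∞) / F N) atTop (𝓝 0) := by
        refine tendsto_of_tendsto_of_tendsto_of_le_of_le' tendsto_const_nhds hzero
          (Eventually.of_forall fun _ => zero_le) ?_
        filter_upwards [hfreq, eventually_ge_atTop 1] with N hN hN1
        have h1 := toENNReal_maxZeroRun_le (not_le.1 hN).le
        rw [ENNReal.inv_div (Or.inl (by simp)) (Or.inl (by simp; omega)), ← mul_div_assoc]
        refine ENNReal.div_le_div_right (h1.trans_eq ?_) _
        push_cast
        rfl
      exact Or.inl ⟨hω, hratio.liminf_eq, hratio.limsup_eq⟩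
  · rw [dimH_union]
    exact max_le_max le_rfl (dimH_setOf_frequently_long_runs_le hm hK)

/-- The dimension of the level sets for the linear normalization. -/
theorem dimH_ratioSet_natCast_eq (hS : IsGoodSubshift S) {A B : ℝ} (hA : 0 ≤ A) (hB : 0 < B)
    (hAB : A * (1 + B) ≤ B) :
    dimH (ratioSetStar S (fun N => N) (ENNReal.ofReal A) (ENNReal.ofReal B)) =
        ENNReal.ofReal ((B * (1 - A) - A) / ((1 + B) * (B - A))) * dimH S ∧
      dimH (ratioSet S (fun N => N) (ENNReal.ofReal A) (ENNReal.ofReal B)) =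
        ENNReal.ofReal ((B * (1 - A) - A) / ((1 + B) * (B - A))) * dimH S := by
  have h1 := dimH_ratioSet_le hS.two_le hS.isSubshift hA hB hAB
  have h2 := dimH_mono (ratioSetStar_subset S (fun N => N) (ENNReal.ofReal A) (ENNReal.ofReal B))
  have h3 : ENNReal.ofReal ((B * (1 - A) - A) / ((1 + B) * (B - A))) * dimH S ≤
      dimH (ratioSetStar S (fun N => N) (ENNReal.ofReal A) (ENNReal.ofReal B)) := by
    -- At the endpoint `A * (1 + B) = B` the factor is zero and there is nothing to construct.
    rcases hAB.eq_or_lt with h | h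
    · rw [show B * (1 - A) - A = 0 by linarith, zero_div, ENNReal.ofReal_zero, zero_mul]
      exact zero_le
    · exact mul_dimH_le_dimH_ratioSetStar_natCast hS hA hB h
  exact ⟨le_antisymm (h2.trans h1) h3, le_antisymm h1 (h3.trans h2)⟩

end Compare

/-! ### The normalization given by `ψ` -/

section Normalization

variable {m : ℕ} {ψ : ℝ → ℝ}

theorem tendsto_neg_logb_atTop (hm : 2 ≤ m) (hψpos : ∀ x, 0 < x → 0 < ψ x)
    (hψlim : Tendsto ψ atTop (𝓝 0)) :
    Tendsto (fun N : ℕ => -Real.logb m (ψ N)) atTop atTop := by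
  have hm' : (1 : ℝ) < m := by exact_mod_cast hm
  have h1 : Tendsto (fun N : ℕ => ψ N) atTop (𝓝[>] 0) := by
    refine tendsto_nhdsWithin_iff.2 ⟨hψlim.comp tendsto_natCast_atTop_atTop, ?_⟩
    filter_upwards [eventually_ge_atTop 1] with N hN
    exact hψpos _ (by exact_mod_cast hN)
  exact tendsto_neg_atBot_atTop.comp ((Real.tendsto_logb_nhdsGT_zero hm').comp h1)

/-- Monotonicity extends the control at the single point `N + f N` to all `n` below it. -/
theorem isSlow_neg_logb (hm : 2 ≤ m) (hψpos : ∀ x, 0 < x → 0 < ψ x)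
    (hψlim : Tendsto ψ atTop (𝓝 0)) (hψ : StrictAntiOn ψ (Ioi 0))
    (hdiv : Tendsto (fun N : ℕ => -Real.logb m (ψ N) / N) atTop (𝓝 0))
    (hslow : Tendsto (fun N : ℕ => Real.logb m (ψ (N - Real.logb m (ψ N))) / Real.logb m (ψ N))
      atTop (𝓝 1)) : IsSlow fun N : ℕ => -Real.logb m (ψ N) := by
  have hm' : (1 : ℝ) < m := by exact_mod_cast hm
  have hmono : ∀ x y : ℝ, 0 < x → x ≤ y → -Real.logb m (ψ x) ≤ -Real.logb m (ψ y) :=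
    fun x y hx hxy => neg_le_neg (Real.logb_le_logb_of_le hm' (hψpos y (hx.trans_le hxy))
      (hψ.antitoneOn hx (hx.trans_le hxy) hxy))
  have htop := tendsto_neg_logb_atTop hm hψpos hψlim
  refine ⟨fun i j hi hij => hmono _ _ (by exact_mod_cast hi) (by exact_mod_cast hij), htop, hdiv,
    fun η hη => ?_⟩
  filter_upwards [hslow.eventually_lt_const (by linarith : 1 < 1 + η),
    htop.eventually_gt_atTop 0] with N h1 h2 n hn hle
  have h3 := hmono n _ (by exact_mod_cast hn) hle
  rw [← sub_eq_add_neg] at h3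
  rw [← neg_div_neg_eq, div_lt_iff₀ h2] at h1
  exact h3.trans h1.le

end Normalization

end SymbolicSpace

/-! ### Assembly of the cases of the theorem. -/

open SymbolicSpace in
theorem theorem1p5 (m : ℕ) [NeZero m] (hm : 2 ≤ m)
    (S : Set (SymbolicSpace m)) (hS : IsSubshift S) (hspec : HasSpecification S)
    (hent : 0 < entropy S) (hzero : zeroWord m ∈ S)
    (ψ : ℝ → ℝ) (hψpos : ∀ x, 0 < x → 0 < ψ x) (hψlim : Tendsto ψ atTop (𝓝 0))
    (τ : ℝ≥0∞)
    (hτ : Tendsto (fun N : ℕ => ((-Real.logb m (ψ N) / N : ℝ) : EReal)) atTop (𝓝 (τ : EReal)))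
    (a b : ℝ≥0∞) (hab : a ≤ b) :
    -- finite positive `τ`
    (0 < τ → τ < ∞ →
      (τ⁻¹ ≤ a →
        (b < ∞ → levelSetStar S ψ a b = ∅ ∧ levelSet S ψ a b = ∅) ∧
        (b = ∞ → dimH (levelSetStar S ψ a b) = 0 ∧ dimH (levelSet S ψ a b) = 0)) ∧
      (a < τ⁻¹ →
        (b < a / (1 - τ * a) → levelSetStar S ψ a b = ∅ ∧ levelSet S ψ a b = ∅) ∧
        (a / (1 - τ * a) ≤ b →
          dimH (levelSetStar S ψ a b) = dimFactor τ a b * dimH S ∧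
          dimH (levelSet S ψ a b) = dimFactor τ a b * dimH S))) ∧
    -- infinite `τ`
    (τ = ∞ →
      (0 < b → dimH (levelSetStar S ψ a b) = 0 ∧ dimH (levelSet S ψ a b) = 0) ∧
      (b = 0 → dimH (levelSetStar S ψ a b) = dimH S ∧ dimH (levelSet S ψ a b) = dimH S)) ∧
    -- `τ = 0`
    (τ = 0 → StrictAntiOn ψ (Ioi 0) →
      Tendsto (fun N : ℕ => Real.logb m (ψ (N - Real.logb m (ψ N))) / Real.logb m (ψ N))
        atTop (𝓝 1) →
      dimH (levelSetStar S ψ a b) = dimH S ∧ dimH (levelSet S ψ a b) = dimH S) := by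
  have hgood : IsGoodSubshift S := ⟨hm, hS, hspec, hent, hzero⟩
  set F : ℕ → ℝ≥0∞ := fun N => ENNReal.ofReal (-Real.logb m (ψ N)) with hFdef
  have hlevel : levelSet S ψ a b = ratioSet S F a b := rfl
  have hlevelStar : levelSetStar S ψ a b = ratioSetStar S F a b := rfl
  have htop := tendsto_neg_logb_atTop hm hψpos hψlim
  have hF0 : ∀ᶠ N in atTop, F N ≠ 0 := by
    filter_upwards [htop.eventually_gt_atTop 0] with N hN
    exact (ENNReal.ofReal_pos.2 hN).ne'
  have hFt : ∀ N, F N ≠ ∞ := fun N => ENNReal.ofReal_ne_top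
  have hFτ : Tendsto (fun N : ℕ => F N / N) atTop (𝓝 τ) := by
    have h1 := (EReal.continuous_toENNReal.tendsto _).comp hτ
    rw [EReal.toENNReal_coe] at h1
    refine h1.congr' ?_
    filter_upwards [eventually_ge_atTop 1] with N hN
    have hN' : (0 : ℝ) < N := by exact_mod_cast hN
    rw [Function.comp_apply, EReal.toENNReal_of_ne_top (EReal.coe_ne_top _), EReal.toReal_coe,
      ENNReal.ofReal_div_of_pos hN', ENNReal.ofReal_natCast]
  have hsub := ratioSetStar_subset S F a b
  have hSsub : dimH (ratioSet S F a b) ≤ dimH S := dimH_mono fun _ h => h.1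
  have hfull : dimH S ≤ dimH (ratioSetStar S F a b) →
      dimH (ratioSetStar S F a b) = dimH S ∧ dimH (ratioSet S F a b) = dimH S := fun h =>
    ⟨le_antisymm ((dimH_mono hsub).trans hSsub) h,
      le_antisymm hSsub (h.trans (dimH_mono hsub))⟩
  have hnull : b * τ = ∞ → dimH (ratioSetStar S F a b) = 0 ∧ dimH (ratioSet S F a b) = 0 :=
    fun h => by
      have h1 := dimH_ratioSet_eq_zero (S := S) hm hF0 hFt hFτ a h
      exact ⟨le_antisymm ((dimH_mono hsub).trans h1.le) zero_le, h1⟩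
  have hempty : ratioSet S F a b = ∅ → ratioSetStar S F a b = ∅ ∧ ratioSet S F a b = ∅ :=
    fun h => ⟨Set.subset_empty_iff.1 (hsub.trans h.subset), h⟩
  rw [hlevel, hlevelStar]
  refine ⟨fun hτ0 hτt => ?_, fun hτt => ⟨fun hb => hnull ?_, ?_⟩, fun hτ0 hψ hslow => hfull ?_⟩
  · have hbtop : b = ∞ → b * τ = ∞ := fun h => by rw [h, ENNReal.top_mul hτ0.ne']
    obtain ⟨t, ht0, rfl⟩ : ∃ t : ℝ, 0 < t ∧ τ = ENNReal.ofReal t :=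
      ⟨τ.toReal, ENNReal.toReal_pos hτ0.ne' hτt.ne, (ENNReal.ofReal_toReal hτt.ne).symm⟩
    have hlin := ratioSet_eq_natCast (S := S) hF0 hFt hFτ hτ0.ne' hτt.ne a b
    have hlinStar := ratioSetStar_eq_natCast (S := S) hF0 hFt hFτ hτ0.ne' hτt.ne a b
    rw [← ENNReal.ofReal_inv_of_pos ht0]
    refine ⟨fun ha => ⟨fun hb => hempty ?_, fun hb => hnull (hbtop hb)⟩, fun ha => ?_⟩
    · obtain ⟨x, hx0, rfl⟩ : ∃ x : ℝ, 0 ≤ x ∧ a = ENNReal.ofReal x :=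
        ⟨a.toReal, ENNReal.toReal_nonneg, (ENNReal.ofReal_toReal (hab.trans_lt hb).ne).symm⟩
      obtain ⟨y, hy0, rfl⟩ : ∃ y : ℝ, 0 ≤ y ∧ b = ENNReal.ofReal y :=
        ⟨b.toReal, ENNReal.toReal_nonneg, (ENNReal.ofReal_toReal hb.ne).symm⟩
      rw [ENNReal.ofReal_le_ofReal_iff hx0, inv_le_iff_one_le_mul₀' ht0] at ha
      rw [hlin, ← ENNReal.ofReal_mul ht0.le, ← ENNReal.ofReal_mul ht0.le]
      have hty : 0 ≤ t * y := by positivity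
      -- Here `t * x ≥ 1`, so the left side of `B * (1 - A) < A` is nonpositive.
      exact ratioSet_eq_empty S (by linarith) hty (by nlinarith)
    · obtain ⟨x, hx0, rfl⟩ : ∃ x : ℝ, 0 ≤ x ∧ a = ENNReal.ofReal x :=
        ⟨a.toReal, ENNReal.toReal_nonneg, (ENNReal.ofReal_toReal ha.ne_top).symm⟩
      rw [ENNReal.ofReal_lt_ofReal_iff (inv_pos.2 ht0)] at ha
      have htx : t * x < 1 := by
        have := mul_lt_mul_of_pos_left ha ht0
        rwa [mul_inv_cancel₀ ht0.ne'] at this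
      have hdiv : ENNReal.ofReal x / (1 - ENNReal.ofReal t * ENNReal.ofReal x) =
          ENNReal.ofReal (x / (1 - t * x)) := by
        rw [ENNReal.ofReal_div_of_pos (by linarith), ENNReal.ofReal_sub _ (by positivity),
          ENNReal.ofReal_one, ENNReal.ofReal_mul ht0.le]
      rw [hdiv]
      by_cases hbt : b = ∞
      · refine ⟨fun h => absurd (hbt ▸ h) (by simp), fun _ => ?_⟩
        have : dimFactor (ENNReal.ofReal t) (ENNReal.ofReal x) b = 0 := by
          rw [dimFactor, if_neg (by simp [hbt]), if_pos hbt]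
        rw [this, zero_mul]
        exact hnull (hbtop hbt)
      obtain ⟨y, hy0, rfl⟩ : ∃ y : ℝ, 0 ≤ y ∧ b = ENNReal.ofReal y :=
        ⟨b.toReal, ENNReal.toReal_nonneg, (ENNReal.ofReal_toReal hbt).symm⟩
      have hty : 0 ≤ t * y := by positivity
      refine ⟨fun h => hempty ?_, fun h => ?_⟩
      · rw [ENNReal.ofReal_lt_ofReal_iff_of_nonneg hy0, lt_div_iff₀ (by linarith)] at h
        rw [hlin, ← ENNReal.ofReal_mul ht0.le, ← ENNReal.ofReal_mul ht0.le]
        have h1 : t * y * (1 - t * x) < t * x := by nlinarith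
        exact ratioSet_eq_empty S (by nlinarith) hty h1
      · rw [ENNReal.ofReal_le_ofReal_iff hy0, div_le_iff₀ (by linarith)] at h
        rcases hy0.eq_or_lt with rfl | hy
        · obtain rfl : x = 0 := le_antisymm (by linarith) hx0
          rw [dimFactor, if_pos (by simp), one_mul]
          refine hfull ?_
          rw [hlinStar, ENNReal.ofReal_zero, mul_zero]
          exact isNormalization_natCast.dimH_zero_zero hgood
        · have hxy : x < y := by
            rcases hx0.eq_or_lt with rfl | hx
            · exact hy
            · nlinarith [mul_pos ht0 hx]
          have hfac : dimFactor (ENNReal.ofReal t) (ENNReal.ofReal x) (ENNReal.ofReal y) =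
              ENNReal.ofReal ((t * y * (1 - t * x) - t * x) /
                ((1 + t * y) * (t * y - t * x))) := by
            rw [dimFactor, if_neg (by simp [hy]), if_neg (by simp),
              ENNReal.toReal_ofReal ht0.le, ENNReal.toReal_ofReal hx0,
              ENNReal.toReal_ofReal hy0]
            congr 1
            have : y - x ≠ 0 := by linarith
            have : t * y - t * x ≠ 0 := by
              rw [← mul_sub]
              positivity
            have : 1 + t * y ≠ 0 := by positivity
            rw [div_eq_div_iff (by positivity) (by positivity)]
            ring
          rw [hlin, hlinStar, hfac, ← ENNReal.ofReal_mul ht0.le, ← ENNReal.ofReal_mul ht0.le]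
          exact dimH_ratioSet_natCast_eq hgood (by positivity) (by positivity) (by nlinarith)
  · rw [hτt, ENNReal.mul_top hb.ne']
  · rintro rfl
    obtain rfl : a = 0 := le_antisymm hab zero_le
    rw [hτt] at hFτ
    exact hfull (dimH_le_dimH_ratioSetStar_zero hm hFτ)
  · have hdiv : Tendsto (fun N : ℕ => -Real.logb m (ψ N) / N) atTop (𝓝 0) := by
      rw [hτ0] at hτ
      exact EReal.tendsto_coe.1 (by simpa using hτ)
    exact (isSlow_neg_logb hm hψpos hψlim hψ hdiv hslow).dimH_le hgood hab
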